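/- Let $\ell$ be an odd prime. For a number field $F$ put $\mathcal R_F=\mathbb Z_\ell\otimes_{\mathbb Z}F^\times$, and for a place $\lambda\mid\ell$ let $\mathcal R_{F_\lambda}=\varprojlim_n F_\lambda^\times/F_\lambda^{\times\ell^n}$. Let $\mathcal D'_F$ be the free $\mathbb Z_\ell$-module on the finite primes of $F$ not dividing $\ell$. An element of $\mathcal R_F$ is called infinitesimal (resp. pseudo-infinitesimal) if for every $\lambda\mid\ell$ its image in $\mathcal R_{F_\lambda}$ is trivial (resp. lies in the group of $\ell$-power roots of unity of $F_\lambda$). Let $Cl_F^{bp}=\mathcal D'_F/\mathcal P_F^{bp}$, where $\mathcal P_F^{bp}$ is the group of divisors (prime to $\ell$) of pseudo-infinitesimal elements. Let $\mathrm{Log}:\mathbb Q_\ell^\times\to\mathbb Q_\ell$ be the Iwasawa logarithm ($\mathrm{Log}\,\ell=0$). A logarithmic divisor of $F$ is a pair consisting of an element $\sum_{v\nmid\ell}a_v v$ of $\mathcal D'_F$ and a family $(b_\lambda)_{\lambda\mid\ell}$ with $b_\lambda\in\mathbb Z_\ell\cdot\mathrm{Log}(N_{F_\lambda/\mathbb Q_\ell}F_\lambda^\times)$;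 its degree is $\sum_v a_v\mathrm{Log}(Nv)+\sum_\lambda b_\lambda$. The logarithmic divisor of $x\in\mathcal R_F$ is given by $a_v=v(x)$ and $b_\lambda=-\mathrm{Log}(N_{F_\lambda/\mathbb Q_\ell}x)$. The group $\widetilde{Cl}_F$ of logarithmic classes is the group of logarithmic divisors of degree $0$ modulo the logarithmic divisors of elements of $\mathcal R_F$. The Gross–Kuz'min conjecture for $F$ (and $\ell$) asserts that $\widetilde{Cl}_F$ is finite; the Leopoldt conjecture for $F$ (and $\ell$) asserts that the only infinitesimal element of $\mathcal R_F$ whose divisor prime to $\ell$ is zero is the trivial one. $F^c$ denotes the cyclotomic $\mathbb Z_\ell$-extension of a field $F$. An extension $L/K$ of number fields is locally cyclotomic if for every place $v$ of $K$ and every place $w\mid v$ of $L$ one has $L_w\subseteq K_v^c$. For a divisor $\mathfrak a\in\mathcal D'_K$ consider the properties: (A) $\mathfrak a$ represents a nontrivial class of $Cl_K^{bp}$ which becomes trivial in $Cl_L^{bp}$; (B) $\mathfrak a$, viewed as a logarithmic divisor, has degree $0$ and represents a nontrivial class of $\widetilde{Cl}_K$ which becomes trivial in $\widetilde{Cl}_L$.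 The extension $L/K$ is of class type if some $\mathfrak a\in\mathcal D'_K$ satisfies (A) and (B). **Proposition.** Let $K_+$ be a totally real number field and let $K$ be a totally imaginary quadratic extension of $K_+$ containing the $\ell$-th roots of unity. Let $L_+/K_+$ be a cyclic extension of degree $\ell$ not contained in the cyclotomic $\mathbb Z_\ell$-extension $K_+^c$, and let $L=KL_+$. Assume that $L/K$ is locally cyclotomic and that the Gross–Kuz'min conjecture holds for $K$ and $\ell$. Then $L/K$ is of class type. If moreover the Leopoldt conjecture holds for $L$ and $\ell$, then every $\mathfrak a\in\mathcal D'_K$ satisfying (A) satisfies (B). -/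

import Mathlib

open scoped TensorProduct NumberField
open IsDedekindDomain Filter Topology

noncomputable section

namespace LogClasses

/-! ### The Iwasawa logarithm on `ℚ_ℓ` -/

section Log

variable (ℓ : ℕ) [Fact ℓ.Prime]

/-- The projection `x ↦ (x / ℓ ^ v(x)) ^ (ℓ - 1)` of a nonzero `ℓ`-adic number to the principal
units `1 + ℓ ℤ_ℓ`. -/
def principalUnit (x : ℚ_[ℓ]) : ℚ_[ℓ] := (x * (ℓ : ℚ_[ℓ]) ^ (-x.valuation)) ^ (ℓ - 1)

/-- The approximations `(u ^ (ℓ ^ k) - 1) / ℓ ^ k` whose limit is the logarithm of a principal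
unit `u`. -/
def logApprox (u : ℚ_[ℓ]) (k : ℕ) : ℚ_[ℓ] := (u ^ ℓ ^ k - 1) / (ℓ : ℚ_[ℓ]) ^ k

/-- The Iwasawa logarithm `Log : ℚ_ℓˣ → ℚ_ℓ`: the usual `ℓ`-adic logarithm
`log u = lim (u ^ (ℓ ^ k) - 1) / ℓ ^ k` on principal units, extended so that it kills `ℓ` and the
roots of unity. The value at `0` is not used. -/
def iwasawaLog (x : ℚ_[ℓ]) : ℚ_[ℓ] :=
  limUnder atTop (logApprox ℓ (principalUnit ℓ x)) / ((ℓ : ℚ_[ℓ]) - 1)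

variable {ℓ}

theorem principalUnit_mul {x y : ℚ_[ℓ]} (hx : x ≠ 0) (hy : y ≠ 0) :
    principalUnit ℓ (x * y) = principalUnit ℓ x * principalUnit ℓ y := by
  have hl : (ℓ : ℚ_[ℓ]) ≠ 0 := by exact_mod_cast (Fact.out : ℓ.Prime).ne_zero
  unfold principalUnit
  rw [Padic.valuation_mul hx hy, neg_add, zpow_add₀ hl, ← mul_pow]
  congr 1
  ring

/-- The principal unit attached to `x ≠ 0` is congruent to `1` modulo `ℓ`. -/
theorem exists_principalUnit_eq {x : ℚ_[ℓ]} (hx : x ≠ 0) :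
    ∃ z : ℤ_[ℓ], principalUnit ℓ x = ((1 + ℓ * z : ℤ_[ℓ]) : ℚ_[ℓ]) := by
  have hp : ℓ.Prime := Fact.out
  have hl : (ℓ : ℚ_[ℓ]) ≠ 0 := by exact_mod_cast hp.ne_zero
  set w : ℚ_[ℓ] := x * (ℓ : ℚ_[ℓ]) ^ (-x.valuation) with hw
  have hn : ‖w‖ = 1 := by
    have hl' : (ℓ : ℝ) ≠ 0 := by exact_mod_cast hp.ne_zero
    rw [hw, norm_mul, Padic.norm_p_zpow, Padic.norm_eq_zpow_neg_valuation hx, ← zpow_add₀ hl']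
    simp
  obtain ⟨u, hu⟩ : ∃ u : ℤ_[ℓ], (u : ℚ_[ℓ]) = w := ⟨⟨w, hn.le⟩, rfl⟩
  have hu1 : IsUnit u := by
    rw [PadicInt.isUnit_iff]
    rw [← hn, ← hu]; rfl
  have hne : PadicInt.toZMod u ≠ 0 := (hu1.map PadicInt.toZMod).ne_zero
  have h1 : PadicInt.toZMod (u ^ (ℓ - 1) - 1) = 0 := by
    rw [map_sub, map_pow, ZMod.pow_card_sub_one_eq_one hne, map_one, sub_self]
  have h2 : u ^ (ℓ - 1) - 1 ∈ RingHom.ker (PadicInt.toZMod (p := ℓ)) := h1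
  rw [PadicInt.ker_toZMod, PadicInt.maximalIdeal_eq_span_p, Ideal.mem_span_singleton] at h2
  obtain ⟨z, hz⟩ := h2
  refine ⟨z, ?_⟩
  have h3 : u ^ (ℓ - 1) = 1 + ℓ * z := by rw [← hz]; ring
  rw [← h3, principalUnit, ← hw, ← hu]
  push_cast
  rfl

theorem pow_sub_one_dvd (z : ℤ_[ℓ]) (k : ℕ) :
    (ℓ : ℤ_[ℓ]) ^ (k + 1) ∣ (1 + ℓ * z) ^ ℓ ^ k - 1 := by
  induction k with
  | zero => exact ⟨z, by ring⟩
  | succ k ih =>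
    obtain ⟨t, ht⟩ := ih
    obtain ⟨c, hc⟩ := Polynomial.powAddExpansion (1 : ℤ_[ℓ]) ((ℓ : ℤ_[ℓ]) ^ (k + 1) * t) ℓ
    have h : (1 + ℓ * z) ^ ℓ ^ k = 1 + (ℓ : ℤ_[ℓ]) ^ (k + 1) * t := by rw [← ht]; ring
    rw [pow_succ ℓ k, pow_mul, h, hc]
    refine ⟨t + c * ℓ ^ k * t ^ 2, ?_⟩
    simp only [one_pow, mul_one]
    ring

theorem exists_tendsto_logApprox (z : ℤ_[ℓ]) :
    ∃ a : ℚ_[ℓ], Tendsto (logApprox ℓ ((1 + ℓ * z : ℤ_[ℓ]) : ℚ_[ℓ])) atTop (𝓝 a) := by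
  have hp : ℓ.Prime := Fact.out
  have hl : (ℓ : ℚ_[ℓ]) ≠ 0 := by exact_mod_cast hp.ne_zero
  have hr : ‖(ℓ : ℚ_[ℓ])‖ < 1 := Padic.norm_p_lt_one
  refine cauchySeq_tendsto_of_complete (cauchySeq_of_le_geometric ‖(ℓ : ℚ_[ℓ])‖ 1 hr ?_)
  intro k
  obtain ⟨t, ht⟩ := pow_sub_one_dvd z k
  obtain ⟨c, hc⟩ := Polynomial.powAddExpansion (1 : ℤ_[ℓ]) ((ℓ : ℤ_[ℓ]) ^ (k + 1) * t) ℓ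
  have h : (1 + ℓ * z) ^ ℓ ^ k = 1 + (ℓ : ℤ_[ℓ]) ^ (k + 1) * t := by rw [← ht]; ring
  have h' : (1 + ℓ * z) ^ ℓ ^ (k + 1) = 1 + ℓ * ((ℓ : ℤ_[ℓ]) ^ (k + 1) * t)
      + c * ((ℓ : ℤ_[ℓ]) ^ (k + 1) * t) ^ 2 := by
    rw [pow_succ ℓ k, pow_mul, h, hc]; simp
  have e1 : logApprox ℓ ((1 + ℓ * z : ℤ_[ℓ]) : ℚ_[ℓ]) k = ((ℓ * t : ℤ_[ℓ]) : ℚ_[ℓ]) := by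
    rw [logApprox, ← PadicInt.coe_pow, h]
    push_cast
    field_simp
    ring
  have e2 : logApprox ℓ ((1 + ℓ * z : ℤ_[ℓ]) : ℚ_[ℓ]) (k + 1)
      = ((ℓ * t + ℓ ^ (k + 1) * (c * t ^ 2) : ℤ_[ℓ]) : ℚ_[ℓ]) := by
    rw [logApprox, ← PadicInt.coe_pow, h']
    push_cast
    field_simp
    ring
  rw [e1, e2, dist_eq_norm, ← PadicInt.coe_sub, one_mul]
  have e3 : (ℓ * t - (ℓ * t + ℓ ^ (k + 1) * (c * t ^ 2)) : ℤ_[ℓ])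
      = ℓ ^ k * (-(ℓ * (c * t ^ 2))) := by ring
  rw [e3, PadicInt.coe_mul, norm_mul, PadicInt.coe_pow, PadicInt.coe_natCast, norm_pow]
  exact mul_le_of_le_one_right (by positivity) (PadicInt.norm_le_one _)

theorem tendsto_pow (z : ℤ_[ℓ]) :
    Tendsto (fun k => ((1 + ℓ * z : ℤ_[ℓ]) : ℚ_[ℓ]) ^ ℓ ^ k) atTop (𝓝 1) := by
  have hp : ℓ.Prime := Fact.out
  have hl : (ℓ : ℚ_[ℓ]) ≠ 0 := by exact_mod_cast hp.ne_zero
  have hr : ‖(ℓ : ℚ_[ℓ])‖ < 1 := Padic.norm_p_lt_one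
  obtain ⟨a, ha⟩ := exists_tendsto_logApprox z
  have h := (ha.mul (tendsto_pow_atTop_nhds_zero_of_norm_lt_one hr)).const_add 1
  rw [mul_zero, add_zero] at h
  refine h.congr fun k => ?_
  rw [logApprox]
  field_simp
  ring

theorem iwasawaLog_mul {x y : ℚ_[ℓ]} (hx : x ≠ 0) (hy : y ≠ 0) :
    iwasawaLog ℓ (x * y) = iwasawaLog ℓ x + iwasawaLog ℓ y := by
  obtain ⟨z, hz⟩ := exists_principalUnit_eq hx
  obtain ⟨w, hw⟩ := exists_principalUnit_eq hy
  obtain ⟨a, ha⟩ := exists_tendsto_logApprox z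
  obtain ⟨b, hb⟩ := exists_tendsto_logApprox w
  have hab : Tendsto (logApprox ℓ (principalUnit ℓ (x * y))) atTop (𝓝 (a + b)) := by
    have h := (ha.mul (tendsto_pow w)).add hb
    rw [mul_one] at h
    refine h.congr fun k => ?_
    rw [principalUnit_mul hx hy, hz, hw, logApprox, logApprox, logApprox, mul_pow]
    ring
  rw [iwasawaLog, iwasawaLog, iwasawaLog, hab.limUnder_eq, hz, hw, ha.limUnder_eq, hb.limUnder_eq,
    add_div]

variable (ℓ) in
/-- The Iwasawa logarithm as a homomorphism `ℚ_ℓˣ → ℚ_ℓ`. -/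
def iwasawaLogHom : Additive ℚ_[ℓ]ˣ →+ ℚ_[ℓ] :=
  AddMonoidHom.mk' (fun x => iwasawaLog ℓ ((x.toMul : ℚ_[ℓ]ˣ) : ℚ_[ℓ])) fun x y => by
    rw [toMul_add, Units.val_mul, iwasawaLog_mul x.toMul.ne_zero y.toMul.ne_zero]

end Log

/-! ### Cyclotomic `ℤ_ℓ`-extensions and completions -/

/-- For `ℓ` odd and `Ω` algebraically closed of characteristic `0`, these elements form the
cyclotomic `ℤ_ℓ`-extension `ℚᶜ` of `ℚ` in `Ω`: the elements of `ℚ(μ_{ℓ^∞})` whose degree over `ℚ`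
is a power of `ℓ` (recall that `Gal(ℚ(μ_{ℓ^∞})/ℚ) ≃ ℤ/(ℓ-1) × ℤ_ℓ`). -/
def ratCyclotomicZl (ℓ : ℕ) (Ω : Type*) [Field Ω] [CharZero Ω] : Set Ω :=
  {x | x ∈ IntermediateField.adjoin ℚ {ζ : Ω | ∃ n : ℕ, ζ ^ ℓ ^ n = 1} ∧
    ∃ k : ℕ, (minpoly ℚ x).natDegree = ℓ ^ k}

/-- The cyclotomic `ℤ_ℓ`-extension `Fᶜ = F ℚᶜ` of a field `F` of characteristic `0`, inside an
algebraically closed extension `Ω`. -/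
def cyclotomicZl (ℓ : ℕ) (F Ω : Type*) [Field F] [Field Ω] [Algebra F Ω] [CharZero Ω] :
    IntermediateField F Ω :=
  IntermediateField.adjoin F (ratCyclotomicZl ℓ Ω)

/-- `E/F` is (globally) cyclotomic: `E` embeds over `F` in the cyclotomic `ℤ_ℓ`-extension
of `F`. -/
def IsGloballyCyclotomic (ℓ : ℕ) (F E : Type*) [Field F] [CharZero F] [Field E] [Algebra F E] :
    Prop :=
  ∃ σ : E →ₐ[F] AlgebraicClosure F,
    σ.fieldRange ≤ cyclotomicZl ℓ F (AlgebraicClosure F)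

section Local

variable {p : ℕ} [Fact p.Prime] {F : Type*} [Field F]

/-- An embedding `σ` of a number field `F` in an algebraic closure of `ℚ_p` induces a place of `F`
above `p`; the completion of `F` at this place is the field `ℚ_p(σ F)`. -/
def localField (σ : F →+* PadicAlgCl p) : IntermediateField ℚ_[p] (PadicAlgCl p) :=
  IntermediateField.adjoin ℚ_[p] (Set.range σ)

/-- The canonical map from `F` to its completion. -/
def toLocalField (σ : F →+* PadicAlgCl p) : F →+* localField σ :=
  σ.codRestrict (localField σ).toSubfield.toSubring
    fun x => IntermediateField.subset_adjoin _ _ ⟨x, rfl⟩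

end Local

/-- `L/K` is locally cyclotomic (with respect to `ℓ`): at every finite place of `L`, the
completion of `L` is contained in the cyclotomic `ℤ_ℓ`-extension of the completion of `K`. Every
finite place of `L` is induced by an embedding in some `PadicAlgCl p`. (At an infinite place the
condition is empty, since an extension of odd degree is locally trivial there.) -/
def IsLocallyCyclotomic (ℓ : ℕ) (K L : Type*) [Field K] [Field L] [Algebra K L] : Prop :=
  ∀ (p : ℕ) [Fact p.Prime] (σ : L →+* PadicAlgCl p),
    localField σ ≤
      localField (σ.comp (algebraMap K L)) ⊔ cyclotomicZl ℓ ℚ_[p] (PadicAlgCl p)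

/-! ### The places above `ℓ`, and the `ℓ`-adified multiplicative groups -/

section Places

variable (ℓ : ℕ) [Fact ℓ.Prime] (K : Type*) [Field K]

/-- Two `ℓ`-adic embeddings of `K` induce the same place iff they are conjugate over `ℚ_ℓ`. -/
def embeddingSetoid : Setoid (K →+* PadicAlgCl ℓ) where
  r σ τ := ∃ g : PadicAlgCl ℓ ≃ₐ[ℚ_[ℓ]] PadicAlgCl ℓ,
    τ = (g : PadicAlgCl ℓ →+* PadicAlgCl ℓ).comp σ
  iseqv :=
    { refl := fun σ => ⟨AlgEquiv.refl, by ext; rfl⟩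
      symm := by
        rintro σ _ ⟨g, rfl⟩
        exact ⟨g.symm, by ext x; simp⟩
      trans := by
        rintro σ _ _ ⟨g, rfl⟩ ⟨h, rfl⟩
        exact ⟨g.trans h, by ext x; simp⟩ }

/-- The places of `K` above `ℓ`. -/
def WildPlace : Type _ := Quotient (embeddingSetoid ℓ K)

instance [NumberField K] : Finite (WildPlace ℓ K) :=
  inferInstanceAs (Finite (Quotient (embeddingSetoid ℓ K)))

instance [NumberField K] : Fintype (WildPlace ℓ K) := Fintype.ofFinite _

/-- The finite places of `K` prime to `ℓ`. -/
abbrev TamePlace : Type _ := {v : HeightOneSpectrum (𝓞 K) // (ℓ : 𝓞 K) ∉ v.asIdeal}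

/-- `ℛ_F = ℤ_ℓ ⊗ Fˣ`, written additively. -/
abbrev AdicMul (F : Type*) [Field F] : Type _ := ℤ_[ℓ] ⊗[ℤ] Additive Fˣ

/-- Functoriality of `ℛ`. -/
def AdicMul.map {F E : Type*} [Field F] [Field E] (f : F →+* E) :
    AdicMul ℓ F →ₗ[ℤ_[ℓ]] AdicMul ℓ E :=
  LinearMap.baseChange ℤ_[ℓ]
    (MonoidHom.toAdditive (Units.map (f : F →* E))).toIntLinearMap

variable {ℓ K}

/-- The completion `K_λ` of `K` at a place `λ` above `ℓ`, realised inside `PadicAlgCl ℓ` by means of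
an embedding inducing `λ`. -/
abbrev WildPlace.completion (l : WildPlace ℓ K) : IntermediateField ℚ_[ℓ] (PadicAlgCl ℓ) :=
  localField (Quotient.out l)

/-- The `ℓ`-adic compactification `ℛ_{K_λ} = lim K_λˣ / (K_λˣ)^(ℓ^n)` of `K_λˣ`, as the
`ℓ`-adic completion of `ℤ_ℓ ⊗ K_λˣ`. -/
abbrev WildPlace.CompactMul (l : WildPlace ℓ K) : Type _ :=
  AdicCompletion (Ideal.span {(ℓ : ℤ_[ℓ])}) (AdicMul ℓ l.completion)

/-- The localization map `ℛ_K → ℛ_{K_λ}`. -/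
def WildPlace.localize (l : WildPlace ℓ K) : AdicMul ℓ K →ₗ[ℤ_[ℓ]] l.CompactMul :=
  (AdicCompletion.of (Ideal.span {(ℓ : ℤ_[ℓ])}) (AdicMul ℓ l.completion)).comp
    (AdicMul.map ℓ (toLocalField (Quotient.out l)))

/-- The subgroup `μ_{K_λ}` of `ℛ_{K_λ}` given by the roots of unity of `ℓ`-power order of `K_λ`. -/
def WildPlace.rootsOfUnity (l : WildPlace ℓ K) : Submodule ℤ_[ℓ] l.CompactMul :=
  Submodule.span ℤ_[ℓ] {x | ∃ (ζ : (l.completion)ˣ) (n : ℕ), ζ ^ ℓ ^ n = 1 ∧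
    x = AdicCompletion.of (Ideal.span {(ℓ : ℤ_[ℓ])}) (AdicMul ℓ l.completion)
      (1 ⊗ₜ[ℤ] Additive.ofMul ζ)}

variable (ℓ K)

/-- The infinitesimal elements `ℛ_K^∞`: the elements of `ℛ_K` with trivial image at all the places
above `ℓ`. -/
def infinitesimal : Submodule ℤ_[ℓ] (AdicMul ℓ K) :=
  ⨅ l : WildPlace ℓ K, LinearMap.ker l.localize

/-- The pseudo-infinitesimal elements `ℛ_K^{bp}`: the elements of `ℛ_K` which are roots of unity
at all the places above `ℓ`. -/
def pseudoInfinitesimal : Submodule ℤ_[ℓ] (AdicMul ℓ K) :=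
  ⨅ l : WildPlace ℓ K, l.rootsOfUnity.comap l.localize

end Places

/-! ### Divisors prime to `ℓ` -/

section Divisors

variable (ℓ : ℕ) [Fact ℓ.Prime] (K : Type*) [Field K] [NumberField K]

/-- `𝒟'_K = ℤ_ℓ ⊗ Id'_K`, the `ℤ_ℓ`-module of divisors of `K` prime to `ℓ`. -/
abbrev Divisor : Type _ := TamePlace ℓ K →₀ ℤ_[ℓ]

variable {K} in
/-- The usual normalised valuation `K^× → ℤ` (written additively). -/
def ord (v : HeightOneSpectrum (𝓞 K)) (x : Kˣ) : ℤ := -(v.valuationOfNeZero x).toAdd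

theorem ord_mul (v : HeightOneSpectrum (𝓞 K)) (x y : Kˣ) : ord v (x * y) = ord v x + ord v y := by
  simp only [ord, map_mul, toAdd_mul]
  ring

theorem ord_support_finite (x : Kˣ) : {v : HeightOneSpectrum (𝓞 K) | ord v x ≠ 0}.Finite := by
  refine ((HeightOneSpectrum.Support.finite (𝓞 K) (x : K)).union
    (HeightOneSpectrum.Support.finite (𝓞 K) ((x⁻¹ : Kˣ) : K))).subset ?_
  intro v hv
  have h0 : v.valuation K (x : K) ≠ 0 := by simp
  have h1 : v.valuation K (x : K) ≠ 1 := by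
    intro h
    rw [← HeightOneSpectrum.valuationOfNeZero_eq, ← WithZero.coe_one, WithZero.coe_inj] at h
    exact hv (by simp [ord, h])
  rcases lt_or_gt_of_ne h1 with h | h
  · right
    change 1 < v.valuation K _
    rw [Units.val_inv_eq_inv_val, map_inv₀]
    exact (one_lt_inv₀ (zero_lt_iff.mpr h0)).mpr h
  · left
    exact h

/-- The divisor prime to `ℓ` of an element of `Kˣ`. -/
def divUnits : Additive Kˣ →+ Divisor ℓ K :=
  AddMonoidHom.mk' (fun x => Finsupp.ofSupportFinite
      (fun v : TamePlace ℓ K => ((ord v.1 x.toMul : ℤ) : ℤ_[ℓ]))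
      (((ord_support_finite K x.toMul).preimage Subtype.val_injective.injOn).subset
        fun v hv => by
          intro h
          exact hv (by simp [h])))
    fun x y => by
      ext v
      simp [Finsupp.ofSupportFinite, ord_mul]
      rfl

/-- The divisor map `ℛ_K → 𝒟'_K`. -/
def div : AdicMul ℓ K →ₗ[ℤ_[ℓ]] Divisor ℓ K :=
  LinearMap.liftBaseChange ℤ_[ℓ] (divUnits ℓ K).toIntLinearMap

/-- `𝒫_K^{bp}`: the principal divisors generated by pseudo-infinitesimal elements. -/
def bpPrincipal : Submodule ℤ_[ℓ] (Divisor ℓ K) := (pseudoInfinitesimal ℓ K).map (div ℓ K)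

/-- The group `Cl_K^{bp}` of pseudo-infinitesimal classes. -/
abbrev BPClassGroup : Type _ := Divisor ℓ K ⧸ bpPrincipal ℓ K

/-- The Leopoldt conjecture for `ℓ` and `K`: the only infinitesimal unit is trivial. -/
def Leopoldt : Prop := infinitesimal ℓ K ⊓ LinearMap.ker (div ℓ K) = ⊥

end Divisors

section Extension

variable (ℓ : ℕ) [Fact ℓ.Prime] (K L : Type*) [Field K] [NumberField K] [Field L] [NumberField L]
  [Algebra K L]

variable {L} in
/-- The place of `K` below a finite place of `L` prime to `ℓ`. -/
def TamePlace.below (w : TamePlace ℓ L) : TamePlace ℓ K :=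
  ⟨w.1.under (𝓞 K), fun h => w.2 (by
    have h' : (ℓ : 𝓞 K) ∈ w.1.asIdeal.under (𝓞 K) := h
    simpa [Ideal.mem_comap] using h')⟩

theorem TamePlace.below_finite (v : TamePlace ℓ K) :
    {w : TamePlace ℓ L | w.below ℓ K = v}.Finite := by
  have := v.1.isMaximal
  refine Set.Finite.subset ((IsDedekindDomain.primesOver_finite v.1.asIdeal (𝓞 L)).preimage
    (f := fun w : TamePlace ℓ L => w.1.asIdeal) ?_) ?_
  · intro w _ w' _ h
    exact Subtype.ext (HeightOneSpectrum.ext h)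
  · rintro w rfl
    exact ⟨w.1.isPrime, ⟨rfl⟩⟩

/-- Extension of divisors `𝒟'_K → 𝒟'_L`, sending a prime `v` to `∑ e(w/v) w` over the primes `w`
above `v`. -/
def extendDivisor : Divisor ℓ K →ₗ[ℤ_[ℓ]] Divisor ℓ L where
  toFun a := Finsupp.ofSupportFinite
    (fun w => (w.1.asIdeal.ramificationIdx (𝓞 K) : ℤ_[ℓ]) * a (w.below ℓ K))
    ((a.support.finite_toSet.biUnion fun v _ => TamePlace.below_finite ℓ K L v).subset
      fun w hw => by
        simp only [Set.mem_iUnion]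
        refine ⟨w.below ℓ K, ?_, rfl⟩
        simp only [Finset.mem_coe, Finsupp.mem_support_iff]
        intro h
        exact hw (by simp [h]))
  map_add' a b := by
    ext w
    simp [Finsupp.ofSupportFinite, mul_add]
  map_smul' c a := by
    ext w
    simp [Finsupp.ofSupportFinite, mul_left_comm]

end Extension

/-! ### Logarithmic divisors and logarithmic classes -/

section Logarithmic

variable (ℓ : ℕ) [Fact ℓ.Prime] (K : Type*) [Field K]

variable {ℓ K} in
/-- The map `x ↦ - Log (N_{K_λ/ℚ_ℓ} x)`, that is, the logarithmic valuation at `λ` multiplied by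
the degree of `λ`. -/
def WildPlace.logVal (l : WildPlace ℓ K) : AdicMul ℓ l.completion →ₗ[ℤ_[ℓ]] ℚ_[ℓ] :=
  LinearMap.liftBaseChange ℤ_[ℓ]
    (-((iwasawaLogHom ℓ).comp
      (MonoidHom.toAdditive (Units.map (Algebra.norm ℚ_[ℓ] (S := l.completion))))) :
        Additive (l.completion)ˣ →+ ℚ_[ℓ]).toIntLinearMap

variable [NumberField K]

/-- The logarithmic divisors of `K`: the free `ℤ_ℓ`-module on the finite places of `K`. At a place
`λ` above `ℓ` the coefficient of `λ` is multiplied by the degree of `λ` (which is a generator of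
the value group of `- Log ∘ N_{K_λ/ℚ_ℓ}`), so that it becomes an element of this value group. -/
abbrev LogDivisor : Type _ :=
  Divisor ℓ K × ((l : WildPlace ℓ K) → LinearMap.range l.logVal)

instance : AddCommGroup (LogDivisor ℓ K) := inferInstance

/-- The degree of logarithmic divisors; a prime `v` not above `ℓ` has degree `Log (N v)`. -/
def LogDivisor.degree : LogDivisor ℓ K →ₗ[ℤ_[ℓ]] ℚ_[ℓ] :=
  LinearMap.coprod
    (Finsupp.linearCombination ℤ_[ℓ]
      fun v : TamePlace ℓ K => iwasawaLog ℓ (Ideal.absNorm v.1.asIdeal : ℚ_[ℓ]))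
    (∑ l : WildPlace ℓ K, (LinearMap.range l.logVal).subtype.comp (LinearMap.proj l))

/-- The logarithmic divisor map: the usual valuations at the places prime to `ℓ`, and the
logarithmic ones at the places above `ℓ`. -/
def logDiv : AdicMul ℓ K →ₗ[ℤ_[ℓ]] LogDivisor ℓ K :=
  (div ℓ K).prod (LinearMap.pi fun l : WildPlace ℓ K =>
    l.logVal.rangeRestrict.comp (AdicMul.map ℓ (toLocalField (Quotient.out l))))

/-- The `ℓ`-group of logarithmic classes: logarithmic divisors of degree `0` modulo principal
ones. -/
abbrev LogClassGroup : Type _ :=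
  LinearMap.ker (LogDivisor.degree ℓ K) ⧸
    (LinearMap.range (logDiv ℓ K)).comap (LinearMap.ker (LogDivisor.degree ℓ K)).subtype

/-- The Gross–Kuz'min conjecture for `ℓ` and `K`: the `ℓ`-group of logarithmic classes of `K` is
finite. -/
def GrossKuzmin : Prop := Finite (LogClassGroup ℓ K)

/-- A divisor prime to `ℓ`, regarded as a logarithmic divisor. -/
def Divisor.toLog : Divisor ℓ K →ₗ[ℤ_[ℓ]] LogDivisor ℓ K := LinearMap.inl _ _ _

end Logarithmic

/-! ### Extensions of class type -/

section ClassType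

variable (ℓ : ℕ) [Fact ℓ.Prime] (K L : Type*) [Field K] [NumberField K] [Field L] [NumberField L]
  [Algebra K L]

variable {K} in
/-- `a ∈ 𝒟'_K` represents a nontrivial class of `Cl_K^{bp}` which capitulates in `Cl_L^{bp}`. -/
def BPCapitulates (a : Divisor ℓ K) : Prop :=
  (Submodule.Quotient.mk a : BPClassGroup ℓ K) ≠ 0 ∧
    (Submodule.Quotient.mk (extendDivisor ℓ K L a) : BPClassGroup ℓ L) = 0

variable {K} in
/-- `a ∈ 𝒟'_K`, regarded as a logarithmic divisor, has degree `0` and represents a nontrivial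
logarithmic class of `K` which capitulates in the group of logarithmic classes of `L`. -/
def LogCapitulates (a : Divisor ℓ K) : Prop :=
  (∃ h : Divisor.toLog ℓ K a ∈ LinearMap.ker (LogDivisor.degree ℓ K),
    (Submodule.Quotient.mk ⟨Divisor.toLog ℓ K a, h⟩ : LogClassGroup ℓ K) ≠ 0) ∧
  (∃ h : Divisor.toLog ℓ L (extendDivisor ℓ K L a) ∈ LinearMap.ker (LogDivisor.degree ℓ L),
    (Submodule.Quotient.mk ⟨Divisor.toLog ℓ L (extendDivisor ℓ K L a), h⟩ : LogClassGroup ℓ L) = 0)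

/-- `L/K` is of class type: a nontrivial class of `Cl_K^{bp}` which capitulates in `Cl_L^{bp}` is
represented by a divisor giving a nontrivial logarithmic class of `K` which capitulates in `L`. -/
def IsOfClassType : Prop := ∃ a : Divisor ℓ K, BPCapitulates ℓ L a ∧ LogCapitulates ℓ L a

end ClassType

end LogClasses

end

/-!
# Capitulation of pseudo-infinitesimal and logarithmic classes

Let `σ` generate `Gal(L/K)` and let `τ` be the automorphism of order `2` of `L/K₀` which commutes
with `σ` and extends the complex conjugation of `K`. The groups `ℛ_F` are written additively.

*Existence of a capitulating class.* Since `τ` inverts the `ℓ`-th roots of unity, there is a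
Kummer generator `x` with `x ^ ℓ = α ∈ K` and `τ x = x⁻¹` (`exists_kummer_generator`). Because the
extension is locally cyclotomic, `x` is, at each finite place, the product of a root of unity of
`ℓ`-power order and an element of the completion of `K` (`exists_eq_pow_mul_of_mem_adjoin`): a
cyclic extension `F(μ_{ℓ^n})/F` has at most one subextension of degree `ℓ`. Hence the divisor of
`α` is `ℓ a₀` (`IsLocallyCyclotomic.dvd_ord`), and by weak approximation at the places above `ℓ`
there is an odd `Y ∈ ℛ_K` such that `x - Y` is pseudo-infinitesimal
(`IsLocallyCyclotomic.exists_odd_sub_smul_mem`). The divisor `a = a₀ - div Y` becomes in `L` the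
divisor of `x - Y`, and so capitulates in both senses: the logarithmic valuations of
pseudo-infinitesimal elements vanish at the places above `ℓ`, the logarithm being bounded, and `a`
has degree `0` by the product formula (`degree_logDiv`).

*Nontriviality.* The conjecture of Gross–Kuz'min is used through the following fact
(`GrossKuzmin.mem_torsion`): an odd element of `ℛ_K` with trivial logarithmic divisor is a root of
unity. Indeed, up to torsion the odd `ℓ`-units embed through their valuations in the odd functions
on the places above `ℓ`, because the odd units of a CM field are roots of unity; the conjecture
says that their logarithmic valuations span the same space of functions, so no odd `ℓ`-unit of
infinite order can be killed by them. If `a` were the logarithmic divisor of `y ∈ ℛ_K`, the odd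
part of `α - ℓ (Y + y)` would be a root of unity, which makes `x` the product of a root of unity
of `ℓ`-power order and an element of `K`. Then `L₀` would be contained in the cyclotomic
`ℤ_ℓ`-extension of `K₀` (`isGloballyCyclotomic_of_eq_mul`).

*Consequence of the Leopoldt conjecture.* If `a` becomes in `L` the divisor of a
pseudo-infinitesimal `x`, then `σ x - x` is a pseudo-infinitesimal unit, hence a root of unity,
which `τ` inverts. So some multiple of `x`, and the sum `x + τ x`, are defined over `K`, which
controls the even part of a hypothetical `y ∈ ℛ_K` with logarithmic divisor `a`, the odd part
being controlled by the conjecture of Gross–Kuz'min (`logCapitulates_of_bpCapitulates`).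

An element of `ℛ_F` is pseudo-infinitesimal iff its images under all embeddings of `F` in an
algebraic closure of `ℚ_ℓ` are infinitely `ℓ`-divisible up to torsion in `ℤ_ℓ ⊗ F_λˣ`
(`mem_pseudoInfinitesimal_iff`); this form of the definition does not involve representatives of
the places and is functorial in `F`.
-/

noncomputable section

namespace LogClasses

/-! ### The modules `ℤ_ℓ ⊗ A` -/

section AdicTensor

variable {ℓ : ℕ} [Fact ℓ.Prime]

theorem natCast_prime_ne_zero : (ℓ : ℤ_[ℓ]) ≠ 0 := by
  exact_mod_cast (Fact.out : ℓ.Prime).ne_zero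

/-- Over `ℤ_ℓ`, being torsion means being killed by a power of `ℓ`. -/
theorem mem_torsion_iff {M : Type*} [AddCommGroup M] [Module ℤ_[ℓ] M] {x : M} :
    x ∈ Submodule.torsion ℤ_[ℓ] M ↔ ∃ k : ℕ, (ℓ : ℤ_[ℓ]) ^ k • x = 0 := by
  rw [Submodule.mem_torsion_iff]
  constructor
  · rintro ⟨⟨a, ha⟩, h⟩
    have ha' : a ≠ 0 := nonZeroDivisors.ne_zero ha
    refine ⟨a.valuation, ?_⟩
    have h' : a • x = 0 := h
    rw [PadicInt.unitCoeff_spec ha', mul_smul] at h'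
    exact (PadicInt.unitCoeff ha').isUnit.smul_eq_zero.mp h'
  · rintro ⟨k, hk⟩
    exact ⟨⟨(ℓ : ℤ_[ℓ]) ^ k, mem_nonZeroDivisors_of_ne_zero
      (pow_ne_zero _ natCast_prime_ne_zero)⟩, hk⟩

theorem smul_mem_torsion {M : Type*} [AddCommGroup M] [Module ℤ_[ℓ] M] {x : M} {c : ℤ_[ℓ]}
    (hc : c ≠ 0) : c • x ∈ Submodule.torsion ℤ_[ℓ] M ↔ x ∈ Submodule.torsion ℤ_[ℓ] M := by
  refine ⟨fun h => ?_, fun h => Submodule.smul_mem _ _ h⟩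
  rw [Submodule.mem_torsion_iff] at h ⊢
  obtain ⟨a, ha⟩ := h
  refine ⟨a * ⟨c, mem_nonZeroDivisors_of_ne_zero hc⟩, ?_⟩
  rw [mul_smul]
  exact ha

theorem isUnit_two (hℓ : ℓ ≠ 2) : IsUnit (2 : ℤ_[ℓ]) := by
  have h : (2 : ℤ_[ℓ]) = ((2 : ℕ) : ℤ_[ℓ]) := by norm_cast
  rw [h, PadicInt.isUnit_iff, PadicInt.norm_natCast_eq_one_iff]
  exact (Nat.coprime_primes Fact.out Nat.prime_two).mpr hℓ

variable {A B : Type*} [AddCommGroup A] [AddCommGroup B]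

theorem natCast_smul_tmul (n : ℕ) (c : ℤ_[ℓ]) (a : A) :
    (n : ℤ_[ℓ]) • (c ⊗ₜ[ℤ] a : ℤ_[ℓ] ⊗[ℤ] A) = c ⊗ₜ (n • a) := by
  rw [Nat.cast_smul_eq_nsmul, TensorProduct.tmul_smul]

/-- Every element of `ℤ_ℓ ⊗ A` is, modulo `ℓ ^ n`, of the form `1 ⊗ a`. -/
theorem exists_eq_one_tmul_add (n : ℕ) (x : ℤ_[ℓ] ⊗[ℤ] A) :
    ∃ (a : A) (y : ℤ_[ℓ] ⊗[ℤ] A), x = 1 ⊗ₜ a + (ℓ : ℤ_[ℓ]) ^ n • y := by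
  induction x using TensorProduct.induction_on with
  | zero => exact ⟨0, 0, by simp⟩
  | tmul c a =>
    obtain ⟨d, hd⟩ := Ideal.mem_span_singleton.mp (PadicInt.appr_spec n c)
    refine ⟨c.appr n • a, d ⊗ₜ a, ?_⟩
    rw [TensorProduct.smul_tmul', smul_eq_mul, ← hd, TensorProduct.sub_tmul, ← natCast_smul_tmul,
      TensorProduct.smul_tmul', smul_eq_mul, mul_one]
    abel
  | add x x' h h' =>
    obtain ⟨a, y, rfl⟩ := h
    obtain ⟨a', y', rfl⟩ := h'
    exact ⟨a + a', y + y', by rw [TensorProduct.tmul_add, smul_add]; abel⟩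

/-- The map `A / ℓ ^ n → (ℤ_ℓ ⊗ A) / ℓ ^ n` is injective. -/
theorem exists_pow_smul_eq {n : ℕ} {a : A} {y : ℤ_[ℓ] ⊗[ℤ] A}
    (h : 1 ⊗ₜ a = (ℓ : ℤ_[ℓ]) ^ n • y) : ∃ b : A, a = ℓ ^ n • b := by
  let N : AddSubgroup A := (zsmulAddGroupHom (ℓ ^ n : ℤ) : A →+ A).range
  have hN : ∀ x : A ⧸ N, (ℓ ^ n) • x = 0 := by
    intro x
    induction x using QuotientAddGroup.induction_on with
    | H z =>
      rw [← QuotientAddGroup.mk_nsmul, QuotientAddGroup.eq_zero_iff]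
      exact ⟨z, by simp [zsmulAddGroupHom, ← natCast_zsmul]⟩
  let _ : Module (ZMod (ℓ ^ n)) (A ⧸ N) := AddCommGroup.zmodModule hN
  let _ : Module ℤ_[ℓ] (A ⧸ N) := Module.compHom _ (PadicInt.toZModPow (p := ℓ) n)
  let f : ℤ_[ℓ] ⊗[ℤ] A →ₗ[ℤ_[ℓ]] A ⧸ N :=
    LinearMap.liftBaseChange ℤ_[ℓ] (QuotientAddGroup.mk' N).toIntLinearMap
  have hf := congrArg f h
  rw [map_smul] at hf
  have h1 : f (1 ⊗ₜ a) = (a : A ⧸ N) := by simp [f]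
  have h2 : (ℓ : ℤ_[ℓ]) ^ n • f y = 0 := by
    rw [← Nat.cast_pow, Nat.cast_smul_eq_nsmul]
    exact hN _
  rw [h1, h2, QuotientAddGroup.eq_zero_iff] at hf
  obtain ⟨b, hb⟩ := hf
  exact ⟨b, by rw [← hb]; simp [zsmulAddGroupHom, ← natCast_zsmul]⟩

instance : Module.Flat ℤ ℤ_[ℓ] := by
  have : Module.IsTorsionFree ℤ ℤ_[ℓ] := inferInstance
  infer_instance

/-- By flatness, the kernel of `ℤ_ℓ ⊗ A → ℤ_ℓ ⊗ B` comes from the kernel of `A → B`. -/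
theorem exists_of_baseChange_eq_zero (f : A →+ B) {x : ℤ_[ℓ] ⊗[ℤ] A}
    (hx : f.toIntLinearMap.baseChange ℤ_[ℓ] x = 0) :
    ∃ y : ℤ_[ℓ] ⊗[ℤ] f.ker, f.ker.subtype.toIntLinearMap.baseChange ℤ_[ℓ] y = x := by
  have hex : Function.Exact f.ker.subtype.toIntLinearMap f.toIntLinearMap := by
    intro a
    constructor
    · intro h
      exact ⟨⟨a, h⟩, rfl⟩
    · rintro ⟨⟨a, h⟩, rfl⟩
      exact h
  exact (Module.Flat.lTensor_exact ℤ_[ℓ] hex x).mp hx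

/-- If `A` is killed by `ℓ ^ k`, then `ℤ_ℓ ⊗ A = A`. -/
theorem exists_eq_one_tmul (k : ℕ) (hA : ∀ a : A, ℓ ^ k • a = 0) (x : ℤ_[ℓ] ⊗[ℤ] A) :
    ∃ a : A, x = 1 ⊗ₜ a := by
  obtain ⟨a, y, rfl⟩ := exists_eq_one_tmul_add k x
  refine ⟨a, ?_⟩
  have : ∀ y : ℤ_[ℓ] ⊗[ℤ] A, (ℓ : ℤ_[ℓ]) ^ k • y = 0 := by
    intro y
    induction y using TensorProduct.induction_on with
    | zero => simp
    | tmul c a => rw [← Nat.cast_pow, natCast_smul_tmul, hA, TensorProduct.tmul_zero]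
    | add x y hx hy => rw [smul_add, hx, hy, add_zero]
  rw [this, add_zero]

/-- The torsion of `ℤ_ℓ ⊗ A` is the `ℓ`-primary torsion of `A`. -/
theorem exists_eq_one_tmul_of_mem_torsion {x : ℤ_[ℓ] ⊗[ℤ] A}
    (hx : x ∈ Submodule.torsion ℤ_[ℓ] (ℤ_[ℓ] ⊗[ℤ] A)) :
    ∃ (a : A) (k : ℕ), ℓ ^ k • a = 0 ∧ x = 1 ⊗ₜ a := by
  obtain ⟨k, hk⟩ := mem_torsion_iff.mp hx
  let f : A →+ A := nsmulAddMonoidHom (ℓ ^ k)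
  have hf : f.toIntLinearMap.baseChange ℤ_[ℓ] x = 0 := by
    rw [← hk]
    induction x using TensorProduct.induction_on with
    | zero => simp
    | tmul c a => rw [← Nat.cast_pow, natCast_smul_tmul]; rfl
    | add x y h h' =>
      have aux : ∀ y : ℤ_[ℓ] ⊗[ℤ] A, f.toIntLinearMap.baseChange ℤ_[ℓ] y
          = (ℓ : ℤ_[ℓ]) ^ k • y := by
        intro y
        induction y using TensorProduct.induction_on with
        | zero => simp
        | tmul c a => rw [← Nat.cast_pow, natCast_smul_tmul]; rfl
        | add x y h h' => rw [map_add, h, h', smul_add]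
      exact aux _
  obtain ⟨y, rfl⟩ := exists_of_baseChange_eq_zero f hf
  obtain ⟨a, rfl⟩ := exists_eq_one_tmul k (fun a : f.ker => Subtype.ext a.2) y
  exact ⟨a, k, a.2, by simp⟩

theorem one_tmul_mem_torsion {a : A} {n : ℕ} (hn : n ≠ 0) (ha : n • a = 0) :
    (1 ⊗ₜ a : ℤ_[ℓ] ⊗[ℤ] A) ∈ Submodule.torsion ℤ_[ℓ] (ℤ_[ℓ] ⊗[ℤ] A) := by
  have hn' : (n : ℤ_[ℓ]) ≠ 0 := by exact_mod_cast hn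
  rw [← smul_mem_torsion hn', natCast_smul_tmul, ha, TensorProduct.tmul_zero]
  exact Submodule.zero_mem _

end AdicTensor

/-! ### Completions, and infinitely divisible elements -/

section Completion

variable {ℓ : ℕ} [Fact ℓ.Prime]

variable (ℓ) in
/-- The submodule `⋂ ℓ ^ n M` of the infinitely `ℓ`-divisible elements of `M`: the kernel of the map
from `M` to its `ℓ`-adic completion. -/
def divisiblePart (M : Type*) [AddCommGroup M] [Module ℤ_[ℓ] M] : Submodule ℤ_[ℓ] M :=
  LinearMap.ker (AdicCompletion.of (Ideal.span {(ℓ : ℤ_[ℓ])}) M)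

variable (ℓ) in
/-- The elements of `M` some nonzero multiple of which is infinitely `ℓ`-divisible. -/
def almostDivisiblePart (M : Type*) [AddCommGroup M] [Module ℤ_[ℓ] M] : Submodule ℤ_[ℓ] M :=
  (Submodule.torsion ℤ_[ℓ] (M ⧸ divisiblePart ℓ M)).comap (divisiblePart ℓ M).mkQ

variable {M N : Type*} [AddCommGroup M] [Module ℤ_[ℓ] M] [AddCommGroup N] [Module ℤ_[ℓ] N]

theorem mem_pow_smul_top_iff {n : ℕ} {x : M} :
    x ∈ (Ideal.span {(ℓ : ℤ_[ℓ])} ^ n • ⊤ : Submodule ℤ_[ℓ] M) ↔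
      ∃ y, x = (ℓ : ℤ_[ℓ]) ^ n • y := by
  rw [Ideal.span_singleton_pow, Submodule.ideal_span_singleton_smul,
    Submodule.mem_smul_pointwise_iff_exists]
  simp [eq_comm]

theorem mem_divisiblePart_iff {x : M} :
    x ∈ divisiblePart ℓ M ↔ ∀ n : ℕ, ∃ y, x = (ℓ : ℤ_[ℓ]) ^ n • y := by
  rw [divisiblePart, LinearMap.mem_ker, AdicCompletion.ext_iff]
  refine forall_congr' fun n => ?_
  rw [← mem_pow_smul_top_iff, ← Submodule.Quotient.mk_eq_zero]
  rfl

theorem mem_almostDivisiblePart_iff {x : M} :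
    x ∈ almostDivisiblePart ℓ M ↔ ∃ k : ℕ, (ℓ : ℤ_[ℓ]) ^ k • x ∈ divisiblePart ℓ M := by
  rw [almostDivisiblePart, Submodule.mem_comap, mem_torsion_iff]
  refine exists_congr fun k => ?_
  rw [← map_smul, Submodule.mkQ_apply, Submodule.Quotient.mk_eq_zero]

theorem smul_mem_almostDivisiblePart {x : M} {c : ℤ_[ℓ]} (hc : c ≠ 0) :
    c • x ∈ almostDivisiblePart ℓ M ↔ x ∈ almostDivisiblePart ℓ M := by
  rw [almostDivisiblePart, Submodule.mem_comap, map_smul, smul_mem_torsion hc, Submodule.mem_comap]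

theorem divisiblePart_le : divisiblePart ℓ M ≤ almostDivisiblePart ℓ M := fun x hx =>
  mem_almostDivisiblePart_iff.mpr ⟨0, by simpa using hx⟩

theorem map_mem_divisiblePart (f : M →ₗ[ℤ_[ℓ]] N) {x : M} (hx : x ∈ divisiblePart ℓ M) :
    f x ∈ divisiblePart ℓ N := by
  rw [mem_divisiblePart_iff] at hx ⊢
  intro n
  obtain ⟨y, rfl⟩ := hx n
  exact ⟨f y, map_smul _ _ _⟩

theorem map_mem_almostDivisiblePart (f : M →ₗ[ℤ_[ℓ]] N) {x : M}
    (hx : x ∈ almostDivisiblePart ℓ M) : f x ∈ almostDivisiblePart ℓ N := by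
  obtain ⟨k, hk⟩ := mem_almostDivisiblePart_iff.mp hx
  exact mem_almostDivisiblePart_iff.mpr ⟨k, by rw [← map_smul]; exact map_mem_divisiblePart f hk⟩

/-- If the `ℓ ^ k`-torsion of `A` is finite, then every element of the completion of `ℤ_ℓ ⊗ A`
killed by `ℓ ^ k` comes from the torsion of `A`. Indeed, modulo each `ℓ ^ n` the given element comes
from the `ℓ ^ k`-torsion of `A`, and one torsion element serves for infinitely many `n`. -/
theorem exists_of_one_tmul_eq {A : Type*} [AddCommGroup A] {k : ℕ}
    (hA : {a : A | ℓ ^ k • a = 0}.Finite)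
    (c : AdicCompletion (Ideal.span {(ℓ : ℤ_[ℓ])}) (ℤ_[ℓ] ⊗[ℤ] A))
    (hc : (ℓ : ℤ_[ℓ]) ^ k • c = 0) :
    ∃ a : A, ℓ ^ k • a = 0 ∧ c = AdicCompletion.of (Ideal.span {(ℓ : ℤ_[ℓ])}) _ (1 ⊗ₜ a) := by
  let I := Ideal.span {(ℓ : ℤ_[ℓ])}
  have hsurj : ∀ n : ℕ, ∃ x : ℤ_[ℓ] ⊗[ℤ] A,
      Submodule.Quotient.mk x = AdicCompletion.eval I _ n c := fun n =>
    Submodule.Quotient.mk_surjective _ _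
  have hdown : ∀ {m n : ℕ} (_ : m ≤ n) {x : ℤ_[ℓ] ⊗[ℤ] A},
      Submodule.Quotient.mk x = AdicCompletion.eval I _ n c →
      Submodule.Quotient.mk x = AdicCompletion.eval I _ m c := by
    intro m n hmn x hx
    have h := AdicCompletion.transitionMap_comp_eval_apply (I := I) (M := ℤ_[ℓ] ⊗[ℤ] A) hmn c
    exact (congrArg (AdicCompletion.transitionMap I _ hmn) hx).trans h
  have key : ∀ n : ℕ, ∃ z : {a : A | ℓ ^ k • a = 0},
      Submodule.Quotient.mk (1 ⊗ₜ (z : A)) = AdicCompletion.eval I (ℤ_[ℓ] ⊗[ℤ] A) n c := by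
    intro n
    obtain ⟨x, hx⟩ := hsurj (n + k)
    obtain ⟨a, y, rfl⟩ := exists_eq_one_tmul_add (n + k) x
    have h0 : (Submodule.Quotient.mk ((ℓ : ℤ_[ℓ]) ^ k • (1 ⊗ₜ a + (ℓ : ℤ_[ℓ]) ^ (n + k) • y)) :
        _ ⧸ (I ^ (n + k) • ⊤ : Submodule ℤ_[ℓ] (ℤ_[ℓ] ⊗[ℤ] A))) = 0 := by
      rw [Submodule.Quotient.mk_smul, hx, ← map_smul, hc, map_zero]
    rw [Submodule.Quotient.mk_eq_zero, mem_pow_smul_top_iff] at h0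
    obtain ⟨w, hw⟩ := h0
    have h1 : (1 : ℤ_[ℓ]) ⊗ₜ[ℤ] (ℓ ^ k • a) =
        (ℓ : ℤ_[ℓ]) ^ (n + k) • (w - (ℓ : ℤ_[ℓ]) ^ k • y) := by
      rw [← natCast_smul_tmul, Nat.cast_pow, smul_sub, ← hw, smul_add, smul_comm]
      abel
    obtain ⟨b, hb⟩ := exists_pow_smul_eq h1
    refine ⟨⟨a - ℓ ^ n • b, ?_⟩, ?_⟩
    · change ℓ ^ k • (a - ℓ ^ n • b) = 0
      rw [smul_sub, hb, smul_smul, pow_add, mul_comm, sub_self]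
    · rw [← hdown (Nat.le_add_right n k) hx, Submodule.Quotient.eq, mem_pow_smul_top_iff]
      refine ⟨-(1 ⊗ₜ b) - (ℓ : ℤ_[ℓ]) ^ k • y, ?_⟩
      rw [TensorProduct.tmul_sub, ← natCast_smul_tmul, Nat.cast_pow, smul_sub, smul_smul, ← pow_add,
        smul_neg]
      abel
  choose z hz using key
  have : Finite {a : A | ℓ ^ k • a = 0} := hA
  obtain ⟨a, ha⟩ := Finite.exists_infinite_fiber z
  have ha' := Set.infinite_coe_iff.mp ha
  refine ⟨a, a.2, AdicCompletion.ext fun n => ?_⟩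
  obtain ⟨m, hm, hnm⟩ := ha'.exists_gt n
  have := hdown hnm.le (hz m)
  rw [show z m = a from hm] at this
  exact this.symm

end Completion

section Functoriality

variable {ℓ : ℕ} [Fact ℓ.Prime] {F E G : Type*} [Field F] [Field E] [Field G]

@[simp]
theorem AdicMul.map_tmul (f : F →+* E) (c : ℤ_[ℓ]) (x : Additive Fˣ) :
    AdicMul.map ℓ f (c ⊗ₜ x) = c ⊗ₜ Additive.ofMul (Units.map (f : F →* E) x.toMul) := rfl

theorem AdicMul.induction {p : AdicMul ℓ F → Prop}
    (hadd : ∀ x y, p x → p y → p (x + y)) (hsmul : ∀ (c : ℤ_[ℓ]) x, p x → p (c • x))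
    (hone : ∀ u : Fˣ, p (1 ⊗ₜ Additive.ofMul u)) (x : AdicMul ℓ F) : p x := by
  induction x using TensorProduct.induction_on with
  | zero => simpa using hsmul 0 _ (hone 1)
  | tmul c a =>
    have h := hsmul c _ (hone a.toMul)
    rwa [TensorProduct.smul_tmul', smul_eq_mul, mul_one, ofMul_toMul] at h
  | add x y hx hy => exact hadd _ _ hx hy

theorem AdicMul.linearMap_ext {M : Type*} [AddCommGroup M] [Module ℤ_[ℓ] M]
    {f g : AdicMul ℓ F →ₗ[ℤ_[ℓ]] M}
    (h : ∀ u : Fˣ, f (1 ⊗ₜ Additive.ofMul u) = g (1 ⊗ₜ Additive.ofMul u)) : f = g := by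
  refine LinearMap.ext fun x => ?_
  induction x using AdicMul.induction with
  | hadd x y hx hy => rw [map_add, map_add, hx, hy]
  | hsmul c x hx => rw [map_smul, map_smul, hx]
  | hone u => exact h u

theorem AdicMul.map_map (g : E →+* G) (f : F →+* E) (x : AdicMul ℓ F) :
    AdicMul.map ℓ g (AdicMul.map ℓ f x) = AdicMul.map ℓ (g.comp f) x := by
  revert x
  rw [← funext_iff]
  have : (AdicMul.map ℓ g).comp (AdicMul.map ℓ f) = AdicMul.map ℓ (g.comp f) :=
    AdicMul.linearMap_ext fun u => by simp; rfl
  exact congrArg DFunLike.coe this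

theorem AdicMul.map_id (x : AdicMul ℓ F) : AdicMul.map ℓ (RingHom.id F) x = x := by
  have : AdicMul.map ℓ (RingHom.id F) = LinearMap.id :=
    AdicMul.linearMap_ext fun u => by simp
  rw [this]; rfl

/-- A torsion element of `ℛ_F` is given by a root of unity of `F`. -/
theorem AdicMul.exists_of_mem_torsion {x : AdicMul ℓ F}
    (hx : x ∈ Submodule.torsion ℤ_[ℓ] (AdicMul ℓ F)) :
    ∃ (ζ : Fˣ) (k : ℕ), ζ ^ ℓ ^ k = 1 ∧ x = 1 ⊗ₜ Additive.ofMul ζ := by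
  obtain ⟨a, k, h, rfl⟩ := exists_eq_one_tmul_of_mem_torsion hx
  exact ⟨a.toMul, k, h, rfl⟩

theorem AdicMul.one_tmul_mem_torsion {ζ : Fˣ} {n : ℕ} (hn : n ≠ 0) (h : ζ ^ n = 1) :
    (1 ⊗ₜ Additive.ofMul ζ : AdicMul ℓ F) ∈ Submodule.torsion ℤ_[ℓ] (AdicMul ℓ F) :=
  LogClasses.one_tmul_mem_torsion hn (by rw [← ofMul_pow, h]; rfl)

/-- For a finite extension `E/F`, the norm shows that an element of `ℛ_F` is infinitely
`ℓ`-divisible up to torsion as soon as it is so in `ℛ_E`. -/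
theorem mem_almostDivisiblePart_of_map [Algebra F E] [FiniteDimensional F E] {x : AdicMul ℓ F}
    (hx : AdicMul.map ℓ (algebraMap F E) x ∈ almostDivisiblePart ℓ (AdicMul ℓ E)) :
    x ∈ almostDivisiblePart ℓ (AdicMul ℓ F) := by
  let N : AdicMul ℓ E →ₗ[ℤ_[ℓ]] AdicMul ℓ F := LinearMap.baseChange ℤ_[ℓ]
    (MonoidHom.toAdditive (Units.map (Algebra.norm F (S := E)))).toIntLinearMap
  have hN : ∀ y, N (AdicMul.map ℓ (algebraMap F E) y) = (Module.finrank F E : ℤ_[ℓ]) • y := by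
    intro y
    induction y using AdicMul.induction with
    | hadd x y hx hy => rw [map_add, map_add, hx, hy, smul_add]
    | hsmul c x hx => rw [map_smul, map_smul, hx, smul_comm]
    | hone u =>
      rw [natCast_smul_tmul, ← ofMul_pow, AdicMul.map_tmul]
      change (1 : ℤ_[ℓ]) ⊗ₜ[ℤ] Additive.ofMul _ = _
      congr 2
      ext1
      exact Algebra.norm_algebraMap _
  have hd : (Module.finrank F E : ℤ_[ℓ]) ≠ 0 := by exact_mod_cast Module.finrank_pos.ne'
  rw [← smul_mem_almostDivisiblePart hd, ← hN]
  exact map_mem_almostDivisiblePart N hx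

theorem finite_pow_eq_one (n : ℕ) (hn : n ≠ 0) : {a : Additive Fˣ | n • a = 0}.Finite := by
  have : NeZero n := ⟨hn⟩
  have h : Finite (_root_.rootsOfUnity n F) := inferInstance
  refine (Set.toFinite (_root_.rootsOfUnity n F : Set Fˣ)).subset ?_
  intro a ha
  exact ha

end Functoriality

/-! ### Infinitesimal and pseudo-infinitesimal elements -/

section LocalField

variable {p : ℕ} [Fact p.Prime] {K L : Type*} [Field K] [Field L]

/-- A `ℚ_p`-endomorphism `g` of the algebraic closure of `ℚ_p` such that `g ∘ σ = τ ∘ f` maps the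
completion of `K` at `σ` to the completion of `L` at `τ`. -/
def localFieldMap {σ : K →+* PadicAlgCl p} {τ : L →+* PadicAlgCl p} (f : K →+* L)
    (g : PadicAlgCl p →ₐ[ℚ_[p]] PadicAlgCl p) (h : ∀ x, g (σ x) = τ (f x)) :
    localField σ →ₐ[ℚ_[p]] localField τ :=
  (g.comp (localField σ).val).codRestrict (localField τ).toSubalgebra (by
    have hle : localField σ ≤ (localField τ).comap g := by
      rw [localField, IntermediateField.adjoin_le_iff]
      rintro _ ⟨x, rfl⟩
      change g (σ x) ∈ localField τ
      rw [h]
      exact IntermediateField.subset_adjoin _ _ ⟨_, rfl⟩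
    exact fun x => hle x.2)

theorem localFieldMap_comp {σ : K →+* PadicAlgCl p} {τ : L →+* PadicAlgCl p} (f : K →+* L)
    (g : PadicAlgCl p →ₐ[ℚ_[p]] PadicAlgCl p) (h : ∀ x, g (σ x) = τ (f x)) :
    ((localFieldMap f g h : localField σ →ₐ[ℚ_[p]] localField τ) : localField σ →+* _).comp
      (toLocalField σ) = (toLocalField τ).comp f := by
  ext x
  exact h x

instance [NumberField K] (σ : K →+* PadicAlgCl p) : FiniteDimensional ℚ_[p] (localField σ) := by
  let b := Module.finBasis ℚ K
  have : FiniteDimensional ℚ_[p] (IntermediateField.adjoin ℚ_[p] (Set.range (σ ∘ b))) := by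
    refine IntermediateField.finiteDimensional_adjoin fun x _ => ?_
    exact Algebra.IsIntegral.isIntegral x
  have hle : localField σ ≤ IntermediateField.adjoin ℚ_[p] (Set.range (σ ∘ b)) := by
    rw [localField, IntermediateField.adjoin_le_iff]
    rintro _ ⟨x, rfl⟩
    rw [← b.sum_repr x, map_sum]
    refine sum_mem fun i _ => ?_
    rw [Rat.smul_def, map_mul, map_ratCast]
    exact mul_mem (SubfieldClass.ratCast_mem _ _) (IntermediateField.subset_adjoin _ _ ⟨i, rfl⟩)
  exact Module.Finite.of_injective (IntermediateField.inclusion hle).toLinearMap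
    (IntermediateField.inclusion hle).injective

end LocalField

section Infinitesimal

variable {ℓ : ℕ} [Fact ℓ.Prime] {K L : Type*} [Field K] [Field L]

theorem localize_eq_zero_iff {l : WildPlace ℓ K} {x : AdicMul ℓ K} :
    l.localize x = 0 ↔ AdicMul.map ℓ (toLocalField (Quotient.out l)) x ∈ divisiblePart ℓ _ :=
  Iff.rfl

/-- The group `μ_{K_λ}` is the torsion submodule of `ℛ_{K_λ}`. -/
theorem rootsOfUnity_eq_torsion (l : WildPlace ℓ K) :
    l.rootsOfUnity = Submodule.torsion ℤ_[ℓ] l.CompactMul := by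
  have hl : ℓ ≠ 0 := (Fact.out : ℓ.Prime).ne_zero
  apply le_antisymm
  · rw [WildPlace.rootsOfUnity, Submodule.span_le]
    rintro _ ⟨ζ, n, hζ, rfl⟩
    obtain ⟨k, hk⟩ := mem_torsion_iff.mp
      (AdicMul.one_tmul_mem_torsion (ℓ := ℓ) (pow_ne_zero n hl) hζ)
    exact mem_torsion_iff.mpr ⟨k, by rw [← map_smul, hk, map_zero]⟩
  · intro x hx
    obtain ⟨k, hk⟩ := mem_torsion_iff.mp hx
    obtain ⟨a, ha, rfl⟩ := exists_of_one_tmul_eq (finite_pow_eq_one _ (pow_ne_zero k hl)) x hk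
    exact Submodule.subset_span ⟨a.toMul, k, ha, rfl⟩

theorem localize_mem_rootsOfUnity_iff {l : WildPlace ℓ K} {x : AdicMul ℓ K} :
    l.localize x ∈ l.rootsOfUnity ↔
      AdicMul.map ℓ (toLocalField (Quotient.out l)) x ∈ almostDivisiblePart ℓ _ := by
  rw [rootsOfUnity_eq_torsion, mem_torsion_iff, mem_almostDivisiblePart_iff]
  refine exists_congr fun k => ?_
  rw [← map_smul, ← map_smul]
  exact localize_eq_zero_iff

theorem exists_localField_hom (σ : K →+* PadicAlgCl ℓ) :
    ∃ j : localField (Quotient.out (Quotient.mk (embeddingSetoid ℓ K) σ)) →ₐ[ℚ_[ℓ]] localField σ,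
      j.toRingHom.comp (toLocalField _) = toLocalField σ := by
  obtain ⟨g, hg⟩ := Quotient.mk_out (s := embeddingSetoid ℓ K) σ
  have h : ∀ x, (g : PadicAlgCl ℓ →ₐ[ℚ_[ℓ]] PadicAlgCl ℓ)
      (Quotient.out (Quotient.mk (embeddingSetoid ℓ K) σ) x) = σ (RingHom.id K x) :=
    fun x => (RingHom.congr_fun hg x).symm
  exact ⟨localFieldMap (RingHom.id K) _ h, localFieldMap_comp _ _ h⟩

/-- An element is infinitesimal iff all its images under `ℓ`-adic embeddings are infinitely
`ℓ`-divisible. -/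
theorem mem_infinitesimal_iff {x : AdicMul ℓ K} :
    x ∈ infinitesimal ℓ K ↔
      ∀ σ : K →+* PadicAlgCl ℓ, AdicMul.map ℓ (toLocalField σ) x ∈ divisiblePart ℓ _ := by
  rw [infinitesimal, Submodule.mem_iInf]
  refine ⟨fun h σ => ?_, fun h l => h _⟩
  obtain ⟨j, hj⟩ := exists_localField_hom σ
  rw [← hj, ← AdicMul.map_map]
  exact map_mem_divisiblePart _ (localize_eq_zero_iff.mp (h _))

/-- An element is pseudo-infinitesimal iff all its images under `ℓ`-adic embeddings are infinitely
`ℓ`-divisible up to torsion. -/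
theorem mem_pseudoInfinitesimal_iff {x : AdicMul ℓ K} :
    x ∈ pseudoInfinitesimal ℓ K ↔
      ∀ σ : K →+* PadicAlgCl ℓ, AdicMul.map ℓ (toLocalField σ) x ∈ almostDivisiblePart ℓ _ := by
  rw [pseudoInfinitesimal, Submodule.mem_iInf]
  refine ⟨fun h σ => ?_, fun h l => localize_mem_rootsOfUnity_iff.mpr (h _)⟩
  obtain ⟨j, hj⟩ := exists_localField_hom σ
  rw [← hj, ← AdicMul.map_map]
  exact map_mem_almostDivisiblePart _ (localize_mem_rootsOfUnity_iff.mp (h _))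

theorem smul_mem_pseudoInfinitesimal {x : AdicMul ℓ K} {c : ℤ_[ℓ]} (hc : c ≠ 0) :
    c • x ∈ pseudoInfinitesimal ℓ K ↔ x ∈ pseudoInfinitesimal ℓ K := by
  simp only [mem_pseudoInfinitesimal_iff, map_smul, smul_mem_almostDivisiblePart hc]

theorem torsion_le_pseudoInfinitesimal :
    Submodule.torsion ℤ_[ℓ] (AdicMul ℓ K) ≤ pseudoInfinitesimal ℓ K := by
  intro x hx
  obtain ⟨k, hk⟩ := mem_torsion_iff.mp hx
  rw [← smul_mem_pseudoInfinitesimal (pow_ne_zero k natCast_prime_ne_zero), hk]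
  exact Submodule.zero_mem _

theorem exists_smul_mem_infinitesimal [NumberField K] {x : AdicMul ℓ K}
    (hx : x ∈ pseudoInfinitesimal ℓ K) : ∃ k : ℕ, (ℓ : ℤ_[ℓ]) ^ k • x ∈ infinitesimal ℓ K := by
  have h := fun σ => mem_almostDivisiblePart_iff.mp (mem_pseudoInfinitesimal_iff.mp hx σ)
  choose k hk using h
  have : Fintype (K →+* PadicAlgCl ℓ) := Fintype.ofFinite _
  refine ⟨∑ σ, k σ, mem_infinitesimal_iff.mpr fun σ => ?_⟩
  obtain ⟨m, hm⟩ := Nat.exists_eq_add_of_le (Finset.single_le_sum (f := k)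
    (fun _ _ => Nat.zero_le _) (Finset.mem_univ σ))
  rw [hm, add_comm, pow_add, mul_smul, map_smul]
  refine Submodule.smul_mem _ _ ?_
  rw [map_smul]
  exact hk σ

theorem map_mem_pseudoInfinitesimal (f : K →+* L) {x : AdicMul ℓ K}
    (hx : x ∈ pseudoInfinitesimal ℓ K) : AdicMul.map ℓ f x ∈ pseudoInfinitesimal ℓ L := by
  rw [mem_pseudoInfinitesimal_iff] at hx ⊢
  intro σ
  rw [AdicMul.map_map, ← localFieldMap_comp f (AlgHom.id _ _) (σ := σ.comp f) (fun x => rfl),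
    ← AdicMul.map_map]
  exact map_mem_almostDivisiblePart _ (hx _)

/-- The preimage of `ℛ_L^{bp}` in `ℛ_K` is `ℛ_K^{bp}`: the local norms bound the kernels of
`ℛ_{K_λ} → ℛ_{L_w}`. -/
theorem mem_pseudoInfinitesimal_of_map [NumberField K] [NumberField L] [Algebra K L]
    {x : AdicMul ℓ K} (hx : AdicMul.map ℓ (algebraMap K L) x ∈ pseudoInfinitesimal ℓ L) :
    x ∈ pseudoInfinitesimal ℓ K := by
  rw [mem_pseudoInfinitesimal_iff] at hx ⊢
  intro σ
  let _ : Algebra K (PadicAlgCl ℓ) := σ.toAlgebra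
  have : FiniteDimensional K L := Module.Finite.of_restrictScalars_finite ℚ K L
  let s : L →ₐ[K] PadicAlgCl ℓ := IsAlgClosed.lift
  have hs : ∀ y, AlgHom.id ℚ_[ℓ] (PadicAlgCl ℓ) (σ y) = (s : L →+* _) (algebraMap K L y) :=
    fun y => (s.commutes y).symm
  let j := localFieldMap (algebraMap K L) (AlgHom.id _ _) hs
  let _ : Algebra (localField σ) (localField (s : L →+* PadicAlgCl ℓ)) := j.toRingHom.toAlgebra
  have : IsScalarTower ℚ_[ℓ] (localField σ) (localField (s : L →+* PadicAlgCl ℓ)) :=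
    IsScalarTower.of_algebraMap_eq fun x => (j.commutes x).symm
  have : FiniteDimensional (localField σ) (localField (s : L →+* PadicAlgCl ℓ)) :=
    Module.Finite.of_restrictScalars_finite ℚ_[ℓ] _ _
  refine mem_almostDivisiblePart_of_map (E := localField (s : L →+* PadicAlgCl ℓ)) ?_
  have h := hx (s : L →+* PadicAlgCl ℓ)
  rw [AdicMul.map_map, ← localFieldMap_comp (algebraMap K L) (AlgHom.id _ _) hs,
    ← AdicMul.map_map] at h
  exact h

/-- Under the Leopoldt conjecture, a pseudo-infinitesimal unit is a root of unity. -/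
theorem Leopoldt.mem_torsion [NumberField K] (h : Leopoldt ℓ K) {x : AdicMul ℓ K}
    (hx : x ∈ pseudoInfinitesimal ℓ K) (hd : div ℓ K x = 0) :
    x ∈ Submodule.torsion ℤ_[ℓ] (AdicMul ℓ K) := by
  obtain ⟨k, hk⟩ := exists_smul_mem_infinitesimal hx
  refine mem_torsion_iff.mpr ⟨k, ?_⟩
  have : (ℓ : ℤ_[ℓ]) ^ k • x ∈ infinitesimal ℓ K ⊓ LinearMap.ker (div ℓ K) :=
    ⟨hk, LinearMap.mem_ker.mpr (by rw [map_smul, hd, smul_zero])⟩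
  rw [h] at this
  simpa using this

end Infinitesimal

/-! ### Divisors and their extension -/

section Divisors

variable {ℓ : ℕ} [Fact ℓ.Prime] {K L : Type*} [Field K] [NumberField K] [Field L] [NumberField L]

@[simp]
theorem div_one_tmul_apply (u : Kˣ) (v : TamePlace ℓ K) :
    div ℓ K (1 ⊗ₜ Additive.ofMul u) v = (ord v.1 u : ℤ_[ℓ]) := by
  simp [div, divUnits, Finsupp.ofSupportFinite]

theorem valuation_eq_exp_neg_ord (v : HeightOneSpectrum (𝓞 K)) (u : Kˣ) :
    v.valuation K (u : K) = WithZero.exp (-ord v u) := by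
  rw [← HeightOneSpectrum.valuationOfNeZero_eq, ord, neg_neg]
  rfl

theorem ord_eq_iff (v : HeightOneSpectrum (𝓞 K)) (u : Kˣ) (n : ℤ) :
    ord v u = n ↔ v.valuation K (u : K) = WithZero.exp (-n) := by
  rw [valuation_eq_exp_neg_ord, WithZero.exp_inj, neg_inj]

theorem ord_eq_zero_iff (v : HeightOneSpectrum (𝓞 K)) (u : Kˣ) :
    ord v u = 0 ↔ v.valuation K (u : K) = 1 := by
  rw [ord_eq_iff, neg_zero, WithZero.exp_zero]

variable [Algebra K L]

theorem ramificationIdx_below_ne_zero (w : HeightOneSpectrum (𝓞 L)) :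
    w.asIdeal.ramificationIdx (𝓞 K) ≠ 0 :=
  (w.asIdeal.ramificationIdx_pos (𝓞 K)).ne'

theorem ord_map (w : HeightOneSpectrum (𝓞 L)) (u : Kˣ) :
    ord w (Units.map (algebraMap K L : K →* L) u) =
      w.asIdeal.ramificationIdx (𝓞 K) * ord (w.under (𝓞 K)) u := by
  have : w.asIdeal.LiesOver (w.under (𝓞 K)).asIdeal := ⟨rfl⟩
  rw [ord_eq_iff]
  have h := HeightOneSpectrum.valuation_liesOver L (w.under (𝓞 K)) w (u : K)
  rw [Ideal.ramificationIdx'_eq_ramificationIdx _ _ (w.under (𝓞 K)).ne_bot,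
    valuation_eq_exp_neg_ord, ← WithZero.exp_nsmul] at h
  rw [Units.coe_map, MonoidHom.coe_coe, ← h]
  congr 1
  rw [nsmul_eq_mul, mul_neg]

/-- The extension of divisors is compatible with the extension of elements. -/
theorem div_map (x : AdicMul ℓ K) :
    div ℓ L (AdicMul.map ℓ (algebraMap K L) x) = extendDivisor ℓ K L (div ℓ K x) := by
  induction x using AdicMul.induction with
  | hadd x y hx hy => simp only [map_add, hx, hy]
  | hsmul c x hx => simp only [map_smul, hx]
  | hone u =>
    ext w
    rw [AdicMul.map_tmul, div_one_tmul_apply]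
    change ((ord w.1 (Units.map _ u) : ℤ) : ℤ_[ℓ]) = _ * _
    rw [ord_map, Int.cast_mul, Int.cast_natCast]
    exact congrArg _ (div_one_tmul_apply u (w.below ℓ K)).symm

variable (L) in
theorem TamePlace.exists_below_eq (v : TamePlace ℓ K) : ∃ w : TamePlace ℓ L, w.below ℓ K = v := by
  have := v.1.isMaximal
  obtain ⟨Q, hQ, hQv⟩ := Ideal.exists_maximal_ideal_liesOver_of_isIntegral (S := 𝓞 L) v.1.asIdeal
  have hQ0 : Q ≠ ⊥ := Ideal.ne_bot_of_liesOver_of_ne_bot v.1.ne_bot Q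
  have hv : v.1.asIdeal = Q.under (𝓞 K) := hQv.over
  refine ⟨⟨⟨Q, hQ.isPrime, hQ0⟩, fun h => v.2 ?_⟩, ?_⟩
  · rw [hv, Ideal.mem_comap, map_natCast]
    exact h
  · exact Subtype.ext (HeightOneSpectrum.ext hv.symm)

theorem extendDivisor_injective : Function.Injective (extendDivisor ℓ K L) := by
  rw [injective_iff_map_eq_zero]
  intro a ha
  ext v
  obtain ⟨w, rfl⟩ := v.exists_below_eq L
  have h : (w.1.asIdeal.ramificationIdx (𝓞 K) : ℤ_[ℓ]) * a (w.below ℓ K) = 0 :=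
    DFunLike.congr_fun ha w
  exact (mul_eq_zero.mp h).resolve_left
    (by exact_mod_cast ramificationIdx_below_ne_zero (K := K) w.1)

omit [Algebra K L] in
theorem div_map_eq_zero (f : K →+* L) {x : AdicMul ℓ K} (hx : div ℓ K x = 0) :
    div ℓ L (AdicMul.map ℓ f x) = 0 := by
  let _ : Algebra K L := f.toAlgebra
  have h := div_map (L := L) x
  rw [hx, map_zero] at h
  exact h

open scoped Classical in
/-- Since the class group is finite, every divisor has a nonzero multiple which is principal. -/
theorem exists_div_eq_smul (a : Divisor ℓ K) :
    ∃ (n : ℕ) (z : AdicMul ℓ K), n ≠ 0 ∧ div ℓ K z = (n : ℤ_[ℓ]) • a := by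
  let h := Fintype.card (ClassGroup (𝓞 K))
  refine ⟨h, ?_⟩
  suffices H : ∀ v : TamePlace ℓ K, ∃ u : Kˣ,
      div ℓ K (1 ⊗ₜ Additive.ofMul u) = (h : ℤ_[ℓ]) • Finsupp.single v 1 by
    choose u hu using H
    refine ⟨a.sum fun v c => c • (1 ⊗ₜ Additive.ofMul (u v)), Fintype.card_ne_zero, ?_⟩
    rw [map_finsuppSum]
    simp only [map_smul, hu]
    conv_rhs => rw [← a.sum_single]
    rw [Finsupp.smul_sum]
    refine Finsupp.sum_congr fun v _ => ?_
    rw [smul_comm, Finsupp.smul_single_one]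
  intro v
  have hprin : (v.1.asIdeal ^ h).IsPrincipal := by
    have h1 : ClassGroup.mk0 ⟨v.1.asIdeal, mem_nonZeroDivisors_of_ne_zero v.1.ne_bot⟩ ^ h = 1 :=
      pow_card_eq_one
    rw [← map_pow, ClassGroup.mk0_eq_one_iff] at h1
    exact h1
  obtain ⟨π, hπ⟩ := hprin
  rw [← Ideal.span] at hπ
  have hπ0 : π ≠ 0 := by
    rintro rfl
    rw [Ideal.span_singleton_zero] at hπ
    exact pow_ne_zero h v.1.ne_bot hπ
  have hπ0' : (π : K) ≠ 0 := by simpa using hπ0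
  refine ⟨Units.mk0 (π : K) hπ0', ?_⟩
  ext w
  rw [div_one_tmul_apply, Finsupp.smul_apply, smul_eq_mul]
  have key : ord w.1 (Units.mk0 (π : K) hπ0') = if v = w then (h : ℤ) else 0 := by
    rw [ord_eq_iff, Units.val_mk0]
    change w.1.valuation K (algebraMap (𝓞 K) K π) = _
    rw [HeightOneSpectrum.valuation_of_algebraMap, HeightOneSpectrum.intValuation_if_neg _ hπ0,
      ← hπ, Associates.mk_pow, Associates.count_pow (Associates.mk_ne_zero.mpr v.1.ne_bot)
        w.1.associates_irreducible]
    congr 2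
    split_ifs with hvw
    · rw [hvw, Associates.count_self w.1.associates_irreducible, mul_one]
    · rw [Associates.count_eq_zero_of_ne w.1.associates_irreducible v.1.associates_irreducible,
        mul_zero, Nat.cast_zero]
      intro heq
      rw [Associates.mk_eq_mk_iff_associated, associated_iff_eq] at heq
      exact hvw (Subtype.ext (HeightOneSpectrum.ext heq.symm))
  rw [key, Finsupp.single_apply]
  split_ifs <;> simp

end Divisors

/-! ### Finite places and `p`-adic embeddings -/

section Embeddings

theorem norm_le_one_of_isIntegral {p : ℕ} [Fact p.Prime] {x : PadicAlgCl p} (hx : IsIntegral ℤ x) :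
    ‖x‖ ≤ 1 := by
  have h : IsIntegral (Valued.v (R := PadicAlgCl p)).integer x := hx.tower_top
  have h' := (Valuation.integer.integers (Valued.v (R := PadicAlgCl p))).mem_of_integral h
  have h'' : Valued.v x ≤ 1 := h'
  rw [PadicAlgCl.valuation_def] at h''
  exact_mod_cast h''

theorem norm_apply_le_one {K : Type*} [Field K] {p : ℕ} [Fact p.Prime] (σ : K →+* PadicAlgCl p)
    (x : 𝓞 K) : ‖σ x‖ ≤ 1 :=
  norm_le_one_of_isIntegral (x.isIntegral_coe.map σ.toIntAlgHom)

variable {K : Type*} [Field K] [NumberField K]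

/-- The prime ideal of `𝓞 K` defined by a `p`-adic embedding of `K`. -/
def embeddingIdeal {p : ℕ} [Fact p.Prime] (σ : K →+* PadicAlgCl p) : Ideal (𝓞 K) where
  carrier := {x | ‖σ x‖ < 1}
  zero_mem' := by simp
  add_mem' {x y} hx hy := by
    have hx' : ‖σ x‖ < 1 := hx
    have hy' : ‖σ y‖ < 1 := hy
    change ‖σ ((x : K) + (y : K))‖ < 1
    rw [map_add]
    exact (PadicAlgCl.isNonarchimedean p _ _).trans_lt (max_lt hx' hy')
  smul_mem' c x hx := by
    change ‖σ ((c : K) * (x : K))‖ < 1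
    rw [map_mul, norm_mul]
    exact mul_lt_one_of_nonneg_of_lt_one_right (norm_apply_le_one σ c) (norm_nonneg _) hx

theorem mem_embeddingIdeal {p : ℕ} [Fact p.Prime] {σ : K →+* PadicAlgCl p} {x : 𝓞 K} :
    x ∈ embeddingIdeal σ ↔ ‖σ x‖ < 1 := Iff.rfl

theorem norm_natCast_lt_one (p : ℕ) [Fact p.Prime] : ‖(p : PadicAlgCl p)‖ < 1 := by
  have h := PadicAlgCl.norm_extends p (p : ℚ_[p])
  rw [map_natCast] at h
  rw [h]
  exact Padic.norm_p_lt_one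

instance {p : ℕ} [Fact p.Prime] (σ : K →+* PadicAlgCl p) : (embeddingIdeal σ).IsPrime where
  ne_top' h := by
    have := (Ideal.eq_top_iff_one _).mp h
    rw [mem_embeddingIdeal] at this
    simp at this
  mem_or_mem' {x y} h := by
    simp only [mem_embeddingIdeal, map_mul, norm_mul] at h ⊢
    by_contra! hc
    exact absurd h (not_lt.mpr (one_le_mul_of_one_le_of_one_le hc.1 hc.2))

/-- Every finite place of a number field is induced by a `p`-adic embedding: this follows from the
transitivity of the Galois action on primes in the normal closure. -/
theorem exists_embeddingIdeal_eq (v : HeightOneSpectrum (𝓞 K)) :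
    ∃ (p : ℕ) (_ : Fact p.Prime) (σ : K →+* PadicAlgCl p), embeddingIdeal σ = v.asIdeal := by
  have : IsAlgClosure ℚ (AlgebraicClosure K) := IsAlgClosure.ofAlgebraic ℚ K _
  have : Normal ℚ (AlgebraicClosure K) := IsAlgClosure.normal ℚ _
  let N := IntermediateField.normalClosure ℚ K (AlgebraicClosure K)
  have : Normal ℚ N := normalClosure.normal ℚ K _
  have : NumberField N := ⟨⟩
  have : IsGalois ℚ N := ⟨⟩
  obtain ⟨W, hW, hWv⟩ := Ideal.exists_maximal_ideal_liesOver_of_isIntegral (S := 𝓞 N) v.asIdeal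
  have hW0 : W ≠ ⊥ := Ideal.ne_bot_of_liesOver_of_ne_bot v.ne_bot W
  have hP0 : W.under ℤ ≠ ⊥ := Ideal.IsIntegral.comap_ne_bot (R := ℤ) hW0
  have hPp := Submodule.IsPrincipal.prime_generator_of_isPrime (W.under ℤ) hP0
  let p := (Submodule.IsPrincipal.generator (W.under ℤ)).natAbs
  have hp : Fact p.Prime := ⟨Int.prime_iff_natAbs_prime.mp hPp⟩
  have hPspan : W.under ℤ = Ideal.span {(p : ℤ)} := by
    rw [Int.span_natAbs]
    exact (Ideal.span_singleton_generator _).symm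
  let σ₀ : N →ₐ[ℚ] PadicAlgCl p := IsAlgClosed.lift
  have h0 : (embeddingIdeal (σ₀ : N →+* PadicAlgCl p)).under ℤ = Ideal.span {(p : ℤ)} := by
    have hmax : (Ideal.span {(p : ℤ)}).IsMaximal :=
      PrincipalIdealRing.isMaximal_of_irreducible (Nat.prime_iff_prime_int.mp hp.out).irreducible
    refine (hmax.eq_of_le (Ideal.IsPrime.under ℤ _).ne_top ?_).symm
    rw [Ideal.span_singleton_le_iff_mem, Ideal.mem_comap, mem_embeddingIdeal]
    simpa using norm_natCast_lt_one p
  obtain ⟨g, hg⟩ := Ideal.exists_comap_galRestrict_eq ℤ ℚ N (𝓞 N)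
    (p := Ideal.span {(p : ℤ)}) (P₁ := embeddingIdeal (σ₀ : N →+* PadicAlgCl p)) (P₂ := W)
    ⟨inferInstance, ⟨h0.symm⟩⟩ ⟨hW.isPrime, ⟨hPspan.symm⟩⟩
  refine ⟨p, hp, ((σ₀ : N →+* PadicAlgCl p).comp (g : N →+* N)).comp (algebraMap K N), ?_⟩
  rw [hWv.over, ← hg]
  ext x
  rw [Ideal.mem_comap, Ideal.mem_comap, mem_embeddingIdeal, mem_embeddingIdeal]
  have h : ((galRestrict ℤ ℚ N (𝓞 N) g (algebraMap (𝓞 K) (𝓞 N) x) : 𝓞 N) : N) =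
      g (algebraMap K N (x : K)) := algebraMap_galRestrict_apply ℤ g _
  rw [h]
  rfl

/-- For a place induced by an embedding `σ`, the units at this place are the elements with
image of norm `1`. -/
theorem norm_eq_one_iff {p : ℕ} [Fact p.Prime] {σ : K →+* PadicAlgCl p}
    {v : HeightOneSpectrum (𝓞 K)} (h : embeddingIdeal σ = v.asIdeal) (u : Kˣ) :
    ‖σ u‖ = 1 ↔ ord v u = 0 := by
  have hd : ∀ d : v.asIdeal.primeCompl, ‖σ (algebraMap (𝓞 K) K d)‖ = 1 := fun d =>
    le_antisymm (norm_apply_le_one _ _) (not_lt.mp fun hlt =>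
      d.2 (h.le (mem_embeddingIdeal.mpr hlt)))
  have hle : ∀ x : K, v.valuation K x ≤ 1 → ‖σ x‖ ≤ 1 := by
    intro x hx
    obtain ⟨n, d, hnd⟩ := v.exists_primeCompl_mul_eq_of_integer x hx
    have h1 := congrArg (fun y => ‖σ y‖) hnd
    simp only [map_mul, norm_mul] at h1
    rw [hd d, mul_one] at h1
    rw [h1]
    exact norm_apply_le_one _ _
  have hlt : ∀ x : K, v.valuation K x < 1 → ‖σ x‖ < 1 := by
    intro x hx
    obtain ⟨n, d, hnd⟩ := v.exists_primeCompl_mul_eq_of_integer x hx.le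
    have h1 := congrArg (fun y => ‖σ y‖) hnd
    simp only [map_mul, norm_mul] at h1
    rw [hd d, mul_one] at h1
    rw [h1]
    change n ∈ embeddingIdeal σ
    rw [h, ← HeightOneSpectrum.valuation_lt_one_iff_mem (K := K)]
    change v.valuation K (algebraMap (𝓞 K) K n) < 1
    rw [← hnd, map_mul]
    refine mul_lt_one_of_nonneg_of_lt_one_left zero_le hx (v.valuation_le_one _)
  rw [ord_eq_zero_iff]
  constructor
  · intro hu
    rcases lt_trichotomy (v.valuation K (u : K)) 1 with h1 | h1 | h1
    · exact absurd hu (hlt _ h1).ne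
    · exact h1
    · have h2 := hlt (u : K)⁻¹ (by rw [map_inv₀]; exact inv_lt_one_of_one_lt₀ h1)
      rw [map_inv₀, norm_inv, hu, inv_one] at h2
      exact absurd h2 (lt_irrefl _)
  · intro hu
    refine le_antisymm (hle _ hu.le) ?_
    have h2 := hle (u : K)⁻¹ (by rw [map_inv₀, hu, inv_one])
    rw [map_inv₀, norm_inv] at h2
    exact (inv_le_one₀ (norm_pos_iff.mpr (by simp))).mp h2

end Embeddings

/-! ### The Iwasawa logarithm -/

section Log

variable {ℓ : ℕ} [Fact ℓ.Prime]

theorem iwasawaLog_one : iwasawaLog ℓ 1 = 0 := by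
  have h := iwasawaLog_mul (ℓ := ℓ) one_ne_zero one_ne_zero
  rw [mul_one] at h
  exact left_eq_add.mp h

theorem iwasawaLog_neg_one : iwasawaLog ℓ (-1) = 0 := by
  have h0 : (-1 : ℚ_[ℓ]) ≠ 0 := by simp
  have h := iwasawaLog_mul h0 h0
  rw [neg_mul_neg, mul_one, iwasawaLog_one, ← two_mul] at h
  exact (mul_eq_zero.mp h.symm).resolve_left two_ne_zero

theorem iwasawaLog_pow {x : ℚ_[ℓ]} (hx : x ≠ 0) (n : ℕ) :
    iwasawaLog ℓ (x ^ n) = n * iwasawaLog ℓ x := by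
  induction n with
  | zero => simp [iwasawaLog_one]
  | succ n ih => rw [pow_succ, iwasawaLog_mul (pow_ne_zero n hx) hx, ih]; push_cast; ring

theorem iwasawaLog_prime : iwasawaLog ℓ (ℓ : ℚ_[ℓ]) = 0 := by
  have hl : (ℓ : ℚ_[ℓ]) ≠ 0 := by exact_mod_cast (Fact.out : ℓ.Prime).ne_zero
  have h : principalUnit ℓ (ℓ : ℚ_[ℓ]) = principalUnit ℓ 1 := by
    rw [principalUnit, principalUnit, Padic.valuation_p, Padic.valuation_one]
    simp [hl]
  rw [iwasawaLog, h, ← iwasawaLog, iwasawaLog_one]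

theorem norm_prime_sub_one : ‖(ℓ : ℚ_[ℓ]) - 1‖ = 1 := by
  have h : ‖(ℓ : ℚ_[ℓ])‖ < ‖(-1 : ℚ_[ℓ])‖ := by
    rw [norm_neg, norm_one]; exact Padic.norm_p_lt_one
  rw [sub_eq_add_neg, Padic.add_eq_max_of_ne h.ne, max_eq_right h.le, norm_neg, norm_one]

theorem norm_iwasawaLog_le_one {x : ℚ_[ℓ]} (hx : x ≠ 0) : ‖iwasawaLog ℓ x‖ ≤ 1 := by
  have hl : (ℓ : ℚ_[ℓ]) ≠ 0 := by exact_mod_cast (Fact.out : ℓ.Prime).ne_zero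
  obtain ⟨z, hz⟩ := exists_principalUnit_eq hx
  obtain ⟨a, ha⟩ := exists_tendsto_logApprox z
  rw [iwasawaLog, hz, ha.limUnder_eq, norm_div, norm_prime_sub_one, div_one]
  refine le_of_tendsto ha.norm (Eventually.of_forall fun k => ?_)
  obtain ⟨t, ht⟩ := pow_sub_one_dvd z k
  have h : logApprox ℓ ((1 + ℓ * z : ℤ_[ℓ]) : ℚ_[ℓ]) k = ((ℓ * t : ℤ_[ℓ]) : ℚ_[ℓ]) := by
    rw [logApprox, ← PadicInt.coe_pow, ← PadicInt.coe_one, ← PadicInt.coe_sub, ht]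
    push_cast
    field_simp
    ring
  rw [h]
  exact PadicInt.norm_le_one _

theorem norm_prime_mul_lt_one (c : ℤ_[ℓ]) : ‖(ℓ : ℤ_[ℓ]) * c‖ < 1 := by
  rw [norm_mul]
  exact mul_lt_one_of_nonneg_of_lt_one_left (norm_nonneg _) (Padic.norm_p_lt_one (p := ℓ))
    (PadicInt.norm_le_one _)

theorem valuation_eq_zero_iff {x : ℚ_[ℓ]} (hx : x ≠ 0) : x.valuation = 0 ↔ ‖x‖ = 1 := by
  have hp : (1 : ℝ) < ℓ := by exact_mod_cast (Fact.out : ℓ.Prime).one_lt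
  rw [Padic.norm_eq_zpow_neg_valuation hx,
    zpow_eq_one_iff_right₀ (zero_le_one.trans hp.le) hp.ne', neg_eq_zero]

/-- The powers `(1 + ℓ² t) ^ ℓ ^ k` of a principal unit of exact level `2` have exact level
`k + 2`. -/
theorem exists_pow_eq_one_add {t : ℤ_[ℓ]} (ht : ‖t‖ = 1) (k : ℕ) :
    ∃ s : ℤ_[ℓ], ‖s‖ = 1 ∧ (1 + (ℓ : ℤ_[ℓ]) ^ 2 * t) ^ ℓ ^ k = 1 + (ℓ : ℤ_[ℓ]) ^ (k + 2) * s := by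
  induction k with
  | zero => exact ⟨t, ht, by simp⟩
  | succ k ih =>
    obtain ⟨s, hs, h⟩ := ih
    obtain ⟨c, hc⟩ := Polynomial.powAddExpansion (1 : ℤ_[ℓ]) ((ℓ : ℤ_[ℓ]) ^ (k + 2) * s) ℓ
    refine ⟨s + ℓ * (c * ℓ ^ k * s ^ 2), ?_, ?_⟩
    · have hlt := norm_prime_mul_lt_one (c * (ℓ : ℤ_[ℓ]) ^ k * s ^ 2)
      rw [PadicInt.norm_add_eq_max_of_ne (by rw [hs]; exact hlt.ne'), hs, max_eq_left hlt.le]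
    · rw [pow_succ ℓ k, pow_mul, h, hc]
      simp only [one_pow, mul_one]
      ring

theorem iwasawaLog_ne_zero_of_principalUnit_eq {t : ℤ_[ℓ]} (ht : ‖t‖ = 1) {x : ℚ_[ℓ]}
    (hx : principalUnit ℓ x = ((1 + (ℓ : ℤ_[ℓ]) ^ 2 * t : ℤ_[ℓ]) : ℚ_[ℓ])) :
    iwasawaLog ℓ x ≠ 0 := by
  have hl : (ℓ : ℚ_[ℓ]) ≠ 0 := by exact_mod_cast (Fact.out : ℓ.Prime).ne_zero
  have hx' : principalUnit ℓ x = ((1 + (ℓ : ℤ_[ℓ]) * ((ℓ : ℤ_[ℓ]) * t) : ℤ_[ℓ]) : ℚ_[ℓ]) := by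
    rw [hx, pow_two, mul_assoc]
  obtain ⟨a, ha⟩ := exists_tendsto_logApprox ((ℓ : ℤ_[ℓ]) * t)
  rw [← hx'] at ha
  have hconst : ∀ k, ‖logApprox ℓ (principalUnit ℓ x) k‖ = ‖(ℓ : ℚ_[ℓ])‖ ^ 2 := by
    intro k
    obtain ⟨s, hs, h⟩ := exists_pow_eq_one_add ht k
    have h2 : logApprox ℓ (principalUnit ℓ x) k = (ℓ : ℚ_[ℓ]) ^ 2 * (s : ℚ_[ℓ]) := by
      rw [logApprox, hx, ← PadicInt.coe_pow, h, div_eq_iff (pow_ne_zero k hl)]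
      push_cast
      ring
    have hs' : ‖(s : ℚ_[ℓ])‖ = 1 := hs
    rw [h2, norm_mul, norm_pow, hs', mul_one]
  have hna : ‖a‖ = ‖(ℓ : ℚ_[ℓ])‖ ^ 2 :=
    tendsto_nhds_unique ha.norm ((tendsto_congr hconst).mpr tendsto_const_nhds)
  rw [iwasawaLog, ha.limUnder_eq]
  refine div_ne_zero ?_ ?_
  · rw [← norm_ne_zero_iff, hna]
    exact pow_ne_zero 2 (norm_ne_zero_iff.mpr hl)
  · rw [← norm_ne_zero_iff, norm_prime_sub_one]
    exact one_ne_zero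

/-- The Iwasawa logarithm is not identically zero. -/
theorem iwasawaLog_one_add_ne_zero : iwasawaLog ℓ (1 + (ℓ : ℚ_[ℓ]) ^ 2) ≠ 0 := by
  have hp : ℓ.Prime := Fact.out
  have hl : (ℓ : ℚ_[ℓ]) ≠ 0 := by exact_mod_cast hp.ne_zero
  have hn : ‖(1 + (ℓ : ℚ_[ℓ]) ^ 2)‖ = 1 := by
    have h : ‖(ℓ : ℚ_[ℓ]) ^ 2‖ < ‖(1 : ℚ_[ℓ])‖ := by
      rw [norm_pow, norm_one]
      exact pow_lt_one₀ (norm_nonneg _) Padic.norm_p_lt_one two_ne_zero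
    rw [Padic.add_eq_max_of_ne h.ne', max_eq_left h.le, norm_one]
  have h0 : (1 + (ℓ : ℚ_[ℓ]) ^ 2) ≠ 0 := by
    rw [← norm_ne_zero_iff, hn]; exact one_ne_zero
  have hv : (1 + (ℓ : ℚ_[ℓ]) ^ 2).valuation = 0 := (valuation_eq_zero_iff h0).mpr hn
  obtain ⟨c, hc⟩ := Polynomial.powAddExpansion (1 : ℤ_[ℓ]) ((ℓ : ℤ_[ℓ]) ^ 2) (ℓ - 1)
  have hu : principalUnit ℓ (1 + (ℓ : ℚ_[ℓ]) ^ 2) =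
      ((1 + ℓ ^ 2 * (((ℓ - 1 : ℕ) : ℤ_[ℓ]) + ℓ * (ℓ * c)) : ℤ_[ℓ]) : ℚ_[ℓ]) := by
    have h1 : (1 + (ℓ : ℤ_[ℓ]) ^ 2 * (((ℓ - 1 : ℕ) : ℤ_[ℓ]) + ℓ * (ℓ * c))) =
        (1 + (ℓ : ℤ_[ℓ]) ^ 2) ^ (ℓ - 1) := by
      rw [hc]; simp only [one_pow, mul_one]; ring
    rw [principalUnit, hv, h1]
    simp
  have ht : ‖((ℓ - 1 : ℕ) : ℤ_[ℓ]) + ℓ * (ℓ * c)‖ = 1 := by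
    have h1 : ‖((ℓ - 1 : ℕ) : ℤ_[ℓ])‖ = 1 := by
      rw [PadicInt.norm_natCast_eq_one_iff]
      exact (Nat.coprime_self_sub_right hp.one_le).mpr (Nat.coprime_one_right _)
    have hlt := norm_prime_mul_lt_one ((ℓ : ℤ_[ℓ]) * c)
    rw [PadicInt.norm_add_eq_max_of_ne (by rw [h1]; exact hlt.ne'), h1, max_eq_left hlt.le]
  exact iwasawaLog_ne_zero_of_principalUnit_eq ht hu

end Log

/-! ### Local norms -/

section LocalNorm

variable {p : ℕ} [Fact p.Prime] {K L : Type*} [Field K] [Field L]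

/-- The local norm at the place of `K` induced by `σ`. -/
def localNorm (σ : K →+* PadicAlgCl p) : K →* ℚ_[p] :=
  (Algebra.norm ℚ_[p] (S := localField σ)).comp (toLocalField σ : K →* localField σ)

/-- Isomorphic fields with conjugate embeddings have the same local norm. -/
theorem localNorm_apply_equiv {σ : K →+* PadicAlgCl p} {τ : L →+* PadicAlgCl p} (f : K ≃+* L)
    (g : PadicAlgCl p ≃ₐ[ℚ_[p]] PadicAlgCl p) (h : ∀ x, g (σ x) = τ (f x)) (x : K) :
    localNorm τ (f x) = localNorm σ x := by
  have h' : ∀ y, (g.symm : PadicAlgCl p →ₐ[ℚ_[p]] PadicAlgCl p) (τ y) =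
      σ ((f.symm : L →+* K) y) := by
    intro y
    have h2 := h (f.symm y)
    rw [f.apply_symm_apply] at h2
    exact g.injective ((g.apply_symm_apply _).trans h2.symm)
  let e : localField σ ≃ₐ[ℚ_[p]] localField τ := AlgEquiv.ofAlgHom
    (localFieldMap (f : K →+* L) (g : PadicAlgCl p →ₐ[ℚ_[p]] PadicAlgCl p) h)
    (localFieldMap (f.symm : L →+* K) (g.symm : PadicAlgCl p →ₐ[ℚ_[p]] PadicAlgCl p) h')
    (AlgHom.ext fun y => Subtype.ext (g.apply_symm_apply y))
    (AlgHom.ext fun y => Subtype.ext (g.symm_apply_apply y))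
  have he : e (toLocalField σ x) = toLocalField τ (f x) := Subtype.ext (h x)
  change Algebra.norm ℚ_[p] (toLocalField τ (f x)) = Algebra.norm ℚ_[p] (toLocalField σ x)
  rw [← he, Algebra.norm_eq_of_algEquiv e]

/-- A `ℚ_p`-embedding of a subfield of the algebraic closure extends to an automorphism. -/
theorem exists_algEquiv_extending (F : IntermediateField ℚ_[p] (PadicAlgCl p))
    (j : F →ₐ[ℚ_[p]] PadicAlgCl p) :
    ∃ g : PadicAlgCl p ≃ₐ[ℚ_[p]] PadicAlgCl p, ∀ y : F, g y = j y := by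
  obtain ⟨φ, hφ⟩ := IsAlgClosed.surjective_domRestrict_of_isAlgebraic (K := ℚ_[p]) (L := F)
    (M := PadicAlgCl p) (E := PadicAlgCl p) j
  refine ⟨AlgEquiv.ofBijective φ (Algebra.IsAlgebraic.algHom_bijective φ), fun y => ?_⟩
  exact DFunLike.congr_fun hφ y

variable (p) in
/-- The place of `K` induced by an embedding. -/
def placeOf (σ : K →+* PadicAlgCl p) : WildPlace p K := Quotient.mk (embeddingSetoid p K) σ

theorem placeOf_eq_iff {σ τ : K →+* PadicAlgCl p} :
    placeOf p σ = placeOf p τ ↔ ∃ g : PadicAlgCl p ≃ₐ[ℚ_[p]] PadicAlgCl p,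
      τ = (g : PadicAlgCl p →+* PadicAlgCl p).comp σ :=
  Quotient.eq (r := embeddingSetoid p K)

theorem placeOf_out (l : WildPlace p K) : placeOf p (Quotient.out l) = l := Quotient.out_eq l

theorem localNorm_out_placeOf (σ : K →+* PadicAlgCl p) :
    localNorm (Quotient.out (placeOf p σ)) = localNorm σ := by
  obtain ⟨g, hg⟩ := placeOf_eq_iff.mp (placeOf_out (placeOf p σ))
  ext x
  exact (localNorm_apply_equiv (RingEquiv.refl K) g
    (fun y => (RingHom.congr_fun hg y).symm) x).symm

theorem localNorm_ne_zero (σ : K →+* PadicAlgCl p) (u : Kˣ) : localNorm σ u ≠ 0 :=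
  (u.isUnit.map (localNorm σ)).ne_zero

variable [NumberField K]

theorem norm_localNorm (σ : K →+* PadicAlgCl p) (x : K) :
    ‖localNorm σ x‖ = ‖σ x‖ ^ Module.finrank ℚ_[p] (localField σ) := by
  have h := Algebra.norm_eq_prod_embeddings ℚ_[p] (PadicAlgCl p) (toLocalField σ x)
  have h2 := congrArg norm h
  rw [norm_prod, PadicAlgCl.norm_extends] at h2
  have h3 : ∀ j : localField σ →ₐ[ℚ_[p]] PadicAlgCl p, ‖j (toLocalField σ x)‖ = ‖σ x‖ := by
    intro j
    rw [← PadicAlgCl.spectralNorm_eq, ← PadicAlgCl.spectralNorm_eq, spectralNorm, spectralNorm]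
    congr 1
    rw [minpoly.algHom_eq j j.injective, ← minpoly.algHom_eq (localField σ).val
      (localField σ).val.injective]
    rfl
  rw [Finset.prod_congr rfl fun j _ => h3 j, Finset.prod_const, Finset.card_univ,
    AlgHom.card ℚ_[p] (localField σ) (PadicAlgCl p)] at h2
  exact h2

open scoped Classical in
/-- The global norm is the product of the local norms. -/
theorem prod_localNorm (x : K) :
    ∏ l : WildPlace p K, localNorm (Quotient.out l) x = ((Algebra.norm ℚ x : ℚ) : ℚ_[p]) := by
  apply (algebraMap ℚ_[p] (PadicAlgCl p)).injective
  have : Fintype (K →+* PadicAlgCl p) := Fintype.ofFinite _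
  have hN : (algebraMap ℚ_[p] (PadicAlgCl p)) ((Algebra.norm ℚ x : ℚ) : ℚ_[p]) =
      ∏ σ : K →+* PadicAlgCl p, σ x := by
    rw [map_ratCast, ← eq_ratCast (algebraMap ℚ (PadicAlgCl p)),
      Algebra.norm_eq_prod_embeddings ℚ (PadicAlgCl p) x]
    exact (Fintype.prod_equiv (RingHom.equivRatAlgHom K (PadicAlgCl p)) _ _ fun σ => rfl).symm
  rw [hN, map_prod, ← Finset.prod_fiberwise Finset.univ (placeOf p)]
  refine Finset.prod_congr rfl fun l _ => ?_
  change algebraMap _ _ (Algebra.norm ℚ_[p] (toLocalField (Quotient.out l) x)) = _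
  rw [Algebra.norm_eq_prod_embeddings ℚ_[p] (PadicAlgCl p)]
  -- the embeddings inducing `l` are the `ℚ_p`-embeddings of the completion at `l`
  refine Finset.prod_bij (fun j _ => (j : _ →+* PadicAlgCl p).comp (toLocalField (Quotient.out l)))
    ?_ ?_ ?_ ?_
  · intro j _
    rw [Finset.mem_filter]
    refine ⟨Finset.mem_univ _, ?_⟩
    obtain ⟨g, hg⟩ := exists_algEquiv_extending _ j
    conv_rhs => rw [← placeOf_out l]
    exact (placeOf_eq_iff.mpr ⟨g, RingHom.ext fun y => (hg (toLocalField _ y)).symm⟩).symm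
  · intro j _ j' _ h
    refine IntermediateField.algHom_ext_of_eq_adjoin _ rfl ?_
    rintro _ ⟨y, rfl⟩
    exact RingHom.congr_fun h y
  · intro σ hσ
    rw [Finset.mem_filter] at hσ
    obtain ⟨g, hg⟩ := placeOf_eq_iff.mp ((placeOf_out l).trans hσ.2.symm)
    exact ⟨(g : PadicAlgCl p →ₐ[ℚ_[p]] PadicAlgCl p).comp (localField _).val, Finset.mem_univ _,
      hg.symm⟩
  · intro j _
    rfl

end LocalNorm

/-! ### Logarithmic valuations -/

section LogValuations

variable {ℓ : ℕ} [Fact ℓ.Prime] {K : Type*} [Field K]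

/-- The logarithmic valuation `- Log ∘ N` at a place above `ℓ`, as a map on `ℛ_K`. -/
def logValuation (l : WildPlace ℓ K) : AdicMul ℓ K →ₗ[ℤ_[ℓ]] ℚ_[ℓ] :=
  l.logVal.comp (AdicMul.map ℓ (toLocalField (Quotient.out l)))

/-- The usual valuation of the local norm at a place above `ℓ`, as a map on `ℛ_K`. -/
def normValuation (l : WildPlace ℓ K) : AdicMul ℓ K →ₗ[ℤ_[ℓ]] ℚ_[ℓ] :=
  LinearMap.liftBaseChange ℤ_[ℓ] (AddMonoidHom.mk'
    (fun u : Additive Kˣ => ((localNorm (Quotient.out l) (u.toMul : Kˣ)).valuation : ℚ_[ℓ]))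
    fun x y => by
      rw [toMul_add, Units.val_mul, map_mul, Padic.valuation_mul (localNorm_ne_zero _ _)
        (localNorm_ne_zero _ _), Int.cast_add]).toIntLinearMap

theorem logValuation_one_tmul (l : WildPlace ℓ K) (u : Kˣ) :
    logValuation l (1 ⊗ₜ Additive.ofMul u) =
      -iwasawaLog ℓ (localNorm (Quotient.out l) (u : K)) := by
  rw [logValuation, LinearMap.comp_apply, AdicMul.map_tmul, WildPlace.logVal,
    LinearMap.liftBaseChange_tmul, one_smul]
  rfl

theorem normValuation_one_tmul (l : WildPlace ℓ K) (u : Kˣ) :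
    normValuation l (1 ⊗ₜ Additive.ofMul u) =
      ((localNorm (Quotient.out l) (u : K)).valuation : ℚ_[ℓ]) := by
  rw [normValuation, LinearMap.liftBaseChange_tmul, one_smul]
  rfl

/-- The action of an automorphism of `K` on the places above `ℓ`. -/
def WildPlace.comap (f : K ≃+* K) (l : WildPlace ℓ K) : WildPlace ℓ K :=
  placeOf ℓ ((Quotient.out l).comp (f : K →+* K))

theorem WildPlace.comap_comap (f g : K ≃+* K) (l : WildPlace ℓ K) :
    (l.comap f).comap g = placeOf ℓ ((Quotient.out l).comp ((f : K →+* K).comp (g : K →+* K))) := by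
  obtain ⟨h, hh⟩ := placeOf_eq_iff.mp (placeOf_out (l.comap f))
  exact placeOf_eq_iff.mpr ⟨h, by rw [← RingHom.comp_assoc, hh]; rfl⟩

theorem localNorm_out_comap (f : K ≃+* K) (l : WildPlace ℓ K) (x : K) :
    localNorm (Quotient.out (l.comap f)) x = localNorm (Quotient.out l) (f x) := by
  rw [WildPlace.comap, localNorm_out_placeOf]
  exact (localNorm_apply_equiv f AlgEquiv.refl (fun _ => rfl) x).symm

theorem logValuation_map (f : K ≃+* K) (l : WildPlace ℓ K) (x : AdicMul ℓ K) :
    logValuation l (AdicMul.map ℓ (f : K →+* K) x) = logValuation (l.comap f) x := by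
  have h : (logValuation l).comp (AdicMul.map ℓ (f : K →+* K)) = logValuation (l.comap f) :=
    AdicMul.linearMap_ext fun u => by
      rw [LinearMap.comp_apply, AdicMul.map_tmul, logValuation_one_tmul, logValuation_one_tmul,
        localNorm_out_comap]
      rfl
  exact DFunLike.congr_fun h x

theorem normValuation_map (f : K ≃+* K) (l : WildPlace ℓ K) (x : AdicMul ℓ K) :
    normValuation l (AdicMul.map ℓ (f : K →+* K) x) = normValuation (l.comap f) x := by
  have h : (normValuation l).comp (AdicMul.map ℓ (f : K →+* K)) = normValuation (l.comap f) :=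
    AdicMul.linearMap_ext fun u => by
      rw [LinearMap.comp_apply, AdicMul.map_tmul, normValuation_one_tmul, normValuation_one_tmul,
        localNorm_out_comap]
      rfl
  exact DFunLike.congr_fun h x

theorem padicInt_smul_def (c : ℤ_[ℓ]) (x : ℚ_[ℓ]) : c • x = (c : ℚ_[ℓ]) * x := rfl

theorem norm_apply_le_one_of_forall_one_tmul {E : Type*} [Field E] (f : AdicMul ℓ E →ₗ[ℤ_[ℓ]] ℚ_[ℓ])
    (hf : ∀ u : Eˣ, ‖f (1 ⊗ₜ Additive.ofMul u)‖ ≤ 1) (x : AdicMul ℓ E) : ‖f x‖ ≤ 1 := by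
  induction x using AdicMul.induction with
  | hadd x y hx hy =>
    rw [map_add]
    exact (Padic.nonarchimedean _ _).trans (max_le hx hy)
  | hsmul c x hx =>
    rw [map_smul, padicInt_smul_def, norm_mul]
    exact mul_le_one₀ c.norm_le_one (norm_nonneg _) hx
  | hone u => exact hf u

/-- A bounded linear form kills the elements which are infinitely `ℓ`-divisible up to torsion. -/
theorem eq_zero_of_mem_almostDivisiblePart {M : Type*} [AddCommGroup M] [Module ℤ_[ℓ] M]
    (f : M →ₗ[ℤ_[ℓ]] ℚ_[ℓ]) (hf : ∀ x, ‖f x‖ ≤ 1) {x : M} (hx : x ∈ almostDivisiblePart ℓ M) :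
    f x = 0 := by
  obtain ⟨k, hk⟩ := mem_almostDivisiblePart_iff.mp hx
  have hl : ((ℓ : ℤ_[ℓ]) ^ k) ≠ 0 := pow_ne_zero k natCast_prime_ne_zero
  have h0 : f ((ℓ : ℤ_[ℓ]) ^ k • x) = 0 := by
    rw [← norm_le_zero_iff]
    refine ge_of_tendsto' (tendsto_pow_atTop_nhds_zero_of_lt_one (norm_nonneg (ℓ : ℚ_[ℓ]))
      Padic.norm_p_lt_one) fun n => ?_
    obtain ⟨y, hy⟩ := mem_divisiblePart_iff.mp hk n
    rw [hy, map_smul, padicInt_smul_def, norm_mul, PadicInt.coe_pow, norm_pow]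
    exact mul_le_of_le_one_right (by positivity) (hf y)
  rw [map_smul] at h0
  exact (smul_eq_zero.mp h0).resolve_left hl

theorem logValuation_eq_zero {x : AdicMul ℓ K} (hx : x ∈ pseudoInfinitesimal ℓ K)
    (l : WildPlace ℓ K) : logValuation l x = 0 := by
  refine eq_zero_of_mem_almostDivisiblePart l.logVal
    (norm_apply_le_one_of_forall_one_tmul _ fun u => ?_)
    (mem_pseudoInfinitesimal_iff.mp hx _)
  rw [WildPlace.logVal, LinearMap.liftBaseChange_tmul, one_smul]
  change ‖-iwasawaLog ℓ _‖ ≤ 1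
  rw [norm_neg]
  exact norm_iwasawaLog_le_one (u.isUnit.map (Algebra.norm ℚ_[ℓ])).ne_zero

variable [NumberField K]

theorem logDiv_eq_toLog_iff {x : AdicMul ℓ K} {a : Divisor ℓ K} :
    logDiv ℓ K x = Divisor.toLog ℓ K a ↔ div ℓ K x = a ∧ ∀ l, logValuation l x = 0 := by
  rw [Prod.ext_iff, funext_iff]
  refine and_congr Iff.rfl (forall_congr' fun l => ?_)
  rw [Subtype.ext_iff]
  rfl

theorem logDiv_eq_zero_iff {x : AdicMul ℓ K} :
    logDiv ℓ K x = 0 ↔ div ℓ K x = 0 ∧ ∀ l, logValuation l x = 0 := by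
  rw [← logDiv_eq_toLog_iff, map_zero]

theorem logDiv_of_mem_pseudoInfinitesimal {x : AdicMul ℓ K} (hx : x ∈ pseudoInfinitesimal ℓ K) :
    logDiv ℓ K x = Divisor.toLog ℓ K (div ℓ K x) :=
  logDiv_eq_toLog_iff.mpr ⟨rfl, logValuation_eq_zero hx⟩

/-- The kernel of the logarithmic divisor map is stable under automorphisms. -/
theorem logDiv_map_eq_zero (f : K ≃+* K) {x : AdicMul ℓ K} (hx : logDiv ℓ K x = 0) :
    logDiv ℓ K (AdicMul.map ℓ (f : K →+* K) x) = 0 := by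
  rw [logDiv_eq_zero_iff] at hx ⊢
  exact ⟨div_map_eq_zero _ hx.1, fun l => by rw [logValuation_map]; exact hx.2 _⟩

end LogValuations

/-! ### The product formula -/

section ProductFormula

variable {ℓ : ℕ} [Fact ℓ.Prime] {K : Type*} [Field K] [NumberField K]

theorem iwasawaLog_absNorm_of_mem {v : HeightOneSpectrum (𝓞 K)} (hv : (ℓ : 𝓞 K) ∈ v.asIdeal) :
    iwasawaLog ℓ (Ideal.absNorm v.asIdeal : ℚ_[ℓ]) = 0 := by
  have hl : (ℓ : ℚ_[ℓ]) ≠ 0 := by exact_mod_cast (Fact.out : ℓ.Prime).ne_zero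
  have h1 : Ideal.absNorm v.asIdeal ∣ Ideal.absNorm (Ideal.span {(ℓ : 𝓞 K)}) :=
    Ideal.absNorm_dvd_absNorm_of_le ((Ideal.span_singleton_le_iff_mem _).mpr hv)
  have h2 : Ideal.absNorm (Ideal.span {(ℓ : 𝓞 K)}) = ℓ ^ Module.finrank ℤ (𝓞 K) := by
    rw [Ideal.absNorm_span_singleton]
    have := Algebra.norm_algebraMap (R := ℤ) (S := 𝓞 K) (ℓ : ℤ)
    rw [map_natCast] at this
    rw [this, Int.natAbs_pow, Int.natAbs_natCast]
  rw [h2] at h1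
  obtain ⟨f, -, hf⟩ := (Nat.dvd_prime_pow Fact.out).mp h1
  rw [hf, Nat.cast_pow, iwasawaLog_pow hl, iwasawaLog_prime, mul_zero]

theorem iwasawaLog_prod {ι : Type*} (s : Finset ι) (f : ι → ℚ_[ℓ]) (hf : ∀ i, f i ≠ 0) :
    iwasawaLog ℓ (∏ i ∈ s, f i) = ∑ i ∈ s, iwasawaLog ℓ (f i) := by
  classical
  induction s using Finset.induction_on with
  | empty => simp [iwasawaLog_one]
  | insert a s ha ih =>
    rw [Finset.prod_insert ha, Finset.sum_insert ha,
      iwasawaLog_mul (hf a) (Finset.prod_ne_zero_iff.mpr fun i _ => hf i), ih]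

open scoped Classical in
theorem linearCombination_div_coe {π : 𝓞 K} (u : Kˣ) (hu : (u : K) = π) :
    Finsupp.linearCombination ℤ_[ℓ]
      (fun v : TamePlace ℓ K => iwasawaLog ℓ (Ideal.absNorm v.1.asIdeal : ℚ_[ℓ]))
      (div ℓ K (1 ⊗ₜ Additive.ofMul u)) = iwasawaLog ℓ ((Algebra.norm ℚ (u : K) : ℚ) : ℚ_[ℓ]) := by
  have hπ : π ≠ 0 := by
    rintro rfl
    exact u.ne_zero (by rw [hu]; rfl)
  have hI : Ideal.span {π} ≠ 0 := by simpa using hπ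
  let c : HeightOneSpectrum (𝓞 K) → ℕ := fun v =>
    (Associates.mk v.asIdeal).count (Associates.mk (Ideal.span {π})).factors
  have hc : ∀ v, ord v u = c v := by
    intro v
    rw [ord_eq_iff, hu]
    change v.valuation K (algebraMap (𝓞 K) K π) = _
    rw [HeightOneSpectrum.valuation_of_algebraMap, HeightOneSpectrum.intValuation_if_neg _ hπ]
  have hfin : (Function.mulSupport fun v : HeightOneSpectrum (𝓞 K) =>
      v.maxPowDividing (Ideal.span {π})).Finite :=
    Ideal.hasFiniteMulSupport hI
  have hNv : ∀ v : HeightOneSpectrum (𝓞 K), (Ideal.absNorm v.asIdeal : ℚ_[ℓ]) ≠ 0 := fun v => by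
    exact_mod_cast (Ideal.absNorm_ne_zero_iff_mem_nonZeroDivisors.mpr
      (mem_nonZeroDivisors_of_ne_zero v.ne_bot))
  have hS : ∀ v, v ∉ hfin.toFinset → c v = 0 := by
    intro v hv
    rw [Set.Finite.mem_toFinset, Function.notMem_mulSupport] at hv
    by_contra h0
    have h1 : v.asIdeal ∣ 1 := by
      rw [← hv]
      exact dvd_pow_self _ h0
    exact v.isPrime.ne_top (Ideal.isUnit_iff.mp (isUnit_of_dvd_one h1))
  -- the norm of `π` is, up to sign, the product of the `N v ^ v(π)`
  have hnorm : iwasawaLog ℓ ((Algebra.norm ℚ (u : K) : ℚ) : ℚ_[ℓ]) =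
      iwasawaLog ℓ (Ideal.absNorm (Ideal.span {π}) : ℚ_[ℓ]) := by
    rw [Ideal.absNorm_span_singleton, hu, ← Algebra.coe_norm_int]
    have hN0 : ((Algebra.norm ℤ π : ℤ) : ℚ_[ℓ]) ≠ 0 := by
      exact_mod_cast Algebra.norm_ne_zero_iff.mpr hπ
    rcases Int.natAbs_eq (Algebra.norm ℤ π) with h | h
    · conv_lhs => rw [h]
      rw [Int.cast_natCast, Rat.cast_natCast]
    · have h' : ((Algebra.norm ℤ π : ℤ) : ℚ_[ℓ]) = -1 * ((Algebra.norm ℤ π).natAbs : ℚ_[ℓ]) := by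
        conv_lhs => rw [h]
        simp
      rw [Rat.cast_intCast, h', iwasawaLog_mul (by simp) (fun h0 => hN0 (by rw [h', h0, mul_zero])),
        iwasawaLog_neg_one, zero_add]
  have hprod : iwasawaLog ℓ (Ideal.absNorm (Ideal.span {π}) : ℚ_[ℓ]) =
      ∑ v ∈ hfin.toFinset, (c v : ℚ_[ℓ]) * iwasawaLog ℓ (Ideal.absNorm v.asIdeal : ℚ_[ℓ]) := by
    conv_lhs => rw [← Ideal.finprod_heightOneSpectrum_factorization hI]
    rw [finprod_eq_prod _ hfin, map_prod, Nat.cast_prod, iwasawaLog_prod]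
    · refine Finset.sum_congr rfl fun v _ => ?_
      rw [← iwasawaLog_pow (hNv v), HeightOneSpectrum.maxPowDividing, map_pow, Nat.cast_pow]
    · intro v
      rw [HeightOneSpectrum.maxPowDividing, map_pow, Nat.cast_pow]
      exact pow_ne_zero _ (hNv v)
  rw [hnorm, hprod, Finsupp.linearCombination_apply,
    Finsupp.sum_of_support_subset (s := hfin.toFinset.subtype fun v => (ℓ : 𝓞 K) ∉ v.asIdeal)]
  · have h1 : ∀ v : TamePlace ℓ K, div ℓ K (1 ⊗ₜ Additive.ofMul u) v •
        iwasawaLog ℓ (Ideal.absNorm v.1.asIdeal : ℚ_[ℓ]) =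
        (c v.1 : ℚ_[ℓ]) * iwasawaLog ℓ (Ideal.absNorm v.1.asIdeal : ℚ_[ℓ]) := by
      intro v
      rw [div_one_tmul_apply, hc, padicInt_smul_def]
      simp
    rw [Finset.sum_congr rfl fun v _ => h1 v, Finset.sum_subtype_eq_sum_filter (f := fun v =>
      (c v : ℚ_[ℓ]) * iwasawaLog ℓ (Ideal.absNorm v.asIdeal : ℚ_[ℓ]))]
    refine Finset.sum_filter_of_ne fun v _ hv hmem => hv ?_
    rw [iwasawaLog_absNorm_of_mem hmem, mul_zero]
  · intro v hv
    rw [Finset.mem_subtype]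
    by_contra h
    rw [Finsupp.mem_support_iff, div_one_tmul_apply, hc, hS _ h] at hv
    exact hv (by simp)
  · intro v _
    rw [zero_smul]

/-- The product formula: principal logarithmic divisors have degree `0`. -/
theorem degree_logDiv (x : AdicMul ℓ K) : LogDivisor.degree ℓ K (logDiv ℓ K x) = 0 := by
  let D := (LogDivisor.degree ℓ K).comp (logDiv ℓ K)
  have hint : ∀ (u : Kˣ) (π : 𝓞 K), (u : K) = π → D (1 ⊗ₜ Additive.ofMul u) = 0 := by
    intro u π hu
    have h1 : D (1 ⊗ₜ Additive.ofMul u) = Finsupp.linearCombination ℤ_[ℓ]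
        (fun v : TamePlace ℓ K => iwasawaLog ℓ (Ideal.absNorm v.1.asIdeal : ℚ_[ℓ]))
        (div ℓ K (1 ⊗ₜ Additive.ofMul u)) +
        ∑ l : WildPlace ℓ K, logValuation l (1 ⊗ₜ Additive.ofMul u) := by
      change _ + (∑ l : WildPlace ℓ K, (LinearMap.range l.logVal).subtype.comp
        (LinearMap.proj l)) _ = _
      rw [LinearMap.sum_apply]
      rfl
    have h2 := iwasawaLog_prod Finset.univ
      (fun l : WildPlace ℓ K => localNorm (Quotient.out l) (u : K)) fun l => localNorm_ne_zero _ u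
    rw [h1, linearCombination_div_coe u hu, ← prod_localNorm, h2, ← Finset.sum_add_distrib]
    refine Finset.sum_eq_zero fun l _ => ?_
    rw [logValuation_one_tmul, add_neg_cancel]
  have h : D = 0 := by
    refine AdicMul.linearMap_ext fun u => ?_
    obtain ⟨a, b, hb, hab⟩ := IsFractionRing.div_surjective (A := 𝓞 K) (u : K)
    have hb0 : (b : K) ≠ 0 := by simpa using nonZeroDivisors.ne_zero hb
    have ha0 : (a : K) ≠ 0 := by
      intro h0
      refine u.ne_zero (hab.symm.trans ?_)
      change (a : K) / (b : K) = 0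
      rw [h0, zero_div]
    have hu : Additive.ofMul u = Additive.ofMul (Units.mk0 (a : K) ha0) -
        Additive.ofMul (Units.mk0 (b : K) hb0) := by
      rw [← ofMul_div]
      congr 1
      ext1
      rw [Units.val_div_eq_div_val]
      exact hab.symm
    rw [hu, TensorProduct.tmul_sub, map_sub, hint _ a rfl, hint _ b rfl, sub_zero,
      LinearMap.zero_apply]
  exact DFunLike.congr_fun h x

end ProductFormula

/-! ### Comparison of two families of valuations -/

section GrossKuzmin

variable {ℓ : ℕ} [Fact ℓ.Prime]

/-- Let `Φ` and `Ψ` be linear maps from a `ℤ_ℓ`-module to a finite-dimensional space. If `Ψ` is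
injective up to torsion and the image of `Φ` spans, then `Φ` is injective up to torsion. -/
theorem ker_le_torsion_of_span_eq_top {V W : Type*} [AddCommGroup V] [Module ℤ_[ℓ] V]
    [AddCommGroup W] [Module ℚ_[ℓ] W] [Module ℤ_[ℓ] W] [IsScalarTower ℤ_[ℓ] ℚ_[ℓ] W]
    [FiniteDimensional ℚ_[ℓ] W] (Φ Ψ : V →ₗ[ℤ_[ℓ]] W)
    (hΨ : LinearMap.ker Ψ ≤ Submodule.torsion ℤ_[ℓ] V)
    (hΦ : Submodule.span ℚ_[ℓ] (Set.range Φ) = ⊤) :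
    LinearMap.ker Φ ≤ Submodule.torsion ℤ_[ℓ] V := by
  intro e he
  by_contra hnt
  obtain ⟨b, hb, hspan, hli⟩ := exists_linearIndependent ℚ_[ℓ] (Set.range Φ)
  rw [hΦ] at hspan
  have hli' : LinearIndependent ℤ_[ℓ] ((↑) : b → W) := hli.restrict_scalars' ℤ_[ℓ]
  have : Fintype b := hli.setFinite.fintype
  have hcard : Fintype.card b = Module.finrank ℚ_[ℓ] W := by
    have := linearIndependent_iff_card_eq_finrank_span.mp hli
    rw [Subtype.range_coe, Set.finrank, hspan, finrank_top] at this
    exact this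
  choose v hv using fun i : b => hb i.2
  have hW : ∀ {c : ℤ_[ℓ]} {w : W}, c ≠ 0 → c • w = 0 → w = 0 := by
    intro c w hc h
    rw [← algebraMap_smul ℚ_[ℓ] c w] at h
    refine (smul_eq_zero.mp h).resolve_left ?_
    exact fun h0 => hc (Subtype.ext h0)
  have key : LinearIndependent ℤ_[ℓ] (fun o : Option b => Ψ (o.elim e v)) := by
    rw [Fintype.linearIndependent_iff]
    intro c hc
    have h1 : ∑ o : Option b, c o • o.elim e v ∈ Submodule.torsion ℤ_[ℓ] V := by
      refine hΨ ?_
      rw [LinearMap.mem_ker, map_sum]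
      simpa only [map_smul] using hc
    obtain ⟨k, hk⟩ := mem_torsion_iff.mp h1
    have hk0 : (ℓ : ℤ_[ℓ]) ^ k ≠ 0 := pow_ne_zero k natCast_prime_ne_zero
    have h2 : ∑ o : Option b, c o • Φ (o.elim e v) = 0 := by
      refine hW hk0 ?_
      rw [← map_zero Φ, ← hk, map_smul, map_sum]
      simp only [map_smul]
    rw [Fintype.sum_option] at h2 h1
    have h3 : ∀ i : b, c (some i) = 0 := by
      refine Fintype.linearIndependent_iff.mp hli' (fun i => c (some i)) ?_
      rw [LinearMap.mem_ker] at he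
      simpa only [Option.elim, he, smul_zero, zero_add, hv] using h2
    have h4 : c none = 0 := by
      by_contra h4
      refine hnt ((smul_mem_torsion h4).mp ?_)
      simpa only [Option.elim, h3, zero_smul, Finset.sum_const_zero, add_zero] using h1
    rintro (_ | i)
    · exact h4
    · exact h3 i
  rw [LinearIndependent.iff_fractionRing ℤ_[ℓ] ℚ_[ℓ]] at key
  have := key.fintype_card_le_finrank
  rw [Fintype.card_option, hcard] at this
  omega

/-- Simultaneous kernels in `ℤ_ℓ ⊗ A` of a locally finite family of homomorphisms `A → ℤ`. -/
theorem exists_of_forall_eq_zero {A ι : Type*} [AddCommGroup A] (f : A →+ (ι →₀ ℤ))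
    {x : ℤ_[ℓ] ⊗[ℤ] A}
    (hx : ∀ i, LinearMap.liftBaseChange ℤ_[ℓ] ((Int.castAddHom ℤ_[ℓ]).comp
      ((Finsupp.applyAddHom i).comp f)).toIntLinearMap x = 0) :
    ∃ y : ℤ_[ℓ] ⊗[ℤ] f.ker, f.ker.subtype.toIntLinearMap.baseChange ℤ_[ℓ] y = x := by
  classical
  refine exists_of_baseChange_eq_zero f ?_
  apply (TensorProduct.finsuppScalarRight ℤ ℤ ℤ_[ℓ] ι).injective
  rw [map_zero]
  ext1 i
  rw [Finsupp.zero_apply, ← hx i]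
  generalize x = x
  induction x using TensorProduct.induction_on with
  | zero => simp
  | tmul c a =>
    rw [LinearMap.baseChange_tmul, TensorProduct.finsuppScalarRight_apply_tmul_apply]
    simp [mul_comm]
  | add x y hx hy => rw [map_add, map_add, Finsupp.add_apply, hx, hy, map_add]

end GrossKuzmin

/-! ### Odd `ℓ`-units and the Gross–Kuz'min conjecture -/

section MinusPart

variable {ℓ : ℕ} [Fact ℓ.Prime] {K : Type*} [Field K]

variable (ℓ) in
/-- The odd functions on the places above `ℓ`, with respect to an automorphism `τ` of `K`. -/
def oddFunctions (τ : K ≃+* K) : Submodule ℚ_[ℓ] (WildPlace ℓ K → ℚ_[ℓ]) where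
  carrier := {f | ∀ l, f (l.comap τ) = -f l}
  zero_mem' l := by simp
  add_mem' {f g} hf hg l := by
    rw [Pi.add_apply, Pi.add_apply, hf, hg]
    ring
  smul_mem' c f hf l := by rw [Pi.smul_apply, Pi.smul_apply, hf, smul_neg]

variable [NumberField K]

variable (ℓ) in
/-- The odd part, with respect to an automorphism `τ` of `K`, of the kernel of the divisor map:
the odd `ℓ`-units. -/
def oddUnits (τ : K ≃+* K) : Submodule ℤ_[ℓ] (AdicMul ℓ K) :=
  LinearMap.ker (div ℓ K) ⊓ LinearMap.ker (AdicMul.map ℓ (τ : K →+* K) + LinearMap.id)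

theorem mem_oddUnits_iff {τ : K ≃+* K} {x : AdicMul ℓ K} :
    x ∈ oddUnits ℓ τ ↔ div ℓ K x = 0 ∧ AdicMul.map ℓ (τ : K →+* K) x = -x := by
  rw [oddUnits, Submodule.mem_inf, LinearMap.mem_ker, LinearMap.mem_ker, LinearMap.add_apply,
    LinearMap.id_apply, ← eq_neg_iff_add_eq_zero]

/-- An equivariant family of valuations maps odd `ℓ`-units to odd functions. -/
def oddUnitsMap (τ : K ≃+* K) (F : WildPlace ℓ K → AdicMul ℓ K →ₗ[ℤ_[ℓ]] ℚ_[ℓ])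
    (hF : ∀ l x, F l (AdicMul.map ℓ (τ : K →+* K) x) = F (l.comap τ) x) :
    oddUnits ℓ τ →ₗ[ℤ_[ℓ]] oddFunctions ℓ τ where
  toFun x := ⟨fun l => F l x, fun l => by
    change F (l.comap τ) x = -F l x
    rw [← hF, (mem_oddUnits_iff.mp x.2).2, map_neg]⟩
  map_add' x y := Subtype.ext (funext fun l => map_add (F l) _ _)
  map_smul' c x := Subtype.ext (funext fun l => map_smul (F l) c _)

/-- The tame valuations and the norm valuations, taken together. -/
def allValuations : Additive Kˣ →+ (TamePlace ℓ K ⊕ WildPlace ℓ K →₀ ℤ) :=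
  AddMonoidHom.mk' (fun u => Finsupp.ofSupportFinite
      (Sum.elim (fun v => ord v.1 u.toMul)
        fun l => (localNorm (Quotient.out l) (u.toMul : Kˣ)).valuation) (by
      have h1 := (ord_support_finite K u.toMul).preimage
        (f := fun v : TamePlace ℓ K => v.1) Subtype.val_injective.injOn
      refine ((h1.image Sum.inl).union ((Set.finite_univ (α := WildPlace ℓ K)).image
        Sum.inr)).subset ?_
      rintro (v | l) h
      · exact Or.inl ⟨v, h, rfl⟩
      · exact Or.inr ⟨l, trivial, rfl⟩))
    fun x y => by
      ext i
      rcases i with v | l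
      · simp [Finsupp.ofSupportFinite, ord_mul]
        rfl
      · simp [Finsupp.ofSupportFinite, Padic.valuation_mul (localNorm_ne_zero _ x.toMul)
          (localNorm_ne_zero _ y.toMul)]
        rfl

/-- An element whose valuations at all finite places vanish, those above `ℓ` being seen through the
local norms, is a unit. -/
theorem isIntegral_of_allValuations_eq_zero {u : Kˣ}
    (hu : allValuations (ℓ := ℓ) (Additive.ofMul u) = 0) :
    IsIntegral ℤ (u : K) ∧ IsIntegral ℤ ((u⁻¹ : Kˣ) : K) := by
  have hord : ∀ v : HeightOneSpectrum (𝓞 K), ord v u = 0 := by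
    intro v
    by_cases hv : (ℓ : 𝓞 K) ∈ v.asIdeal
    · obtain ⟨p, hp, σ, hσ⟩ := exists_embeddingIdeal_eq v
      have hpl : p = ℓ := by
        by_contra hne
        have hcop := (Nat.coprime_primes hp.out (Fact.out : ℓ.Prime)).mpr hne
        have hpv : (p : 𝓞 K) ∈ v.asIdeal := by
          rw [← hσ, mem_embeddingIdeal]
          simpa using norm_natCast_lt_one p
        obtain ⟨a, b, hab⟩ := Nat.isCoprime_iff_coprime.mpr hcop
        have h1 : (1 : 𝓞 K) = (a : 𝓞 K) * p + (b : 𝓞 K) * ℓ := by exact_mod_cast hab.symm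
        refine v.isPrime.ne_top ((Ideal.eq_top_iff_one _).mpr ?_)
        rw [h1]
        exact add_mem (Ideal.mul_mem_left _ _ hpv) (Ideal.mul_mem_left _ _ hv)
      subst hpl
      rw [← norm_eq_one_iff hσ]
      have h1 : (localNorm (Quotient.out (placeOf p σ)) (u : K)).valuation = 0 :=
        DFunLike.congr_fun hu (Sum.inr (placeOf p σ))
      rw [localNorm_out_placeOf, valuation_eq_zero_iff (localNorm_ne_zero _ _),
        norm_localNorm] at h1
      exact (pow_eq_one_iff_of_nonneg (norm_nonneg _) Module.finrank_pos.ne').mp h1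
    · exact DFunLike.congr_fun hu (Sum.inl ⟨v, hv⟩)
  have hint : ∀ x : K, (∀ v : HeightOneSpectrum (𝓞 K), v.valuation K x ≤ 1) → IsIntegral ℤ x := by
    intro x hx
    obtain ⟨y, rfl⟩ := HeightOneSpectrum.mem_integers_of_valuation_le_one K x hx
    exact y.isIntegral_coe
  have hval := fun v => (ord_eq_zero_iff v u).mp (hord v)
  refine ⟨hint _ fun v => (hval v).le, hint _ fun v => ?_⟩
  rw [Units.val_inv_eq_inv_val, map_inv₀, hval v, inv_one]

/-- If `u / τ u` is a root of unity for all units `u`, then the norm valuations are injective up to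
torsion on odd `ℓ`-units. -/
theorem mem_torsion_of_normValuation_eq_zero (hℓ : ℓ ≠ 2) {τ : K ≃+* K}
    (hτu : ∀ u : Kˣ, IsIntegral ℤ (u : K) → IsIntegral ℤ ((u⁻¹ : Kˣ) : K) →
      ∃ n ≠ 0, (u / Units.map (τ : K →* K) u) ^ n = 1)
    {x : AdicMul ℓ K} (hx : x ∈ oddUnits ℓ τ) (hΨ : ∀ l, normValuation l x = 0) :
    x ∈ Submodule.torsion ℤ_[ℓ] (AdicMul ℓ K) := by
  obtain ⟨hdiv, hodd⟩ := mem_oddUnits_iff.mp hx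
  obtain ⟨y, hy⟩ := exists_of_forall_eq_zero (ℓ := ℓ) (allValuations (ℓ := ℓ) (K := K)) (x := x) (by
    rintro (v | l)
    · have h : LinearMap.liftBaseChange ℤ_[ℓ] ((Int.castAddHom ℤ_[ℓ]).comp
          ((Finsupp.applyAddHom (Sum.inl v)).comp
            (allValuations (ℓ := ℓ) (K := K)))).toIntLinearMap =
          (Finsupp.lapply v).comp (div ℓ K) := by
        refine AdicMul.linearMap_ext fun u => ?_
        rw [LinearMap.liftBaseChange_tmul, one_smul, LinearMap.comp_apply, Finsupp.lapply_apply,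
          div_one_tmul_apply]
        rfl
      rw [h, LinearMap.comp_apply, hdiv, map_zero]
    · have h : (Algebra.linearMap ℤ_[ℓ] ℚ_[ℓ]).comp
          (LinearMap.liftBaseChange ℤ_[ℓ] ((Int.castAddHom ℤ_[ℓ]).comp
          ((Finsupp.applyAddHom (Sum.inr l)).comp
            (allValuations (ℓ := ℓ) (K := K)))).toIntLinearMap) = normValuation l := by
        refine AdicMul.linearMap_ext fun u => ?_
        rw [LinearMap.comp_apply, LinearMap.liftBaseChange_tmul, one_smul, normValuation_one_tmul]
        exact map_intCast (algebraMap ℤ_[ℓ] ℚ_[ℓ]) _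
      have h2 := DFunLike.congr_fun h x
      rw [hΨ, LinearMap.comp_apply] at h2
      exact (map_eq_zero_iff _ (FaithfulSMul.algebraMap_injective ℤ_[ℓ] ℚ_[ℓ])).mp h2)
  have h2 : x - AdicMul.map ℓ (τ : K →+* K) x ∈ Submodule.torsion ℤ_[ℓ] (AdicMul ℓ K) := by
    rw [← hy]
    clear hy
    induction y using TensorProduct.induction_on with
    | zero => simp
    | tmul c a =>
      obtain ⟨h1, h2⟩ := isIntegral_of_allValuations_eq_zero (ℓ := ℓ) (u := a.1.toMul) a.2
      obtain ⟨n, hn, h⟩ := hτu _ h1 h2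
      have h3 := Submodule.smul_mem _ c (AdicMul.one_tmul_mem_torsion (ℓ := ℓ) hn h)
      rw [TensorProduct.smul_tmul', smul_eq_mul, mul_one, ofMul_div, TensorProduct.tmul_sub] at h3
      exact h3
    | add y z hy hz =>
      rw [map_add, map_add, add_sub_add_comm]
      exact add_mem hy hz
  rw [hodd, sub_neg_eq_add, ← two_smul ℤ_[ℓ]] at h2
  exact (smul_mem_torsion (isUnit_two hℓ).ne_zero).mp h2

theorem WildPlace.exists_logVal_ne_zero (l : WildPlace ℓ K) :
    ∃ r ∈ LinearMap.range l.logVal, r ≠ 0 := by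
  have h0 : (1 + (ℓ : ℚ_[ℓ]) ^ 2) ≠ 0 := by
    have : (1 + (ℓ : ℚ_[ℓ]) ^ 2) = ((1 + ℓ ^ 2 : ℕ) : ℚ_[ℓ]) := by push_cast; rfl
    rw [this]
    exact_mod_cast Nat.succ_ne_zero _ ∘ (Nat.add_comm 1 _).symm.trans
  let u : (l.completion)ˣ :=
    Units.map (algebraMap ℚ_[ℓ] l.completion : ℚ_[ℓ] →* l.completion) (Units.mk0 _ h0)
  refine ⟨_, ⟨1 ⊗ₜ Additive.ofMul u, rfl⟩, ?_⟩
  rw [WildPlace.logVal, LinearMap.liftBaseChange_tmul, one_smul]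
  change -iwasawaLog ℓ (Algebra.norm ℚ_[ℓ] (algebraMap ℚ_[ℓ] l.completion _)) ≠ 0
  have hd : (Module.finrank ℚ_[ℓ] l.completion : ℚ_[ℓ]) ≠ 0 := by
    exact_mod_cast Module.finrank_pos.ne'
  rw [Units.val_mk0, Algebra.norm_algebraMap, iwasawaLog_pow h0, neg_ne_zero]
  exact mul_ne_zero hd iwasawaLog_one_add_ne_zero

theorem WildPlace.eventually_mem_range_logVal (l : WildPlace ℓ K) (c : ℚ_[ℓ]) :
    ∀ᶠ n : ℕ in atTop, (ℓ : ℚ_[ℓ]) ^ n * c ∈ LinearMap.range l.logVal := by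
  obtain ⟨r, hr, hr0⟩ := l.exists_logVal_ne_zero
  have h : Tendsto (fun n : ℕ => ‖(ℓ : ℚ_[ℓ]) ^ n * c / r‖) atTop (𝓝 0) := by
    have := ((tendsto_pow_atTop_nhds_zero_of_norm_lt_one (Padic.norm_p_lt_one (p := ℓ))).mul_const
      (c / r)).norm
    simpa [mul_div_assoc] using this
  filter_upwards [h.eventually_le_const one_pos] with n hn
  let d : ℤ_[ℓ] := ⟨(ℓ : ℚ_[ℓ]) ^ n * c / r, hn⟩
  have h1 : (ℓ : ℚ_[ℓ]) ^ n * c = d • r := (div_mul_cancel₀ _ hr0).symm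
  rw [h1]
  exact Submodule.smul_mem _ d hr

/-- Under the Gross–Kuz'min conjecture, the logarithmic valuations of odd `ℓ`-units span the space
of odd functions on the places above `ℓ`. -/
theorem GrossKuzmin.exists_logValuation_eq (hGK : GrossKuzmin ℓ K) {τ : K ≃+* K}
    (hτ : ∀ x, τ (τ x) = x) {f : WildPlace ℓ K → ℚ_[ℓ]} (hf : f ∈ oddFunctions ℓ τ) :
    ∃ x ∈ oddUnits ℓ τ, ∃ c : ℚ_[ℓ], c ≠ 0 ∧ ∀ l, logValuation l x = c * f l := by
  obtain ⟨n, hn⟩ := (eventually_all.mpr fun l : WildPlace ℓ K =>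
    l.eventually_mem_range_logVal (f l)).exists
  have hinv : Function.Involutive (WildPlace.comap (ℓ := ℓ) τ) := by
    intro l
    rw [WildPlace.comap_comap]
    conv_rhs => rw [← placeOf_out l]
    congr 1
    ext x
    exact congrArg _ (hτ x)
  have hsum : ∑ l, f l = 0 := by
    have h1 : ∑ l, f l = -∑ l, f l := by
      rw [← Finset.sum_neg_distrib, ← Equiv.sum_comp hinv.toPerm f]
      exact Finset.sum_congr rfl fun l _ => hf l
    exact self_eq_neg.mp h1
  let b : LogDivisor ℓ K := (0, fun l => ⟨_, hn l⟩)
  have hb : b ∈ LinearMap.ker (LogDivisor.degree ℓ K) := by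
    have h1 : LogDivisor.degree ℓ K b = 0 + ∑ l, (ℓ : ℚ_[ℓ]) ^ n * f l := by
      rw [LogDivisor.degree, LinearMap.coprod_apply, map_zero, LinearMap.sum_apply]
      rfl
    rw [LinearMap.mem_ker, h1, ← Finset.mul_sum, hsum, mul_zero, add_zero]
  have : Finite (LogClassGroup ℓ K) := hGK
  have hm0 : Nat.card (LogClassGroup ℓ K) ≠ 0 := Nat.card_pos.ne'
  have hm : Nat.card (LogClassGroup ℓ K) •
      (Submodule.Quotient.mk ⟨b, hb⟩ : LogClassGroup ℓ K) = 0 := card_nsmul_eq_zero'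
  rw [← Submodule.Quotient.mk_smul, Submodule.Quotient.mk_eq_zero, Submodule.mem_comap] at hm
  obtain ⟨y, hy⟩ := hm
  have hdiv : div ℓ K y = 0 := by
    have h1 := congrArg Prod.fst hy
    rw [show div ℓ K y = (logDiv ℓ K y).1 from rfl, h1]
    exact smul_zero _
  have hlog : ∀ l, logValuation l y =
      (Nat.card (LogClassGroup ℓ K) : ℚ_[ℓ]) * ((ℓ : ℚ_[ℓ]) ^ n * f l) := by
    intro l
    have h1 := congrArg Subtype.val (congrFun (congrArg Prod.snd hy) l)
    rw [← nsmul_eq_mul]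
    exact h1
  refine ⟨y - AdicMul.map ℓ (τ : K →+* K) y, mem_oddUnits_iff.mpr ⟨?_, ?_⟩,
    2 * (Nat.card (LogClassGroup ℓ K) : ℚ_[ℓ]) * (ℓ : ℚ_[ℓ]) ^ n, ?_, fun l => ?_⟩
  · rw [map_sub, hdiv, div_map_eq_zero _ hdiv, sub_zero]
  · have h2 : (τ : K →+* K).comp (τ : K →+* K) = RingHom.id K := RingHom.ext hτ
    rw [map_sub, AdicMul.map_map, h2, AdicMul.map_id, neg_sub]
  · have hl : (ℓ : ℚ_[ℓ]) ≠ 0 := by exact_mod_cast (Fact.out : ℓ.Prime).ne_zero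
    exact mul_ne_zero (mul_ne_zero two_ne_zero (by exact_mod_cast hm0)) (pow_ne_zero n hl)
  · rw [map_sub, logValuation_map, hlog, hlog, hf l]
    ring

/-- Under the Gross–Kuz'min conjecture, an odd element with trivial logarithmic divisor is a root of
unity. Indeed the odd `ℓ`-units have, up to torsion, at most the rank of the odd functions on the
places above `ℓ`, and by the conjecture their logarithmic valuations have the same rank. -/
theorem GrossKuzmin.mem_torsion (hℓ : ℓ ≠ 2) (hGK : GrossKuzmin ℓ K) {τ : K ≃+* K}
    (hτ : ∀ x, τ (τ x) = x)
    (hτu : ∀ u : Kˣ, IsIntegral ℤ (u : K) → IsIntegral ℤ ((u⁻¹ : Kˣ) : K) →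
      ∃ n ≠ 0, (u / Units.map (τ : K →* K) u) ^ n = 1)
    {x : AdicMul ℓ K} (hx : logDiv ℓ K x = 0) (hodd : AdicMul.map ℓ (τ : K →+* K) x = -x) :
    x ∈ Submodule.torsion ℤ_[ℓ] (AdicMul ℓ K) := by
  obtain ⟨hdiv, hlog⟩ := logDiv_eq_zero_iff.mp hx
  let Φ := oddUnitsMap (ℓ := ℓ) τ logValuation (logValuation_map τ)
  let Ψ := oddUnitsMap (ℓ := ℓ) τ normValuation (normValuation_map τ)
  have hmem : ∀ {y : oddUnits ℓ τ}, y ∈ Submodule.torsion ℤ_[ℓ] (oddUnits ℓ τ) ↔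
      (y : AdicMul ℓ K) ∈ Submodule.torsion ℤ_[ℓ] (AdicMul ℓ K) := by
    intro y
    rw [mem_torsion_iff, mem_torsion_iff]
    refine exists_congr fun k => ?_
    rw [Subtype.ext_iff]
    rfl
  have key := ker_le_torsion_of_span_eq_top Φ Ψ ?_ ?_
  · have hx' : x ∈ oddUnits ℓ τ := mem_oddUnits_iff.mpr ⟨hdiv, hodd⟩
    exact hmem.mp (key (x := ⟨x, hx'⟩) (Subtype.ext (funext hlog)))
  · intro y hy
    refine hmem.mpr (mem_torsion_of_normValuation_eq_zero hℓ hτu y.2 fun l => ?_)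
    exact congrFun (congrArg Subtype.val (LinearMap.mem_ker.mp hy)) l
  · rw [eq_top_iff]
    rintro f -
    obtain ⟨y, hy, c, hc, h⟩ := hGK.exists_logValuation_eq hτ f.2
    have h1 : f = c⁻¹ • Φ ⟨y, hy⟩ := by
      refine Subtype.ext (funext fun l => ?_)
      change f.1 l = c⁻¹ * logValuation l y
      rw [h, inv_mul_cancel_left₀ hc]
    rw [h1]
    exact Submodule.smul_mem _ _ (Submodule.subset_span ⟨_, rfl⟩)

end MinusPart

/-! ### Weak approximation at the places above `ℓ` -/

section Density

variable {p : ℕ} [Fact p.Prime] {K : Type*} [Field K] [NumberField K]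

theorem localField_eq_adjoin (σ : K →+* PadicAlgCl p) {θ : K}
    (hθ : IntermediateField.adjoin ℚ {θ} = ⊤) :
    localField σ = IntermediateField.adjoin ℚ_[p] {σ θ} := by
  refine le_antisymm ?_ (IntermediateField.adjoin.mono _ _ _ (by rintro _ rfl; exact ⟨θ, rfl⟩))
  rw [localField, IntermediateField.adjoin_le_iff]
  rintro _ ⟨x, rfl⟩
  have hx : x ∈ IntermediateField.adjoin ℚ {θ} := hθ ▸ IntermediateField.mem_top
  induction hx using IntermediateField.adjoin_induction with
  | mem x h =>
    rw [Set.mem_singleton_iff.mp h]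
    exact IntermediateField.mem_adjoin_simple_self _ _
  | algebraMap q => rw [eq_ratCast, map_ratCast]; exact SubfieldClass.ratCast_mem _ _
  | add x y _ _ hx hy => rw [map_add]; exact add_mem hx hy
  | inv x _ hx => rw [map_inv₀]; exact inv_mem hx
  | mul x y _ _ hx hy => rw [map_mul]; exact mul_mem hx hy

theorem exists_aeval_eq (σ : K →+* PadicAlgCl p) {θ : K}
    (hθ : IntermediateField.adjoin ℚ {θ} = ⊤) (t : localField σ) :
    ∃ f : Polynomial ℚ_[p], Polynomial.aeval (toLocalField σ θ) f = t := by
  have ht : (t : PadicAlgCl p) ∈ (IntermediateField.adjoin ℚ_[p] {σ θ}).toSubalgebra := by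
    rw [← localField_eq_adjoin σ hθ]
    exact t.2
  rw [IntermediateField.adjoin_simple_toSubalgebra_of_isAlgebraic
    (Algebra.IsAlgebraic.isAlgebraic _), Algebra.adjoin_singleton_eq_range_aeval] at ht
  obtain ⟨f, hf⟩ := ht
  refine ⟨f, Subtype.ext ?_⟩
  rw [← hf]
  exact (Polynomial.aeval_algHom_apply (localField σ).val (toLocalField σ θ) f).symm

theorem aeval_minpoly_ne_zero {σ τ : K →+* PadicAlgCl p} {θ : K}
    (hθ : IntermediateField.adjoin ℚ {θ} = ⊤) (h : placeOf p σ ≠ placeOf p τ) :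
    Polynomial.aeval (toLocalField τ θ) (minpoly ℚ_[p] (σ θ)) ≠ 0 := by
  intro h0
  have h1 : Polynomial.aeval (τ θ) (minpoly ℚ_[p] (σ θ)) = 0 := by
    have h2 := congrArg (localField τ).val h0
    rw [map_zero, ← Polynomial.aeval_algHom_apply] at h2
    exact h2
  have hi : IsIntegral ℚ_[p] (σ θ) := Algebra.IsIntegral.isIntegral _
  have h2 : IsConjRoot ℚ_[p] (τ θ) (σ θ) :=
    (minpoly.eq_of_irreducible_of_monic (minpoly.irreducible hi) h1 (minpoly.monic hi)).symm
  have : Normal ℚ_[p] (PadicAlgCl p) := IsAlgClosure.normal ℚ_[p] _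
  obtain ⟨g, hg⟩ := isConjRoot_iff_exists_algEquiv.mp h2
  refine h (placeOf_eq_iff.mpr ⟨g, ?_⟩)
  ext x
  have hx : x ∈ IntermediateField.adjoin ℚ {θ} := hθ ▸ IntermediateField.mem_top
  induction hx using IntermediateField.adjoin_induction with
  | mem x h =>
    rw [Set.mem_singleton_iff.mp h]
    exact hg.symm
  | algebraMap q => rw [eq_ratCast, map_ratCast, map_ratCast]
  | add x y _ _ hx hy => rw [map_add, map_add, hx, hy]
  | inv x _ hx => rw [map_inv₀, map_inv₀, hx]
  | mul x y _ _ hx hy => rw [map_mul, map_mul, hx, hy]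

/-- A number field is dense in the product of its completions at finitely many distinct places above
`p`. -/
theorem denseRange_toLocalField {ι : Type*} [Finite ι] (σ : ι → (K →+* PadicAlgCl p))
    (hσ : Function.Injective fun i => placeOf p (σ i)) :
    DenseRange fun (x : K) (i : ι) => toLocalField (σ i) x := by
  classical
  have := Fintype.ofFinite ι
  obtain ⟨θ, hθ⟩ := Field.exists_primitive_element ℚ K
  let φ : K →+* ((i : ι) → localField (σ i)) := RingHom.pi fun i => toLocalField (σ i)
  let R : Subring ((i : ι) → localField (σ i)) := φ.range.topologicalClosure
  have hφ : ∀ x, φ x ∈ R := fun x => subset_closure ⟨x, rfl⟩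
  have hconst : ∀ c : ℚ_[p], (fun i => algebraMap ℚ_[p] (localField (σ i)) c) ∈ R := by
    intro c
    refine isClosed_property (Padic.denseRange_ratCast (p := p))
      (p := fun c => (fun i => algebraMap ℚ_[p] (localField (σ i)) c) ∈ R) ?_ (fun q => ?_) c
    · exact (Subring.isClosed_topologicalClosure _).preimage
        (continuous_pi fun i => continuous_algebraMap ℚ_[p] (localField (σ i)))
    · have : (fun i => algebraMap ℚ_[p] (localField (σ i)) q) = φ q := by
        funext i
        exact (map_ratCast _ q).trans (map_ratCast (toLocalField (σ i)) q).symm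
      rw [this]
      exact hφ q
  have hpoly : ∀ f : Polynomial ℚ_[p],
      (fun i => Polynomial.aeval (toLocalField (σ i) θ) f) ∈ R := by
    intro f
    induction f using Polynomial.induction_on' with
    | add f g hf hg =>
      have : (fun i => Polynomial.aeval (toLocalField (σ i) θ) (f + g)) =
          (fun i => Polynomial.aeval (toLocalField (σ i) θ) f) +
            (fun i => Polynomial.aeval (toLocalField (σ i) θ) g) := by
        funext i
        exact map_add _ _ _
      rw [this]
      exact add_mem hf hg
    | monomial n c =>
      have : (fun i => Polynomial.aeval (toLocalField (σ i) θ) (Polynomial.monomial n c)) =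
          (fun i => algebraMap ℚ_[p] (localField (σ i)) c) * φ θ ^ n := by
        funext i
        exact Polynomial.aeval_monomial _
      rw [this]
      exact mul_mem (hconst c) (pow_mem (hφ θ) n)
  have htop : ∀ t, t ∈ R := by
    intro t
    let m : ι → Polynomial ℚ_[p] := fun i => minpoly ℚ_[p] (σ i θ)
    have hm0 : ∀ i, Polynomial.aeval (toLocalField (σ i) θ) (m i) = 0 := by
      intro i
      refine Subtype.ext ?_
      refine (Polynomial.aeval_algHom_apply (localField (σ i)).val _ _).symm.trans ?_
      exact minpoly.aeval _ _
    choose f hf using fun i => exists_aeval_eq (σ i) hθ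
      (t i / Polynomial.aeval (toLocalField (σ i) θ) (∏ j ∈ Finset.univ.erase i, m j))
    have ht : t = fun i => Polynomial.aeval (toLocalField (σ i) θ)
        (∑ k, f k * ∏ j ∈ Finset.univ.erase k, m j) := by
      funext i
      rw [map_sum, Finset.sum_eq_single i, map_mul, hf, div_mul_cancel₀]
      · rw [map_prod, Finset.prod_ne_zero_iff]
        intro j hj
        exact aeval_minpoly_ne_zero hθ fun h => Finset.ne_of_mem_erase hj (hσ h)
      · intro k _ hk
        rw [map_mul, map_prod, Finset.prod_eq_zero (i := i) (by simpa using hk.symm) (hm0 i),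
          mul_zero]
      · simp
    rw [ht]
    exact hpoly _
  exact fun t => htop t

/-- The absolute values of a completion are those of the number field. -/
theorem exists_norm_apply_eq (σ : K →+* PadicAlgCl p) {y : PadicAlgCl p} (hy : y ∈ localField σ)
    (hy0 : y ≠ 0) : ∃ u : Kˣ, ‖σ u‖ = ‖y‖ := by
  have hd := denseRange_toLocalField (fun _ : Unit => σ) (fun _ _ _ => rfl)
  obtain ⟨x, hx⟩ := hd.exists_mem_open
    (s := {t | ‖(t () : PadicAlgCl p) - y‖ < ‖y‖})
    (isOpen_lt (by fun_prop) continuous_const) ⟨fun _ => ⟨y, hy⟩, by simpa using hy0⟩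
  have hx' : ‖σ x - y‖ < ‖y‖ := hx
  have h : ‖σ x‖ = ‖y‖ := by
    have := IsUltrametricDist.norm_add_eq_max_of_norm_ne_norm hx'.ne
    rwa [sub_add_cancel, max_eq_right hx'.le] at this
  have hx0 : x ≠ 0 := by
    rintro rfl
    rw [map_zero, norm_zero] at h
    exact hy0 (norm_eq_zero.mp h.symm)
  exact ⟨Units.mk0 x hx0, h⟩

end Density

section WeakApproximation

variable {ℓ : ℕ} [Fact ℓ.Prime] {K : Type*} [Field K] [NumberField K]

instance {p : ℕ} [Fact p.Prime] (σ : K →+* PadicAlgCl p) : ProperSpace (localField σ) :=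
  FiniteDimensional.proper ℚ_[p] _

/-- The cosets of the group of `n`-th powers of nonzero elements of a completion are open: this is
the inverse function theorem for `z ↦ z ^ n`. -/
theorem isOpen_mul_pow {p : ℕ} [Fact p.Prime] (σ : K →+* PadicAlgCl p) {n : ℕ} (hn : n ≠ 0)
    {c : localField σ} (hc : c ≠ 0) :
    IsOpen {y : localField σ | ∃ z : localField σ, z ≠ 0 ∧ y = c * z ^ n} := by
  rw [isOpen_iff_mem_nhds]
  rintro _ ⟨z, hz, rfl⟩
  have h1 : HasStrictDerivAt (fun z : localField σ => c * z ^ n) (c * (n * z ^ (n - 1))) z :=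
    (hasStrictDerivAt_pow n z).const_mul c
  have h2 : c * (n * z ^ (n - 1)) ≠ 0 :=
    mul_ne_zero hc (mul_ne_zero (by exact_mod_cast hn) (pow_ne_zero _ hz))
  rw [← h1.map_nhds_eq h2, Filter.mem_map]
  filter_upwards [isOpen_ne.mem_nhds hz] with w hw
  exact ⟨w, hw, rfl⟩

instance : Nonempty (WildPlace ℓ K) :=
  ⟨placeOf ℓ (IsAlgClosed.lift (R := ℚ) (S := K) (M := PadicAlgCl ℓ)).toRingHom⟩

/-- Up to `ℓ`-th powers, every element of `∏ K_λˣ` comes from `Kˣ`, since `K` is dense and the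
`ℓ`-th powers are open. -/
theorem exists_eq_mul_pow (y : ∀ l : WildPlace ℓ K, (l.completion)ˣ) :
    ∃ (k : Kˣ) (z : ∀ l : WildPlace ℓ K, (l.completion)ˣ),
      ∀ l, y l = Units.map (toLocalField (Quotient.out l) : K →* l.completion) k * z l ^ ℓ := by
  have hℓ : ℓ ≠ 0 := (Fact.out : ℓ.Prime).ne_zero
  have hd := denseRange_toLocalField (fun l : WildPlace ℓ K => Quotient.out l)
    (fun l l' h => by simpa only [placeOf_out] using h)
  obtain ⟨x, hx⟩ := hd.exists_mem_open
    (isOpen_set_pi Set.finite_univ fun l _ => isOpen_mul_pow (Quotient.out l) hℓ (y l).ne_zero)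
    ⟨fun l => y l, fun l _ => ⟨1, one_ne_zero, by simp⟩⟩
  choose z hz0 hz using fun l => hx l (Set.mem_univ l)
  have hx0 : x ≠ 0 := by
    rintro rfl
    obtain ⟨l⟩ := (inferInstance : Nonempty (WildPlace ℓ K))
    have h : toLocalField (Quotient.out l) 0 = _ := hz l
    rw [map_zero] at h
    exact mul_ne_zero (y l).ne_zero (pow_ne_zero _ (hz0 l)) h.symm
  refine ⟨Units.mk0 x hx0, fun l => (Units.mk0 (z l) (hz0 l))⁻¹, fun l => ?_⟩
  rw [inv_pow, eq_mul_inv_iff_mul_eq]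
  exact Units.ext (hz l).symm

/-- Finiteness of `K_λˣ / K_λˣ ^ ℓ`: finitely many elements of `K` represent all the classes of
`∏ K_λˣ` modulo `ℓ`-th powers, which are open and meet a compact set. -/
theorem exists_finset_eq_mul_pow : ∃ S : Finset Kˣ, ∀ y : ∀ l : WildPlace ℓ K, (l.completion)ˣ,
    ∃ k ∈ S, ∃ z : ∀ l : WildPlace ℓ K, (l.completion)ˣ,
      ∀ l, y l = Units.map (toLocalField (Quotient.out l) : K →* l.completion) k * z l ^ ℓ := by
  have hℓ : ℓ ≠ 0 := (Fact.out : ℓ.Prime).ne_zero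
  let C : Set (∀ l : WildPlace ℓ K, l.completion) :=
    Set.univ.pi fun l => {w | ‖(ℓ : l.completion)‖ ^ ℓ ≤ ‖w‖ ∧ ‖w‖ ≤ 1}
  have hl0 : ∀ l : WildPlace ℓ K, 0 < ‖(ℓ : l.completion)‖ := fun l =>
    norm_pos_iff.mpr (by exact_mod_cast hℓ)
  have hl1 : ∀ l : WildPlace ℓ K, ‖(ℓ : l.completion)‖ < 1 := fun l => norm_natCast_lt_one ℓ
  have hC : IsCompact C := isCompact_univ_pi fun l => Metric.isCompact_of_isClosed_isBounded
    ((isClosed_le continuous_const continuous_norm).inter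
      (isClosed_le continuous_norm continuous_const))
    ((Metric.isBounded_closedBall (x := 0) (r := 1)).subset fun w hw => by simpa using hw.2)
  let U : Kˣ → Set (∀ l : WildPlace ℓ K, l.completion) := fun k =>
    Set.univ.pi fun l => {y | ∃ z, z ≠ 0 ∧ y = toLocalField (Quotient.out l) (k : K) * z ^ ℓ}
  obtain ⟨S, hS⟩ := hC.elim_finite_subcover U
    (fun k => isOpen_set_pi Set.finite_univ fun l _ => isOpen_mul_pow _ hℓ (by simp))
    (fun w hw => by
      have h0 : ∀ l, w l ≠ 0 := fun l => by
        have h1 := (pow_pos (hl0 l) ℓ).trans_le (hw l (Set.mem_univ l)).1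
        exact norm_pos_iff.mp h1
      obtain ⟨k, z, h⟩ := exists_eq_mul_pow fun l => Units.mk0 (w l) (h0 l)
      exact Set.mem_iUnion.mpr ⟨k, fun l _ => ⟨z l, (z l).ne_zero, congrArg Units.val (h l)⟩⟩)
  refine ⟨S, fun y => ?_⟩
  -- multiplying by powers of `ℓ ^ ℓ` moves `y` into the compact set `C`
  have hj : ∀ l, ∃ j : ℤ, ‖(ℓ : l.completion)‖ ^ ℓ ≤
      ‖(y l : l.completion) * ((ℓ : l.completion) ^ j) ^ ℓ‖ ∧
      ‖(y l : l.completion) * ((ℓ : l.completion) ^ j) ^ ℓ‖ ≤ 1 := by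
    intro l
    have hc := pow_pos (hl0 l) ℓ
    obtain ⟨j, hj1, hj2⟩ := exists_mem_Ioc_zpow (norm_pos_iff.mpr (y l).ne_zero)
      ((one_lt_inv₀ hc).mpr (pow_lt_one₀ (hl0 l).le (hl1 l) hℓ))
    have e : ‖(y l : l.completion) * ((ℓ : l.completion) ^ (j + 1)) ^ ℓ‖ =
        ‖(y l : l.completion)‖ * (‖(ℓ : l.completion)‖ ^ ℓ) ^ (j + 1) := by
      rw [norm_mul, norm_pow, norm_zpow, ← zpow_natCast, ← zpow_natCast, ← zpow_mul, ← zpow_mul,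
        mul_comm (j + 1)]
    refine ⟨j + 1, ?_, ?_⟩ <;> rw [e]
    · rw [inv_zpow'] at hj1
      calc ‖(ℓ : l.completion)‖ ^ ℓ
          = (‖(ℓ : l.completion)‖ ^ ℓ) ^ (-j) * (‖(ℓ : l.completion)‖ ^ ℓ) ^ (j + 1) := by
            rw [← zpow_add₀ hc.ne', neg_add_cancel_left, zpow_one]
        _ ≤ _ := mul_le_mul_of_nonneg_right hj1.le (zpow_nonneg hc.le _)
    · rw [inv_zpow'] at hj2
      calc _ ≤ (‖(ℓ : l.completion)‖ ^ ℓ) ^ (-(j + 1)) * (‖(ℓ : l.completion)‖ ^ ℓ) ^ (j + 1) :=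
            mul_le_mul_of_nonneg_right hj2 (zpow_nonneg hc.le _)
        _ = 1 := by rw [← zpow_add₀ hc.ne', neg_add_cancel, zpow_zero]
  choose j hj using hj
  obtain ⟨k, hk, hz⟩ := Set.mem_iUnion₂.mp (hS (fun l _ => hj l))
  choose z hz0 hz using fun l => hz l (Set.mem_univ l)
  have hp0 : ∀ l : WildPlace ℓ K, (ℓ : l.completion) ≠ 0 := fun l => norm_pos_iff.mp (hl0 l)
  refine ⟨k, hk, fun l => Units.mk0 (z l / (ℓ : l.completion) ^ j l)
    (div_ne_zero (hz0 l) (zpow_ne_zero _ (hp0 l))), fun l => Units.ext ?_⟩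
  have h : (y l : l.completion) * ((ℓ : l.completion) ^ j l) ^ ℓ =
    toLocalField (Quotient.out l) (k : K) * z l ^ ℓ := hz l
  change (y l : l.completion) = toLocalField (Quotient.out l) (k : K) *
    (z l / (ℓ : l.completion) ^ j l) ^ ℓ
  rw [div_pow, mul_div_assoc', eq_div_iff (pow_ne_zero _ (zpow_ne_zero _ (hp0 l))), h]

/-- An `ℓ`-adic integer with prescribed digits. -/
theorem exists_padicInt_digits (b : ℕ → ℤ_[ℓ]) :
    ∃ c : ℤ_[ℓ], ∀ N, ∃ d, c = ∑ n ∈ Finset.range N, b n * (ℓ : ℤ_[ℓ]) ^ n + ℓ ^ N * d := by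
  have hp : ℓ.Prime := Fact.out
  have hs : ∀ N, Summable fun n => b (n + N) * (ℓ : ℤ_[ℓ]) ^ n := fun N => by
    refine Summable.of_norm_bounded
      (summable_geometric_of_lt_one (norm_nonneg (ℓ : ℤ_[ℓ]))
        (by rw [PadicInt.norm_p]; exact inv_lt_one_of_one_lt₀ (by exact_mod_cast hp.one_lt)))
      fun n => ?_
    rw [norm_mul, norm_pow]
    exact mul_le_of_le_one_left (by positivity) (PadicInt.norm_le_one _)
  refine ⟨∑' n, b n * (ℓ : ℤ_[ℓ]) ^ n, fun N => ⟨∑' n, b (n + N) * (ℓ : ℤ_[ℓ]) ^ n, ?_⟩⟩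
  have h0 : Summable fun n => b n * (ℓ : ℤ_[ℓ]) ^ n := hs 0
  rw [← h0.sum_add_tsum_nat_add N, ← (hs N).tsum_mul_left]
  congr 1
  refine tsum_congr fun n => ?_
  rw [pow_add]
  ring

/-- Weak approximation: the map `ℛ_K → ∏ ℛ_{K_λ}` reaches every family of elements of the `K_λˣ`.
Writing `y = g₀ z₁ ^ ℓ`, `z₁ = g₁ z₂ ^ ℓ`, …, with all `gₙ` in a finite subset of `Kˣ`, the
preimage of `y` is `∑ ℓ ^ n ⊗ gₙ`, a finite sum once the terms with the same `gₙ` are collected.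
-/
theorem exists_map_sub_mem_divisiblePart (y : ∀ l : WildPlace ℓ K, (l.completion)ˣ) :
    ∃ Y : AdicMul ℓ K, ∀ l : WildPlace ℓ K,
      AdicMul.map ℓ (toLocalField (Quotient.out l)) Y - 1 ⊗ₜ Additive.ofMul (y l) ∈
        divisiblePart ℓ (AdicMul ℓ l.completion) := by
  classical
  obtain ⟨S, hS⟩ := exists_finset_eq_mul_pow (ℓ := ℓ) (K := K)
  choose g hg z hz using hS
  let w : ℕ → ∀ l : WildPlace ℓ K, (l.completion)ˣ := fun n => z^[n] y
  have hw : ∀ n l, w n l = Units.map (toLocalField (Quotient.out l) : K →* l.completion) (g (w n)) *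
      w (n + 1) l ^ ℓ := by
    intro n l
    change _ = _ * (z^[n + 1] y) l ^ ℓ
    rw [Function.iterate_succ_apply']
    exact hz (w n) l
  choose c d hc using fun k : Kˣ =>
    exists_padicInt_digits (ℓ := ℓ) fun n => if g (w n) = k then 1 else 0
  refine ⟨∑ k ∈ S, c k ⊗ₜ Additive.ofMul k, fun l => mem_divisiblePart_iff.mpr fun N => ?_⟩
  have hY : (∑ k ∈ S, c k ⊗ₜ Additive.ofMul k : AdicMul ℓ K) =
      ∑ n ∈ Finset.range N, ((ℓ : ℤ_[ℓ]) ^ n) ⊗ₜ Additive.ofMul (g (w n)) +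
        (ℓ : ℤ_[ℓ]) ^ N • ∑ k ∈ S, d k N ⊗ₜ Additive.ofMul k := by
    have h1 : ∀ k ∈ S, (c k ⊗ₜ Additive.ofMul k : AdicMul ℓ K) =
        ∑ n ∈ Finset.range N, (if g (w n) = k then
          ((ℓ : ℤ_[ℓ]) ^ n) ⊗ₜ Additive.ofMul (g (w n)) else 0) +
        (ℓ : ℤ_[ℓ]) ^ N • (d k N ⊗ₜ Additive.ofMul k) := by
      intro k _
      rw [hc k N, TensorProduct.add_tmul, TensorProduct.sum_tmul, TensorProduct.smul_tmul',
        smul_eq_mul]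
      congr 1
      refine Finset.sum_congr rfl fun n _ => ?_
      split_ifs with h
      · rw [one_mul, h]
      · rw [zero_mul, TensorProduct.zero_tmul]
    rw [Finset.sum_congr rfl h1, Finset.sum_add_distrib, Finset.sum_comm, Finset.smul_sum]
    congr 1
    refine Finset.sum_congr rfl fun n _ => ?_
    rw [Finset.sum_ite_eq, if_pos (hg _)]
  have hy : ∀ N, (1 ⊗ₜ Additive.ofMul (y l) : AdicMul ℓ l.completion) =
      ∑ n ∈ Finset.range N, ((ℓ : ℤ_[ℓ]) ^ n) ⊗ₜ Additive.ofMul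
        (Units.map (toLocalField (Quotient.out l) : K →* l.completion) (g (w n))) +
        (ℓ : ℤ_[ℓ]) ^ N • (1 ⊗ₜ Additive.ofMul (w N l)) := by
    intro N
    induction N with
    | zero => simp [w]
    | succ N ih =>
      rw [ih, Finset.sum_range_succ, add_assoc]
      congr 1
      conv_lhs => rw [hw N l]
      rw [ofMul_mul, ofMul_pow, TensorProduct.tmul_add, smul_add, TensorProduct.tmul_smul,
        TensorProduct.smul_tmul', smul_eq_mul, mul_one, pow_succ, mul_smul, Nat.cast_smul_eq_nsmul]
  refine ⟨AdicMul.map ℓ (toLocalField (Quotient.out l)) (∑ k ∈ S, d k N ⊗ₜ Additive.ofMul k) -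
    1 ⊗ₜ Additive.ofMul (w N l), ?_⟩
  rw [hY, map_add, map_sum, map_smul, hy N, smul_sub]
  simp only [AdicMul.map_tmul, toMul_ofMul]
  abel

end WeakApproximation

/-! ### Kummer generators of cyclotomic extensions -/

section Kummer

variable {F Ω : Type*} [Field F] [Field Ω] [Algebra F Ω]
  [Algebra.IsIntegral F Ω] {ℓ : ℕ} [Fact ℓ.Prime]

/-- An element `X` of `F(η)`, with `η` a root of unity of order `ℓ ^ n`, whose `ℓ`-th power is in `F`,
is the product of a power of `η` and an element of `F`. Indeed `F(η)/F` is cyclic, with a generator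
`g` say. If `ε ∉ F` is a power of `η` with `ε ^ ℓ ∈ F`, then `g ε / ε` is a primitive `ℓ`-th root of
unity, so that `g X / X = (g ε / ε) ^ b` for some `b`, and `X / ε ^ b` is fixed by `g`. -/
theorem exists_eq_pow_mul_of_mem_adjoin (hℓ : ℓ ≠ 2) {n : ℕ} {η : Ω}
    (hη : IsPrimitiveRoot η (ℓ ^ n)) {X : Ω} (hX : X ∈ IntermediateField.adjoin F {η})
    {a : F} (ha : X ^ ℓ = algebraMap F Ω a) :
    ∃ (j : ℕ) (y : F), X = η ^ j * algebraMap F Ω y := by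
  classical
  have hp : ℓ.Prime := Fact.out
  have : NeZero (ℓ ^ n) := ⟨pow_ne_zero n hp.ne_zero⟩
  let N := IntermediateField.adjoin F {η}
  have hcyc : IsCyclotomicExtension {ℓ ^ n} F N :=
    hη.intermediateField_adjoin_isCyclotomicExtension F
  have hgal : IsGalois F N := IsCyclotomicExtension.isGalois {ℓ ^ n} F N
  have hfin : FiniteDimensional F N := IsCyclotomicExtension.finiteDimensional {ℓ ^ n} F N
  let e : N := ⟨η, IntermediateField.mem_adjoin_simple_self F η⟩
  have he : IsPrimitiveRoot e (ℓ ^ n) :=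
    IsPrimitiveRoot.of_map_of_injective (f := algebraMap N Ω) hη (algebraMap N Ω).injective
  have hU : IsCyclic (ZMod (ℓ ^ n))ˣ := ZMod.isCyclic_units_of_prime_pow ℓ hp hℓ n
  have hG : IsCyclic (N ≃ₐ[F] N) := isCyclic_of_injective _ (he.autToPow_injective F)
  obtain ⟨g, hg⟩ := hG.exists_generator
  -- an element fixed by the generator is in `F`
  have hfix : ∀ t : N, g t = t → ∃ y : F, t = algebraMap F N y := by
    intro t ht
    have h1 : ∀ h : N ≃ₐ[F] N, h t = t := by
      intro h
      have h2 : Subgroup.zpowers g ≤ MulAction.stabilizer (N ≃ₐ[F] N) t := by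
        rw [Subgroup.zpowers_le]
        exact ht
      exact h2 (hg h)
    obtain ⟨y, hy⟩ := (IsGalois.mem_range_algebraMap_iff_fixed t).mpr h1
    exact ⟨y, hy.symm⟩
  let x : N := ⟨X, hX⟩
  have hx : x ^ ℓ = algebraMap F N a := Subtype.ext ha
  suffices h : ∃ (j : ℕ) (y : F), x = e ^ j * algebraMap F N y by
    obtain ⟨j, y, h⟩ := h
    exact ⟨j, y, congrArg Subtype.val h⟩
  by_cases hx0 : x = 0
  · exact ⟨0, 0, by rw [hx0, map_zero, mul_zero]⟩
  have hex : ∃ k, e ^ ℓ ^ k ∈ (algebraMap F N).range :=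
    ⟨n, by rw [he.pow_eq_one]; exact one_mem _⟩
  by_cases hk : Nat.find hex = 0
  · obtain ⟨c, hc⟩ := Nat.find_spec hex
    rw [hk, pow_zero, pow_one] at hc
    have h1 : ∀ h : N ≃ₐ[F] N, h = 1 := by
      intro h
      refine he.autToPow_injective F (Units.ext ?_)
      refine (he.isUnit (NeZero.ne _)).elim fun u hu => ?_
      have h2 := he.autToPow_spec F h
      have h3 := he.autToPow_spec F 1
      have h4 : h e = (1 : N ≃ₐ[F] N) e := by rw [← hc, AlgEquiv.commutes, AlgEquiv.commutes]
      rw [h4, ← h3] at h2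
      exact ZMod.val_injective _ (he.pow_inj (ZMod.val_lt _) (ZMod.val_lt _) h2)
    obtain ⟨y, hy⟩ := hfix x (by rw [h1 g]; rfl)
    exact ⟨0, y, by rw [hy, pow_zero, one_mul]⟩
  · obtain ⟨k, hk⟩ := Nat.exists_eq_succ_of_ne_zero hk
    -- `ε` is a root of unity of minimal order that is not in `F`
    let ε := e ^ ℓ ^ k
    have hε0 : ε ≠ 0 := pow_ne_zero _ (he.ne_zero (NeZero.ne _))
    have hε : ε ∉ (algebraMap F N).range := Nat.find_min hex (by omega)
    obtain ⟨c, hc⟩ : ε ^ ℓ ∈ (algebraMap F N).range := by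
      have h1 := Nat.find_spec hex
      rw [hk] at h1
      rw [← pow_mul, ← pow_succ]
      exact h1
    have hroot : ∀ {t : N} {b : F}, t ≠ 0 → t ^ ℓ = algebraMap F N b → (g t / t) ^ ℓ = 1 := by
      intro t b ht hb
      rw [div_pow, ← map_pow, hb, AlgEquiv.commutes, ← hb, div_self (pow_ne_zero _ ht)]
    have hprim : IsPrimitiveRoot (g ε / ε) ℓ := by
      refine IsPrimitiveRoot.iff_orderOf.mpr (orderOf_eq_prime (hroot hε0 hc.symm) fun h1 => ?_)
      obtain ⟨y, hy⟩ := hfix ε (by rwa [div_eq_one_iff_eq hε0] at h1)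
      exact hε ⟨y, hy.symm⟩
    obtain ⟨b, -, hb⟩ := hprim.eq_pow_of_pow_eq_one (hroot hx0 hx)
    obtain ⟨y, hy⟩ := hfix (x / ε ^ b) (by
      rw [map_div₀, map_pow]
      rw [div_pow, div_eq_div_iff (pow_ne_zero _ hε0) hx0] at hb
      rw [div_eq_div_iff (pow_ne_zero _ (by simpa using hε0)) (pow_ne_zero _ hε0)]
      rw [← hb, mul_comm])
    refine ⟨ℓ ^ k * b, y, ?_⟩
    rw [← hy, pow_mul, mul_div_cancel₀ _ (pow_ne_zero _ hε0)]

theorem exists_eq_mul_of_mem_sup_cyclotomicZl (hℓ : ℓ ≠ 2) {E Ω : Type*} [Field E] [Field Ω]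
    [CharZero Ω] [IsAlgClosed Ω] [Algebra E Ω] [Algebra.IsAlgebraic E Ω] {F : IntermediateField E Ω}
    {X : Ω}
    (hX : X ∈ F ⊔ cyclotomicZl ℓ E Ω) (hXℓ : X ^ ℓ ∈ F) :
    ∃ (η : Ω) (n : ℕ) (y : F), η ^ ℓ ^ n = 1 ∧ X = η * y := by
  classical
  have hp : ℓ.Prime := Fact.out
  let μ : Set Ω := {ζ | ∃ n : ℕ, ζ ^ ℓ ^ n = 1}
  let M := IntermediateField.adjoin F μ
  have hle : F ⊔ cyclotomicZl ℓ E Ω ≤ M.restrictScalars E := by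
    refine sup_le (fun t ht => M.algebraMap_mem ⟨t, ht⟩) ?_
    rw [cyclotomicZl, IntermediateField.adjoin_le_iff]
    rintro t ⟨ht, -⟩
    change t ∈ M
    induction ht using IntermediateField.adjoin_induction with
    | mem t h => exact IntermediateField.subset_adjoin _ _ h
    | algebraMap q => rw [eq_ratCast]; exact SubfieldClass.ratCast_mem _ _
    | add x y _ _ hx hy => exact add_mem hx hy
    | inv x _ hx => exact inv_mem hx
    | mul x y _ _ hx hy => exact mul_mem hx hy
  have hXM : X ∈ M := hle hX
  obtain ⟨T, hT, hXT⟩ : ∃ T : Finset Ω, (T : Set Ω) ⊆ μ ∧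
      X ∈ IntermediateField.adjoin F (T : Set Ω) :=
    IntermediateField.exists_finset_of_mem_adjoin hXM
  have hT' : ∀ t : Ω, ∃ n : ℕ, t ∈ T → t ^ ℓ ^ n = 1 := fun t => by
    by_cases h : t ∈ T
    · obtain ⟨n, hn⟩ := hT h
      exact ⟨n, fun _ => hn⟩
    · exact ⟨0, fun h' => absurd h' h⟩
  choose f hf using hT'
  have : NeZero (ℓ ^ T.sup f) := ⟨pow_ne_zero _ hp.ne_zero⟩
  obtain ⟨η, hη⟩ := HasEnoughRootsOfUnity.exists_primitiveRoot Ω (ℓ ^ T.sup f)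
  have hXη : X ∈ IntermediateField.adjoin F {η} := by
    refine (IntermediateField.adjoin_le_iff.mpr fun t ht => ?_ :
      IntermediateField.adjoin F (T : Set Ω) ≤ _) hXT
    obtain ⟨i, -, hi⟩ := hη.eq_pow_of_pow_eq_one (ξ := t) (by
      obtain ⟨c, hc⟩ := pow_dvd_pow ℓ (Finset.le_sup (f := f) ht)
      rw [hc, pow_mul, hf t ht, one_pow])
    rw [← hi]
    exact pow_mem (IntermediateField.mem_adjoin_simple_self _ _) i
  have : Algebra.IsIntegral F Ω := Algebra.IsIntegral.tower_top E
  obtain ⟨j, y, h⟩ := exists_eq_pow_mul_of_mem_adjoin hℓ hη hXη (a := ⟨X ^ ℓ, hXℓ⟩) rfl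
  exact ⟨η ^ j, T.sup f, y, by rw [← pow_mul, mul_comm, pow_mul, hη.pow_eq_one, one_pow], h⟩

end Kummer

section LocallyCyclotomic

variable {ℓ : ℕ} [Fact ℓ.Prime] {K L : Type*} [Field K] [NumberField K] [Field L] [NumberField L]
  [Algebra K L] {p : ℕ} [Fact p.Prime]

theorem exists_comp_algebraMap_eq (s : K →+* PadicAlgCl p) :
    ∃ σ : L →+* PadicAlgCl p, σ.comp (algebraMap K L) = s := by
  let : Algebra K (PadicAlgCl p) := s.toAlgebra
  have : Algebra.IsAlgebraic K L := Algebra.IsAlgebraic.of_finite K L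
  exact ⟨(IsAlgClosed.lift (R := K) (S := L) (M := PadicAlgCl p)).toRingHom,
    AlgHom.comp_algebraMap _⟩

/-- If `x` is a Kummer generator of a locally cyclotomic extension, then `α = x ^ ℓ` is locally the
`ℓ`-th power of the product of a root of unity of `ℓ`-power order and an element of the
completion of the base field. -/
theorem IsLocallyCyclotomic.exists_eq_mul (hloc : IsLocallyCyclotomic ℓ K L) (hℓ : ℓ ≠ 2)
    {x : Lˣ} {α : Kˣ} (hx : x ^ ℓ = Units.map (algebraMap K L : K →* L) α)
    (s : K →+* PadicAlgCl p) :
    ∃ (η : PadicAlgCl p) (n : ℕ) (y : (localField s)ˣ), η ^ ℓ ^ n = 1 ∧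
      s α = η ^ ℓ * (y : localField s) ^ ℓ := by
  have hp : ℓ.Prime := Fact.out
  obtain ⟨σ, rfl⟩ := exists_comp_algebraMap_eq (L := L) s
  have hX : σ x ∈ localField (σ.comp (algebraMap K L)) ⊔ cyclotomicZl ℓ ℚ_[p] (PadicAlgCl p) :=
    hloc p σ (IntermediateField.subset_adjoin _ _ ⟨x, rfl⟩)
  have hXℓ : (σ x) ^ ℓ = σ.comp (algebraMap K L) α := by
    rw [← map_pow]
    exact congrArg σ (congrArg Units.val hx)
  obtain ⟨η, n, y, hη, h⟩ := exists_eq_mul_of_mem_sup_cyclotomicZl hℓ hX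
    (hXℓ ▸ IntermediateField.subset_adjoin _ _ ⟨_, rfl⟩)
  have hy : y ≠ 0 := by
    rintro rfl
    rw [ZeroMemClass.coe_zero, mul_zero] at h
    simp at h
  exact ⟨η, n, Units.mk0 y hy, hη, by rw [← hXℓ, h, mul_pow]; rfl⟩

theorem ord_pow (v : HeightOneSpectrum (𝓞 K)) (x : Kˣ) (n : ℕ) : ord v (x ^ n) = n * ord v x := by
  simp [ord]

/-- The `ℓ`-th power of a Kummer generator of a locally cyclotomic extension has a divisor divisible
by `ℓ` in the divisors of the base field. -/
theorem IsLocallyCyclotomic.dvd_ord (hloc : IsLocallyCyclotomic ℓ K L) (hℓ : ℓ ≠ 2)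
    {x : Lˣ} {α : Kˣ} (hx : x ^ ℓ = Units.map (algebraMap K L : K →* L) α)
    (v : HeightOneSpectrum (𝓞 K)) : (ℓ : ℤ) ∣ ord v α := by
  have hp : ℓ.Prime := Fact.out
  obtain ⟨p, _, s, hs⟩ := exists_embeddingIdeal_eq v
  obtain ⟨η, n, y, hη, h⟩ := hloc.exists_eq_mul hℓ hx s
  have hη1 : ‖η‖ = 1 := by
    refine (pow_eq_one_iff_of_nonneg (norm_nonneg _) (pow_ne_zero n hp.ne_zero)).mp ?_
    rw [← norm_pow, hη, norm_one]
  obtain ⟨u, hu⟩ := exists_norm_apply_eq s (y : localField s).2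
    (fun h => y.ne_zero (Subtype.ext h))
  have h0 : ‖s ((α / u ^ ℓ : Kˣ) : K)‖ = 1 := by
    rw [Units.val_div_eq_div_val, map_div₀, h, Units.val_pow_eq_pow_val, map_pow, norm_div,
      norm_mul, norm_pow, norm_pow, norm_pow, hη1, hu, one_pow, one_mul, div_self]
    exact pow_ne_zero _ (norm_ne_zero_iff.mpr fun h => y.ne_zero (Subtype.ext h))
  have h1 := (norm_eq_one_iff hs _).mp h0
  refine ⟨ord v u, ?_⟩
  rw [← ord_pow, ← div_mul_cancel α (u ^ ℓ), ord_mul, h1, zero_add]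

/-- The `ℓ`-th power of a Kummer generator of a locally cyclotomic extension is pseudo-infinitesimal
modulo `ℓ`-th powers. -/
theorem IsLocallyCyclotomic.exists_sub_smul_mem (hloc : IsLocallyCyclotomic ℓ K L) (hℓ : ℓ ≠ 2)
    {x : Lˣ} {α : Kˣ} (hx : x ^ ℓ = Units.map (algebraMap K L : K →* L) α) :
    ∃ Y : AdicMul ℓ K, 1 ⊗ₜ Additive.ofMul α - (ℓ : ℤ_[ℓ]) • Y ∈ pseudoInfinitesimal ℓ K := by
  choose η n y hη h using fun l : WildPlace ℓ K => hloc.exists_eq_mul hℓ hx (Quotient.out l)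
  obtain ⟨Y, hY⟩ := exists_map_sub_mem_divisiblePart y
  refine ⟨Y, (Submodule.mem_iInf _).mpr fun l => localize_mem_rootsOfUnity_iff.mpr ?_⟩
  let a : (l.completion)ˣ := Units.map (toLocalField (Quotient.out l) : K →* l.completion) α
  have hω : (a / y l ^ ℓ) ^ ℓ ^ n l = 1 := by
    have h1 : ((a / y l ^ ℓ : (l.completion)ˣ) : l.completion).1 = η l ^ ℓ := by
      rw [Units.val_div_eq_div_val]
      change Quotient.out l α / ((y l : l.completion) : PadicAlgCl ℓ) ^ ℓ = _
      rw [h l, mul_div_cancel_right₀]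
      exact pow_ne_zero _ fun h => (y l).ne_zero (Subtype.ext h)
    refine Units.ext (Subtype.ext ?_)
    rw [Units.val_pow_eq_pow_val]
    change ((a / y l ^ ℓ : (l.completion)ˣ) : l.completion).1 ^ ℓ ^ n l = 1
    rw [h1, ← pow_mul, mul_comm, pow_mul, hη, one_pow]
  have e : AdicMul.map ℓ (toLocalField (Quotient.out l))
      (1 ⊗ₜ Additive.ofMul α - (ℓ : ℤ_[ℓ]) • Y) =
      1 ⊗ₜ Additive.ofMul (a / y l ^ ℓ) - (ℓ : ℤ_[ℓ]) •
        (AdicMul.map ℓ (toLocalField (Quotient.out l)) Y - 1 ⊗ₜ Additive.ofMul (y l)) := by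
    rw [map_sub, map_smul, AdicMul.map_tmul, ofMul_div, ofMul_pow, TensorProduct.tmul_sub,
      TensorProduct.tmul_smul, smul_sub, Nat.cast_smul_eq_nsmul, Nat.cast_smul_eq_nsmul,
      sub_sub_eq_add_sub, sub_add_cancel]
    rfl
  rw [e]
  refine sub_mem (mem_almostDivisiblePart_iff.mpr ⟨n l, ?_⟩)
    (divisiblePart_le (Submodule.smul_mem _ _ (hY l)))
  rw [← Nat.cast_pow]
  have e0 := natCast_smul_tmul (ℓ := ℓ) (ℓ ^ n l) 1 (Additive.ofMul (a / y l ^ ℓ))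
  rw [← ofMul_pow, hω, ofMul_one, TensorProduct.tmul_zero] at e0
  exact e0 ▸ zero_mem _

end LocallyCyclotomic

/-! ### Complex conjugation and the compositum `L = K L₀` -/

section ComplexMultiplication

variable (K₀ K : Type*) [Field K₀] [Field K] [NumberField K] [Algebra K₀ K]
  [NumberField.IsTotallyReal K₀] [NumberField.IsTotallyComplex K]
  [Algebra.IsQuadraticExtension K₀ K]

/-- Complex conjugation on a CM field: it inverts the roots of unity, and `u / τ u` is a root of
unity for every unit `u`. -/
theorem exists_complexConj : ∃ τ : K ≃ₐ[K₀] K, (∀ x, τ (τ x) = x) ∧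
    (∀ (ζ : K) (n : ℕ), n ≠ 0 → ζ ^ n = 1 → τ ζ = ζ⁻¹) ∧
    (∀ u : Kˣ, IsIntegral ℤ (u : K) → IsIntegral ℤ ((u⁻¹ : Kˣ) : K) →
      ∃ n ≠ 0, (u / Units.map ((τ : K →+* K) : K →* K) u) ^ n = 1) := by
  have hCM : NumberField.IsCMField K := NumberField.IsCMField.ofCMExtension K₀ K
  let c := NumberField.IsCMField.complexConj K
  let τ : K ≃ₐ[K₀] K := AlgEquiv.ofRingEquiv (f := (c : K ≃+* K)) fun x => by
    have h := NumberField.CMExtension.equivMaximalRealSubfield_apply K₀ K x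
    change c (algebraMap K₀ K x) = _
    rw [← h]
    exact NumberField.IsCMField.complexConj_apply_eq_self K _
  refine ⟨τ, NumberField.IsCMField.complexConj_apply_apply K, fun ζ n hn h => ?_,
    fun u hu hu' => ?_⟩
  · let φ : K →+* ℂ := Classical.choice inferInstance
    apply φ.injective
    have h1 : φ (τ ζ) = starRingEnd ℂ (φ ζ) :=
      NumberField.IsCMField.complexEmbedding_complexConj K φ ζ
    have h2 : (φ ζ) ^ n = 1 := by rw [← map_pow, h, map_one]
    have h3 : ‖φ ζ‖ = 1 := Complex.norm_eq_one_of_pow_eq_one h2 hn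
    rw [h1, map_inv₀, Complex.inv_eq_conj h3]
  · let v : (𝓞 K)ˣ := ⟨⟨u, hu⟩, ⟨_, hu'⟩, Subtype.ext u.mul_inv, Subtype.ext u.inv_mul⟩
    let ζ := NumberField.IsCMField.unitsMulComplexConjInv K v
    obtain ⟨n, hn, h⟩ := isOfFinOrder_iff_pow_eq_one.mp ((CommGroup.mem_torsion _).mp ζ.2)
    refine ⟨n, hn.ne', Units.ext ?_⟩
    have h1 := congrArg (fun w : (𝓞 K)ˣ => (w : K)) h
    have h2 : ((ζ : (𝓞 K)ˣ) : K) = u / τ u := by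
      rw [NumberField.IsCMField.unitsMulComplexConjInv_apply, div_eq_mul_inv]
      simp
      rfl
    simp only [Units.val_pow_eq_pow_val, Units.val_one, map_pow, map_one] at h1
    rw [Units.val_pow_eq_pow_val, Units.val_div_eq_div_val, Units.val_one]
    exact h2 ▸ h1

end ComplexMultiplication

section Compositum

variable {K₀ K L₀ L : Type*}
  [Field K₀] [Field K] [Field L₀] [Field L] [Algebra K₀ L] [Algebra K L] [Algebra L₀ L]

theorem algEquiv_ext_of_adjoin_eq_top
    (hL : IntermediateField.adjoin K (Set.range (algebraMap L₀ L)) = ⊤) {g h : L ≃ₐ[K₀] L}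
    (h1 : ∀ y : K, g (algebraMap K L y) = h (algebraMap K L y))
    (h2 : ∀ y : L₀, g (algebraMap L₀ L y) = h (algebraMap L₀ L y)) : g = h := by
  ext x
  have hx : x ∈ IntermediateField.adjoin K (Set.range (algebraMap L₀ L)) :=
    hL ▸ IntermediateField.mem_top
  induction hx using IntermediateField.adjoin_induction with
  | mem x hx => obtain ⟨y, rfl⟩ := hx; exact h2 y
  | algebraMap y => exact h1 y
  | add x y _ _ hx hy => rw [map_add, map_add, hx, hy]
  | inv x _ hx => rw [map_inv₀, map_inv₀, hx]
  | mul x y _ _ hx hy => rw [map_mul, map_mul, hx, hy]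

variable [Algebra K₀ K] [Algebra K₀ L₀] [IsScalarTower K₀ K L] [IsScalarTower K₀ L₀ L]

theorem isGalois_of_adjoin_eq_top
    (hL : IntermediateField.adjoin K (Set.range (algebraMap L₀ L)) = ⊤)
    [CharZero K₀] [FiniteDimensional K₀ L] [Normal K₀ K] [Normal K₀ L₀] : IsGalois K₀ L := by
  let A := (IsScalarTower.toAlgHom K₀ K L).fieldRange
  let B := (IsScalarTower.toAlgHom K₀ L₀ L).fieldRange
  have hA : Normal K₀ A :=
    Normal.of_algEquiv (AlgEquiv.ofInjectiveField (IsScalarTower.toAlgHom K₀ K L))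
  have hB : Normal K₀ B :=
    Normal.of_algEquiv (AlgEquiv.ofInjectiveField (IsScalarTower.toAlgHom K₀ L₀ L))
  have hAB : A ⊔ B = ⊤ := by
    rw [eq_top_iff]
    rintro x -
    have hx : x ∈ IntermediateField.adjoin K (Set.range (algebraMap L₀ L)) :=
      hL ▸ IntermediateField.mem_top
    induction hx using IntermediateField.adjoin_induction with
    | mem x hx => obtain ⟨y, rfl⟩ := hx; exact (le_sup_right : B ≤ A ⊔ B) ⟨y, rfl⟩
    | algebraMap y => exact (le_sup_left : A ≤ A ⊔ B) ⟨y, rfl⟩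
    | add x y _ _ hx hy => exact add_mem hx hy
    | inv x _ hx => exact inv_mem hx
    | mul x y _ _ hx hy => exact mul_mem hx hy
  have h1 : Normal K₀ (A ⊔ B : IntermediateField K₀ L) := inferInstance
  rw [hAB] at h1
  have : Normal K₀ L := Normal.of_algEquiv IntermediateField.topEquiv
  exact { }

theorem commute_of_adjoin_eq_top
    (hL : IntermediateField.adjoin K (Set.range (algebraMap L₀ L)) = ⊤)
    [Normal K₀ K] [Normal K₀ L₀] [IsCyclic (K ≃ₐ[K₀] K)] [IsCyclic (L₀ ≃ₐ[K₀] L₀)]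
    (g h : L ≃ₐ[K₀] L) : g * h = h * g := by
  refine algEquiv_ext_of_adjoin_eq_top hL (fun y => ?_) (fun y => ?_)
  · rw [AlgEquiv.mul_apply, AlgEquiv.mul_apply, ← AlgEquiv.restrictNormal_commutes h K,
      ← AlgEquiv.restrictNormal_commutes g K, ← AlgEquiv.restrictNormal_commutes g K,
      ← AlgEquiv.restrictNormal_commutes h K, ← AlgEquiv.mul_apply, ← AlgEquiv.mul_apply,
      (IsCyclic.commGroup (α := K ≃ₐ[K₀] K)).mul_comm]
  · rw [AlgEquiv.mul_apply, AlgEquiv.mul_apply, ← AlgEquiv.restrictNormal_commutes h L₀,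
      ← AlgEquiv.restrictNormal_commutes g L₀, ← AlgEquiv.restrictNormal_commutes g L₀,
      ← AlgEquiv.restrictNormal_commutes h L₀, ← AlgEquiv.mul_apply, ← AlgEquiv.mul_apply,
      (IsCyclic.commGroup (α := L₀ ≃ₐ[K₀] L₀)).mul_comm]

variable (K₀ K L₀ L) in
/-- Restriction to `L₀` of the automorphisms of `L / K`. -/
def restrictHom [Normal K₀ L₀] :
    (L ≃ₐ[K] L) →* (L₀ ≃ₐ[K₀] L₀) :=
  (AlgEquiv.restrictNormalHom L₀).comp (AlgEquiv.restrictScalarsHom K₀)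

theorem restrictHom_injective [Normal K₀ L₀]
    (hL : IntermediateField.adjoin K (Set.range (algebraMap L₀ L)) = ⊤) :
    Function.Injective (restrictHom K₀ K L₀ L) := by
  intro g h e
  have h1 : g.restrictScalars K₀ = h.restrictScalars K₀ := by
    refine algEquiv_ext_of_adjoin_eq_top hL (fun y => ?_) (fun y => ?_)
    · exact (g.commutes y).trans (h.commutes y).symm
    · rw [← AlgEquiv.restrictNormal_commutes (g.restrictScalars K₀),
        ← AlgEquiv.restrictNormal_commutes (h.restrictScalars K₀)]
      exact congrArg (algebraMap L₀ L) (DFunLike.congr_fun e y)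
  exact AlgEquiv.ext fun x => DFunLike.congr_fun h1 x

theorem finrank_of_adjoin_eq_top [CharZero K₀] [FiniteDimensional K₀ L]
    {ℓ : ℕ} [Fact ℓ.Prime] (hℓ : ℓ ≠ 2)
    (hL : IntermediateField.adjoin K (Set.range (algebraMap L₀ L)) = ⊤)
    [Algebra.IsQuadraticExtension K₀ K] [IsGalois K₀ L₀] (hdeg : Module.finrank K₀ L₀ = ℓ) :
    Module.finrank K L = ℓ := by
  have hp : ℓ.Prime := Fact.out
  have : IsGalois K₀ L := isGalois_of_adjoin_eq_top hL
  have : IsGalois K L := IsGalois.tower_top_of_isGalois K₀ K L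
  have : FiniteDimensional K L := .right K₀ K L
  have : FiniteDimensional K₀ L₀ := .left K₀ L₀ L
  have h1 : Module.finrank K L ∣ ℓ := by
    rw [← hdeg, ← IsGalois.card_aut_eq_finrank K L, ← IsGalois.card_aut_eq_finrank K₀ L₀]
    exact Subgroup.card_dvd_of_injective _ (restrictHom_injective (K₀ := K₀) hL)
  refine (hp.eq_one_or_self_of_dvd _ h1).resolve_left fun h2 => ?_
  have h3 := Module.finrank_mul_finrank K₀ K L
  have h4 := Module.finrank_mul_finrank K₀ L₀ L
  rw [h2, Algebra.IsQuadraticExtension.finrank_eq_two, mul_one] at h3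
  rw [hdeg, ← h3] at h4
  exact hℓ ((Nat.prime_dvd_prime_iff_eq hp Nat.prime_two).mp ⟨_, h4.symm⟩)

/-- An involution of `K / K₀` extends to an involution of `L / K₀`. -/
theorem exists_involution [CharZero K₀] [FiniteDimensional K₀ L]
    {ℓ : ℕ} [Fact ℓ.Prime] (hℓ : ℓ ≠ 2)
    (hL : IntermediateField.adjoin K (Set.range (algebraMap L₀ L)) = ⊤)
    [Algebra.IsQuadraticExtension K₀ K] [IsGalois K₀ L₀] (hdeg : Module.finrank K₀ L₀ = ℓ)
    (c : K ≃ₐ[K₀] K) (hc : ∀ y, c (c y) = y) :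
    ∃ τ : L ≃ₐ[K₀] L, (∀ y, τ (τ y) = y) ∧
      ∀ y : K, τ (algebraMap K L y) = algebraMap K L (c y) := by
  have hp : ℓ.Prime := Fact.out
  have : IsGalois K₀ L := isGalois_of_adjoin_eq_top hL
  obtain ⟨τ₀, h0⟩ := AlgEquiv.restrictNormalHom_surjective (F := K₀) (K₁ := K) L c
  have h1 : τ₀ ^ (2 * ℓ) = 1 := by
    have h2 : Nat.card (L ≃ₐ[K₀] L) = 2 * ℓ := by
      rw [IsGalois.card_aut_eq_finrank, ← Module.finrank_mul_finrank K₀ K L,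
        Algebra.IsQuadraticExtension.finrank_eq_two, finrank_of_adjoin_eq_top hℓ hL hdeg]
    rw [← h2]
    exact pow_card_eq_one'
  have hc2 : c ^ 2 = 1 := AlgEquiv.ext hc
  refine ⟨τ₀ ^ ℓ, fun y => ?_, fun y => ?_⟩
  · rw [← AlgEquiv.mul_apply, ← pow_add, ← two_mul, h1, AlgEquiv.one_apply]
  · rw [← AlgEquiv.restrictNormal_commutes]
    congr 1
    have h2 : (τ₀ ^ ℓ).restrictNormal K = c ^ ℓ := by
      rw [← h0, ← map_pow]
      rfl
    rw [h2]
    obtain ⟨m, hm⟩ := hp.odd_of_ne_two hℓ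
    rw [hm, pow_succ, pow_mul, hc2, one_pow, one_mul]

/-- A Kummer generator `x` of `L / K` on which the involution `τ` acts as `x ↦ x⁻¹`. It is
obtained as `y / τ y` from an arbitrary Kummer generator `y`, since `τ` inverts the roots of unity
of order `ℓ`. -/
theorem exists_kummer_generator [CharZero K₀] [FiniteDimensional K₀ L]
    {ℓ : ℕ} [Fact ℓ.Prime] (hℓ : ℓ ≠ 2)
    (hL : IntermediateField.adjoin K (Set.range (algebraMap L₀ L)) = ⊤)
    [Algebra.IsQuadraticExtension K₀ K] [IsGalois K₀ L₀] [IsCyclic (L₀ ≃ₐ[K₀] L₀)]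
    (hdeg : Module.finrank K₀ L₀ = ℓ) {ζ : K} (hζ : IsPrimitiveRoot ζ ℓ)
    {c : K ≃ₐ[K₀] K} (hcζ : c ζ = ζ⁻¹) {τ : L ≃ₐ[K₀] L} (hτ : ∀ y, τ (τ y) = y)
    (hτc : ∀ y : K, τ (algebraMap K L y) = algebraMap K L (c y)) :
    ∃ (x : Lˣ) (α : Kˣ), x ^ ℓ = Units.map (algebraMap K L : K →* L) α ∧
      τ (x : L) = ((x⁻¹ : Lˣ) : L) ∧ ∀ g : L ≃ₐ[K] L, g x = x → g = 1 := by
  have hp : ℓ.Prime := Fact.out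
  have : IsGalois K₀ L := isGalois_of_adjoin_eq_top hL
  have : IsGalois K L := IsGalois.tower_top_of_isGalois K₀ K L
  have : FiniteDimensional K L := .right K₀ K L
  have hd := finrank_of_adjoin_eq_top hℓ hL hdeg
  have : IsCyclic (L ≃ₐ[K] L) := isCyclic_of_injective _ (restrictHom_injective (K₀ := K₀) hL)
  obtain ⟨y, ⟨a, ha⟩, hy⟩ := exists_root_adjoin_eq_top_of_isCyclic K L
    (by rw [hd]; exact ⟨ζ, (mem_primitiveRoots hp.pos).mpr hζ⟩)
  rw [hd] at ha
  have hy0 : y ≠ 0 := by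
    rintro rfl
    have h1 := IntermediateField.finrank_top' (F := K) (E := L)
    rw [← hy, IntermediateField.adjoin_zero, IntermediateField.finrank_bot, hd] at h1
    exact hp.one_lt.ne h1
  have ha0 : a ≠ 0 := by
    rintro rfl
    rw [map_zero] at ha
    exact pow_ne_zero ℓ hy0 ha.symm
  have hτy : τ y ≠ 0 := by simpa using hy0
  have hroot : ∀ w : L, w ^ ℓ = 1 → τ w = w⁻¹ := by
    intro w hw
    obtain ⟨i, -, rfl⟩ := (hζ.map_of_injective (algebraMap K L).injective).eq_pow_of_pow_eq_one hw
    rw [map_pow, hτc, hcζ, map_inv₀, inv_pow]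
  refine ⟨Units.mk0 (y / τ y) (div_ne_zero hy0 hτy),
    Units.mk0 (a / c a) (div_ne_zero ha0 (by simpa using ha0)), Units.ext ?_, ?_, ?_⟩
  · change (y / τ y) ^ ℓ = algebraMap K L (a / c a)
    rw [div_pow, ← map_pow, ← ha, hτc, map_div₀]
  · rw [Units.val_inv_eq_inv_val, Units.val_mk0, map_div₀, hτ, inv_div]
  · intro g hg
    rw [Units.val_mk0] at hg
    obtain ⟨w, hw⟩ : ∃ w, g y = w * y := ⟨g y / y, (div_mul_cancel₀ _ hy0).symm⟩
    have hwℓ : w ^ ℓ = 1 := by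
      have h1 := congrArg g ha
      rw [AlgEquiv.commutes, ha, map_pow, hw, mul_pow] at h1
      exact (mul_eq_right₀ (pow_ne_zero _ hy0)).mp h1.symm
    have hw0 : w ≠ 0 := by
      rintro rfl
      rw [zero_mul] at hw
      exact hy0 (by simpa using hw)
    have h1 : g (τ y) = w⁻¹ * τ y := by
      rw [← hroot w hwℓ, ← map_mul, ← hw]
      exact DFunLike.congr_fun (commute_of_adjoin_eq_top (K₀ := K₀) hL (g.restrictScalars K₀) τ) y
    have h2 : w ^ 2 = 1 := by
      have h3 : w * y / (w⁻¹ * τ y) = w ^ 2 * (y / τ y) := by field_simp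
      rw [map_div₀, h1, hw, h3] at hg
      exact (mul_eq_right₀ (div_ne_zero hy0 hτy)).mp hg
    have h4 : w = 1 := by
      have h5 := pow_gcd_eq_one.mpr ⟨hwℓ, h2⟩
      rwa [((Nat.coprime_primes hp Nat.prime_two).mpr hℓ).gcd_eq_one, pow_one] at h5
    ext x
    have hx : x ∈ IntermediateField.adjoin K {y} := hy ▸ IntermediateField.mem_top
    rw [AlgEquiv.one_apply]
    induction hx using IntermediateField.adjoin_induction with
    | mem x hx => rw [Set.mem_singleton_iff.mp hx, hw, h4, one_mul]
    | algebraMap y => exact g.commutes y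
    | add x y _ _ hx hy => rw [map_add, hx, hy]
    | inv x _ hx => rw [map_inv₀, hx]
    | mul x y _ _ hx hy => rw [map_mul, hx, hy]

end Compositum

/-! ### Roots of unity and the cyclotomic `ℤ_ℓ`-extension -/

section Cyclotomic

variable {ℓ : ℕ} [Fact ℓ.Prime]

/-- An automorphism that is trivial on the cyclotomic `ℤ_ℓ`-extension of `ℚ` acts on the roots of
unity of `ℓ`-power order through a group of exponent `ℓ - 1`. -/
theorem pow_apply_eq_of_forall_mem_ratCyclotomicZl {F Ω : Type*} [Field F] [Field Ω] [CharZero F]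
    [CharZero Ω] [IsAlgClosed Ω] [Algebra F Ω] {ρ : Ω ≃ₐ[F] Ω}
    (hρ : ∀ t ∈ ratCyclotomicZl ℓ Ω, ρ t = t) {ζ : Ω} {k : ℕ} (hζ : ζ ^ ℓ ^ k = 1) :
    (ρ ^ (ℓ - 1)) ζ = ζ := by
  have hp : ℓ.Prime := Fact.out
  have : NeZero (ℓ ^ k) := ⟨pow_ne_zero k hp.ne_zero⟩
  obtain ⟨η, hη⟩ := HasEnoughRootsOfUnity.exists_primitiveRoot Ω (ℓ ^ k)
  let N := IntermediateField.adjoin ℚ {η}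
  have hint : IsIntegral ℚ η := (hη.isIntegral (NeZero.pos _)).tower_top
  have hfin : FiniteDimensional ℚ N := IntermediateField.adjoin.finiteDimensional hint
  let e : N := ⟨η, IntermediateField.mem_adjoin_simple_self ℚ η⟩
  have he : IsPrimitiveRoot e (ℓ ^ k) :=
    IsPrimitiveRoot.of_map_of_injective (f := algebraMap N Ω) hη (algebraMap N Ω).injective
  have hcyc : IsCyclotomicExtension {ℓ ^ k} ℚ N := by
    have h1 := hη.adjoin_isCyclotomicExtension ℚ
    change IsCyclotomicExtension {ℓ ^ k} ℚ N.toSubalgebra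
    rwa [IntermediateField.adjoin_simple_toSubalgebra_of_isAlgebraic hint.isAlgebraic]
  have hgal : IsGalois ℚ N := IsCyclotomicExtension.isGalois {ℓ ^ k} ℚ N
  let f : (N ≃ₐ[ℚ] N) →* (ZMod (ℓ ^ k))ˣ := he.autToPow ℚ
  let q : (N ≃ₐ[ℚ] N) →* (ZMod (ℓ ^ k))ˣ := (powMonoidHom (ℓ - 1)).comp f
  let H := q.ker
  -- the index of `H` is a power of `ℓ`
  have hH : ∃ m, H.index = ℓ ^ m := by
    have hq : IsPGroup ℓ q.range := by
      rintro ⟨_, g, rfl⟩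
      refine ⟨k, Subtype.ext ?_⟩
      change (f g ^ (ℓ - 1)) ^ ℓ ^ k = 1
      obtain ⟨c, hc⟩ : Nat.totient (ℓ ^ k) ∣ (ℓ - 1) * ℓ ^ k := by
        rcases k with _ | k
        · simp
        · rw [Nat.totient_prime_pow_succ hp, mul_comm (ℓ - 1)]
          exact mul_dvd_mul_right (pow_dvd_pow ℓ k.le_succ) _
      rw [← pow_mul, hc, pow_mul, ZMod.pow_totient, one_pow]
    obtain ⟨m, hm⟩ := IsPGroup.iff_card.mp hq
    exact ⟨m, by rw [← hm]; exact Subgroup.index_ker q⟩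
  obtain ⟨m, hm⟩ := hH
  let ρN : N ≃ₐ[ℚ] N := AlgEquiv.restrictNormalHom N (ρ.restrictScalars ℚ)
  have hρN : ∀ t : N, ((ρN t : N) : Ω) = ρ t := fun t =>
    AlgEquiv.restrictNormal_commutes (ρ.restrictScalars ℚ) N t
  have hmem : ρN ∈ H := by
    rw [← IntermediateField.fixingSubgroup_fixedField H]
    rintro ⟨t, ht⟩
    refine Subtype.ext ((hρN t).trans (hρ t ⟨?_, ?_⟩))
    · refine (IntermediateField.adjoin_le_iff.mpr ?_ : N ≤ _) t.2
      rintro _ rfl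
      exact IntermediateField.subset_adjoin _ _ ⟨k, hη.pow_eq_one⟩
    · have h1 : (minpoly ℚ (t : Ω)).natDegree ∣ ℓ ^ m := by
        have h2 : minpoly ℚ (t : Ω) = minpoly ℚ (⟨t, ht⟩ : IntermediateField.fixedField H) :=
          (minpoly.algebraMap_eq (algebraMap N Ω).injective t).trans
            (minpoly.algebraMap_eq (algebraMap (IntermediateField.fixedField H) N).injective
              ⟨t, ht⟩)
        have h3 : Module.finrank ℚ (IntermediateField.fixedField H) = ℓ ^ m := by
          rw [← hm]
          have h4 := Module.finrank_mul_finrank ℚ (IntermediateField.fixedField H) N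
          rw [IntermediateField.finrank_fixedField_eq_card, ← IsGalois.card_aut_eq_finrank ℚ N,
            ← H.index_mul_card] at h4
          exact Nat.eq_of_mul_eq_mul_right Nat.card_pos h4
        rw [h2, ← h3]
        exact minpoly.degree_dvd (Algebra.IsIntegral.isIntegral _)
      obtain ⟨j, -, hj⟩ := (Nat.dvd_prime_pow hp).mp h1
      exact ⟨j, hj⟩
  have h1 : ρN ^ (ℓ - 1) = 1 := he.autToPow_injective ℚ (by
    rw [map_pow, map_one]
    exact hmem)
  have h2 : (ρ ^ (ℓ - 1)) η = η := by
    have h3 := AlgEquiv.restrictNormal_commutes ((ρ.restrictScalars ℚ) ^ (ℓ - 1)) N e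
    have h4 : AlgEquiv.restrictNormal ((ρ.restrictScalars ℚ) ^ (ℓ - 1)) N = 1 := by
      rw [← h1]
      exact map_pow (AlgEquiv.restrictNormalHom N) _ _
    rw [h4] at h3
    have h5 : (ρ.restrictScalars ℚ) ^ (ℓ - 1) = (ρ ^ (ℓ - 1)).restrictScalars ℚ :=
      (map_pow (AlgEquiv.restrictScalarsHom ℚ) ρ (ℓ - 1)).symm
    rw [h5] at h3
    exact h3.symm
  obtain ⟨i, -, rfl⟩ := hη.eq_pow_of_pow_eq_one hζ
  rw [map_pow, h2]

/-- If an involution inverts the `ℓ`-th roots of unity, it inverts the roots of unity of `ℓ`-power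
order. -/
theorem apply_eq_inv_of_pow_eq_one {L : Type*} [Field L] (hℓ : ℓ ≠ 2) {τ : L →+* L}
    (hτ : ∀ y, τ (τ y) = y) {ζ : L} (hζ : IsPrimitiveRoot ζ ℓ) (hτζ : τ ζ = ζ⁻¹) {ξ : L} {k : ℕ}
    (hξ : ξ ^ ℓ ^ k = 1) : τ ξ = ξ⁻¹ := by
  classical
  have hp : ℓ.Prime := Fact.out
  have h0 : ∃ j, (ξ * τ ξ) ^ ℓ ^ j = 1 := ⟨k, by rw [mul_pow, ← map_pow, hξ, map_one, mul_one]⟩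
  suffices h : Nat.find h0 = 0 by
    have h1 := Nat.find_spec h0
    rw [h, pow_zero, pow_one] at h1
    exact eq_inv_of_mul_eq_one_right h1
  by_contra h
  obtain ⟨j, hj⟩ := Nat.exists_eq_succ_of_ne_zero h
  -- otherwise some power of the norm `ξ * τ ξ` would be a nontrivial `ℓ`-th root of unity
  refine Nat.find_min h0 (m := j) (by omega) ?_
  have h1 := Nat.find_spec h0
  rw [hj, pow_succ, pow_mul] at h1
  have h2 : τ ((ξ * τ ξ) ^ ℓ ^ j) = (ξ * τ ξ) ^ ℓ ^ j := by
    rw [map_pow, map_mul, hτ, mul_comm]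
  generalize (ξ * τ ξ) ^ ℓ ^ j = w at h1 h2
  obtain ⟨i, -, rfl⟩ := hζ.eq_pow_of_pow_eq_one h1
  have hζ0 : ζ ≠ 0 := hζ.ne_zero hp.ne_zero
  have h3 : (ζ ^ i) ^ 2 = 1 := by
    rw [map_pow, hτζ, inv_pow] at h2
    nth_rewrite 1 [sq, ← h2]
    exact inv_mul_cancel₀ (pow_ne_zero _ hζ0)
  have h4 := pow_gcd_eq_one.mpr ⟨h1, h3⟩
  rwa [((Nat.coprime_primes hp Nat.prime_two).mpr hℓ).gcd_eq_one, pow_one] at h4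

variable {K₀ K L₀ L : Type*}
  [Field K₀] [Field K] [Field L₀] [Field L] [Algebra K₀ L] [Algebra K L] [Algebra L₀ L]
  [Algebra K₀ K] [Algebra K₀ L₀] [IsScalarTower K₀ K L] [IsScalarTower K₀ L₀ L]

/-- If a Kummer generator of `L / K` is the product of a root of unity of `ℓ`-power order and an
element of `K`, then `L₀ / K₀` is cyclotomic. Indeed an automorphism over the cyclotomic
`ℤ_ℓ`-extension of `K₀` acts on `L ⊆ K(μ_{ℓ^∞})` with order dividing `2 (ℓ - 1)`, hence trivially
on `L₀`. -/
theorem isGloballyCyclotomic_of_eq_mul [CharZero K₀] [FiniteDimensional K₀ L] (hℓ : ℓ ≠ 2)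
    (hL : IntermediateField.adjoin K (Set.range (algebraMap L₀ L)) = ⊤)
    [Algebra.IsQuadraticExtension K₀ K] [IsGalois K₀ L₀] (hdeg : Module.finrank K₀ L₀ = ℓ)
    {x : L} (hx : ∀ g : L ≃ₐ[K] L, g x = x → g = 1) {η : L} {k : ℕ} (hη : η ^ ℓ ^ k = 1) {z : K}
    (h : x = η * algebraMap K L z) : IsGloballyCyclotomic ℓ K₀ L₀ := by
  have hp : ℓ.Prime := Fact.out
  have : FiniteDimensional K₀ L₀ := .left K₀ L₀ L
  have : FiniteDimensional K₀ K := .left K₀ K L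
  have : IsGalois K₀ L := isGalois_of_adjoin_eq_top hL
  let Ω := AlgebraicClosure K₀
  let φ : L →ₐ[K₀] Ω := IsAlgClosed.lift
  let : Algebra L Ω := φ.toAlgebra
  have : IsScalarTower K₀ L Ω := IsScalarTower.of_algebraMap_eq fun y => (φ.commutes y).symm
  refine ⟨φ.comp (IsScalarTower.toAlgHom K₀ L₀ L), ?_⟩
  rintro _ ⟨y, rfl⟩
  let C := cyclotomicZl ℓ K₀ Ω
  have hC : IsGalois C Ω := IsGalois.tower_top_of_isGalois K₀ C Ω
  suffices hfix : φ (algebraMap L₀ L y) ∈ Set.range (algebraMap C Ω) by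
    obtain ⟨t, ht⟩ := hfix
    exact (ht ▸ t.2 : φ (algebraMap L₀ L y) ∈ C)
  rw [InfiniteGalois.mem_range_algebraMap_iff_fixed]
  intro ρ
  let ρ₀ : Ω ≃ₐ[K₀] Ω := ρ.restrictScalars K₀
  have hρ₀ : ∀ t ∈ ratCyclotomicZl ℓ Ω, ρ₀ t = t := fun t ht =>
    ρ.commutes (⟨t, IntermediateField.subset_adjoin _ _ ht⟩ : C)
  let r : L ≃ₐ[K₀] L := AlgEquiv.restrictNormalHom L ρ₀
  have hr : ∀ (n : ℕ) (t : L), φ ((r ^ n) t) = (ρ₀ ^ n) (φ t) := by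
    intro n t
    rw [← map_pow]
    exact AlgEquiv.restrictNormal_commutes (ρ₀ ^ n) L t
  have hrK : ∀ t : K, (r ^ (2 * (ℓ - 1))) (algebraMap K L t) = algebraMap K L t := by
    intro t
    have h1 : Nat.card (K ≃ₐ[K₀] K) = 2 := by
      rw [IsGalois.card_aut_eq_finrank, Algebra.IsQuadraticExtension.finrank_eq_two]
    have h2 : (r ^ (2 * (ℓ - 1))).restrictNormal K = 1 := by
      change AlgEquiv.restrictNormalHom K (r ^ (2 * (ℓ - 1))) = 1
      rw [map_pow, pow_mul, ← h1, pow_card_eq_one', one_pow]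
    rw [← AlgEquiv.restrictNormal_commutes, h2, AlgEquiv.one_apply]
  have hrη : (r ^ (2 * (ℓ - 1))) η = η := by
    refine φ.injective (?_ : φ _ = φ _)
    have h1 : (ρ₀ ^ (ℓ - 1)) (φ η) = φ η :=
      pow_apply_eq_of_forall_mem_ratCyclotomicZl (k := k) hρ₀ (by rw [← map_pow, hη, map_one])
    rw [hr, mul_comm, pow_mul, sq, AlgEquiv.mul_apply, h1, h1]
  have h1 : r ^ (2 * (ℓ - 1)) = 1 := by
    let g : L ≃ₐ[K] L := AlgEquiv.ofRingEquiv
      (f := ((r ^ (2 * (ℓ - 1)) : L ≃ₐ[K₀] L) : L ≃+* L)) hrK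
    have hg : g = 1 := hx g (by
      change (r ^ (2 * (ℓ - 1))) x = x
      rw [h, map_mul, hrK, hrη])
    exact AlgEquiv.ext fun t => DFunLike.congr_fun hg t
  have h2 : r ^ (2 * ℓ) = 1 := by
    have h3 : Nat.card (L ≃ₐ[K₀] L) = 2 * ℓ := by
      rw [IsGalois.card_aut_eq_finrank, ← Module.finrank_mul_finrank K₀ K L,
        Algebra.IsQuadraticExtension.finrank_eq_two, finrank_of_adjoin_eq_top hℓ hL hdeg]
    rw [← h3]
    exact pow_card_eq_one'
  have h3 : r ^ 2 = 1 := by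
    have h4 : 2 * ℓ = 2 * (ℓ - 1) + 2 := by have := hp.one_lt; omega
    rwa [h4, pow_add, h1, one_mul] at h2
  have h4 : AlgEquiv.restrictNormalHom L₀ r = 1 := by
    have h5 : (AlgEquiv.restrictNormalHom L₀ r) ^ ℓ = 1 := by
      rw [← hdeg, ← IsGalois.card_aut_eq_finrank, pow_card_eq_one']
    have h6 : (AlgEquiv.restrictNormalHom L₀ r) ^ 2 = 1 := by rw [← map_pow, h3, map_one]
    have h7 := pow_gcd_eq_one.mpr ⟨h5, h6⟩
    rwa [((Nat.coprime_primes hp Nat.prime_two).mpr hℓ).gcd_eq_one, pow_one] at h7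
  have h5 := hr 1 (algebraMap L₀ L y)
  rw [pow_one, pow_one] at h5
  have h6 : r (algebraMap L₀ L y) = algebraMap L₀ L y := by
    rw [← AlgEquiv.restrictNormal_commutes]
    exact congrArg _ (DFunLike.congr_fun h4 y)
  rw [h6] at h5
  exact h5.symm

/-- Galois descent for `ℛ`. -/
theorem AdicMul.exists_map_eq_of_fixed {σ : L ≃ₐ[K] L}
    (hσ : ∀ y, σ y = y → y ∈ Set.range (algebraMap K L)) {x : AdicMul ℓ L}
    (h : AdicMul.map ℓ (σ : L →+* L) x = x) :
    ∃ y : AdicMul ℓ K, AdicMul.map ℓ (algebraMap K L) y = x := by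
  let f : Additive Lˣ →+ Additive Lˣ :=
    MonoidHom.toAdditive (Units.map ((σ : L →+* L) : L →* L)) - AddMonoidHom.id _
  have hf : ∀ y : AdicMul ℓ L, f.toIntLinearMap.baseChange ℤ_[ℓ] y =
      AdicMul.map ℓ (σ : L →+* L) y - y := by
    intro y
    induction y using TensorProduct.induction_on with
    | zero => simp
    | tmul c u => exact TensorProduct.tmul_sub _ _ _
    | add y z hy hz => rw [map_add, map_add, hy, hz]; abel
  obtain ⟨y, rfl⟩ := exists_of_baseChange_eq_zero f (x := x) (by rw [hf, h, sub_self])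
  clear h
  induction y using TensorProduct.induction_on with
  | zero => exact ⟨0, by simp⟩
  | tmul c u =>
    have h1 : σ (u.1.toMul : L) = u.1.toMul :=
      congrArg (fun w : Additive Lˣ => ((w.toMul : Lˣ) : L)) (sub_eq_zero.mp u.2)
    obtain ⟨t, ht⟩ := hσ _ h1
    have ht0 : t ≠ 0 := by
      rintro rfl
      rw [map_zero] at ht
      exact u.1.toMul.ne_zero ht.symm
    refine ⟨c ⊗ₜ Additive.ofMul (Units.mk0 t ht0), ?_⟩
    rw [AdicMul.map_tmul]
    exact congrArg (fun w : Additive Lˣ => (c ⊗ₜ w : AdicMul ℓ L))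
      (Units.ext ht : Units.map (algebraMap K L : K →* L) (Units.mk0 t ht0) = u.1.toMul)
  | add y z hy hz =>
    obtain ⟨a, ha⟩ := hy
    obtain ⟨b, hb⟩ := hz
    exact ⟨a + b, by rw [map_add, map_add, ha, hb]⟩

end Cyclotomic

/-! ### Capitulation -/

section Capitulation

variable {ℓ : ℕ} [Fact ℓ.Prime] {K L : Type*} [Field K] [NumberField K] [Field L] [NumberField L]
  [Algebra K L]

theorem divisor_smul_cancel {F : Type*} [Field F] {c : ℤ_[ℓ]} (hc : c ≠ 0) {a b : Divisor ℓ F}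
    (h : c • a = c • b) :
    a = b :=
  Finsupp.ext fun v => mul_left_cancel₀ hc (DFunLike.congr_fun h v)

theorem bpCapitulates_iff {a : Divisor ℓ K} :
    BPCapitulates ℓ L a ↔ a ∉ bpPrincipal ℓ K ∧ extendDivisor ℓ K L a ∈ bpPrincipal ℓ L := by
  rw [BPCapitulates, ne_eq, Submodule.Quotient.mk_eq_zero, Submodule.Quotient.mk_eq_zero]

theorem degree_toLog_div_of_mem_pseudoInfinitesimal {x : AdicMul ℓ K}
    (hx : x ∈ pseudoInfinitesimal ℓ K) :
    LogDivisor.degree ℓ K (Divisor.toLog ℓ K (div ℓ K x)) = 0 := by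
  rw [← logDiv_of_mem_pseudoInfinitesimal hx, degree_logDiv]

theorem not_mem_bpPrincipal {a : Divisor ℓ K} (h : ∀ y, logDiv ℓ K y ≠ Divisor.toLog ℓ K a) :
    a ∉ bpPrincipal ℓ K := by
  rintro ⟨y, hy, rfl⟩
  exact h y (logDiv_of_mem_pseudoInfinitesimal hy)

/-- A divisor capitulating in the pseudo-infinitesimal sense capitulates logarithmically as soon as
a multiple is the divisor of a pseudo-infinitesimal element of `K` (which forces its degree to be
zero) and its logarithmic class is not trivial. -/
theorem logCapitulates_of_mem {a : Divisor ℓ K} {x : AdicMul ℓ L}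
    (hx : x ∈ pseudoInfinitesimal ℓ L) (hxa : div ℓ L x = extendDivisor ℓ K L a)
    {n : ℤ_[ℓ]} (hn : n ≠ 0) {y : AdicMul ℓ K} (hy : y ∈ pseudoInfinitesimal ℓ K)
    (hya : div ℓ K y = n • a) (h : ∀ y, logDiv ℓ K y ≠ Divisor.toLog ℓ K a) :
    LogCapitulates ℓ L a := by
  have h1 : LogDivisor.degree ℓ K (Divisor.toLog ℓ K a) = 0 := by
    have h2 := degree_toLog_div_of_mem_pseudoInfinitesimal hy
    rw [hya, map_smul, map_smul, padicInt_smul_def] at h2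
    exact (mul_eq_zero.mp h2).resolve_left fun h => hn (Subtype.ext h)
  have h2 : logDiv ℓ L x = Divisor.toLog ℓ L (extendDivisor ℓ K L a) := by
    rw [logDiv_of_mem_pseudoInfinitesimal hx, hxa]
  refine ⟨⟨h1, fun h3 => ?_⟩, ⟨?_, ?_⟩⟩
  · rw [Submodule.Quotient.mk_eq_zero] at h3
    obtain ⟨y, hy⟩ := h3
    exact h y hy
  · rw [LinearMap.mem_ker, ← h2, degree_logDiv]
  · rw [Submodule.Quotient.mk_eq_zero]
    exact ⟨x, h2⟩

variable {c : K ≃+* K}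

theorem AdicMul.map_involution {F : Type*} [Field F] {τ : F ≃+* F} (hτ : ∀ x, τ (τ x) = x)
    (x : AdicMul ℓ F) :
    AdicMul.map ℓ (τ : F →+* F) (AdicMul.map ℓ (τ : F →+* F) x) = x := by
  rw [AdicMul.map_map, show (τ : F →+* F).comp (τ : F →+* F) = RingHom.id F from RingHom.ext hτ,
    AdicMul.map_id]

theorem AdicMul.map_one_tmul_eq_neg {F : Type*} [Field F] {τ : F ≃+* F} {u : Fˣ}
    (h : Units.map (τ : F →* F) u = u⁻¹) :
    AdicMul.map ℓ (τ : F →+* F) (1 ⊗ₜ Additive.ofMul u) = -(1 ⊗ₜ Additive.ofMul u) := by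
  rw [AdicMul.map_tmul, toMul_ofMul, ← TensorProduct.tmul_neg, ← ofMul_inv, ← h]
  rfl

/-- The odd part of an element with trivial logarithmic divisor is a root of unity. -/
theorem GrossKuzmin.sub_map_mem_torsion (hℓ : ℓ ≠ 2) (hGK : GrossKuzmin ℓ K)
    (hc : ∀ x, c (c x) = x)
    (hcu : ∀ u : Kˣ, IsIntegral ℤ (u : K) → IsIntegral ℤ ((u⁻¹ : Kˣ) : K) →
      ∃ n ≠ 0, (u / Units.map (c : K →* K) u) ^ n = 1)
    {w : AdicMul ℓ K} (hw : logDiv ℓ K w = 0) :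
    w - AdicMul.map ℓ (c : K →+* K) w ∈ Submodule.torsion ℤ_[ℓ] (AdicMul ℓ K) := by
  refine hGK.mem_torsion hℓ hc hcu ?_ ?_
  · rw [map_sub, hw, logDiv_map_eq_zero c hw, sub_zero]
  · rw [map_sub, AdicMul.map_involution hc, neg_sub]

/-- The correcting element of `exists_sub_smul_mem` can be chosen odd under complex conjugation,
when `α` is odd. -/
theorem IsLocallyCyclotomic.exists_odd_sub_smul_mem (hloc : IsLocallyCyclotomic ℓ K L)
    (hℓ : ℓ ≠ 2) {x : Lˣ} {α : Kˣ} (hx : x ^ ℓ = Units.map (algebraMap K L : K →* L) α)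
    (hc : ∀ x, c (c x) = x) (hcα : Units.map (c : K →* K) α = α⁻¹) :
    ∃ Y : AdicMul ℓ K, 1 ⊗ₜ Additive.ofMul α - (ℓ : ℤ_[ℓ]) • Y ∈ pseudoInfinitesimal ℓ K ∧
      AdicMul.map ℓ (c : K →+* K) Y = -Y := by
  obtain ⟨Y, hY⟩ := hloc.exists_sub_smul_mem hℓ hx
  obtain ⟨u, hu⟩ := isUnit_two (ℓ := ℓ) hℓ
  have hu2 : (2 : ℤ_[ℓ]) * (u⁻¹ : ℤ_[ℓ]ˣ) = 1 := by rw [← hu, u.mul_inv]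
  have h1 := map_mem_pseudoInfinitesimal (c : K →+* K) hY
  rw [map_sub, map_smul, AdicMul.map_one_tmul_eq_neg hcα] at h1
  refine ⟨((u⁻¹ : ℤ_[ℓ]ˣ) : ℤ_[ℓ]) • (Y - AdicMul.map ℓ (c : K →+* K) Y), ?_, ?_⟩
  · rw [← smul_mem_pseudoInfinitesimal (two_ne_zero (α := ℤ_[ℓ]))]
    convert sub_mem hY h1 using 1
    rw [smul_sub, smul_comm (2 : ℤ_[ℓ]), ← mul_smul (2 : ℤ_[ℓ]), hu2, one_smul, two_smul, smul_sub]
    abel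
  · rw [map_smul, map_sub, AdicMul.map_involution hc, ← smul_neg, neg_sub]

/-- The divisor of a Kummer generator of a locally cyclotomic extension, divided by `ℓ` and
corrected at the places above `ℓ`, is a capitulating divisor. Its logarithmic class is not
trivial: otherwise the conjecture of Gross–Kuz'min shows that the Kummer generator is the product
of a root of unity and an element of `K`. -/
theorem IsLocallyCyclotomic.isOfClassType (hloc : IsLocallyCyclotomic ℓ K L) (hℓ : ℓ ≠ 2)
    (hGK : GrossKuzmin ℓ K) (hc : ∀ x, c (c x) = x)
    (hcu : ∀ u : Kˣ, IsIntegral ℤ (u : K) → IsIntegral ℤ ((u⁻¹ : Kˣ) : K) →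
      ∃ n ≠ 0, (u / Units.map (c : K →* K) u) ^ n = 1)
    {x : Lˣ} {α : Kˣ} (hx : x ^ ℓ = Units.map (algebraMap K L : K →* L) α)
    (hcα : Units.map (c : K →* K) α = α⁻¹)
    (hne : ∀ (η : L) (k : ℕ) (z : K), η ^ ℓ ^ k = 1 → (x : L) ≠ η * algebraMap K L z) :
    IsOfClassType ℓ K L := by
  have hp : ℓ.Prime := Fact.out
  have hl0 : (ℓ : ℤ_[ℓ]) ≠ 0 := by exact_mod_cast hp.ne_zero
  obtain ⟨Y, hY, hcY⟩ := hloc.exists_odd_sub_smul_mem hℓ hx hc hcα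
  choose b hb using hloc.dvd_ord hℓ hx
  have hfin : (Function.support fun v : TamePlace ℓ K => (b v.1 : ℤ_[ℓ])).Finite := by
    refine (div ℓ K (1 ⊗ₜ Additive.ofMul α)).support.finite_toSet.subset fun v hv => ?_
    rw [Finset.mem_coe, Finsupp.mem_support_iff, div_one_tmul_apply, hb, Int.cast_mul]
    exact mul_ne_zero (by exact_mod_cast hp.ne_zero) hv
  let a₀ : Divisor ℓ K := Finsupp.ofSupportFinite _ hfin
  have ha₀ : (ℓ : ℤ_[ℓ]) • a₀ = div ℓ K (1 ⊗ₜ Additive.ofMul α) := by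
    ext v
    rw [div_one_tmul_apply, hb, Int.cast_mul, Int.cast_natCast]
    rfl
  let a := a₀ - div ℓ K Y
  let A : AdicMul ℓ K := 1 ⊗ₜ Additive.ofMul α - (ℓ : ℤ_[ℓ]) • Y
  have hA : div ℓ K A = (ℓ : ℤ_[ℓ]) • a := by rw [map_sub, map_smul, ← ha₀, smul_sub]
  let X : AdicMul ℓ L := 1 ⊗ₜ Additive.ofMul x - AdicMul.map ℓ (algebraMap K L) Y
  have hXA : (ℓ : ℤ_[ℓ]) • X = AdicMul.map ℓ (algebraMap K L) A := by
    rw [map_sub, map_smul, AdicMul.map_tmul, toMul_ofMul, ← hx, smul_sub, ofMul_pow,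
      TensorProduct.tmul_smul, Nat.cast_smul_eq_nsmul]
  have hXmem : X ∈ pseudoInfinitesimal ℓ L := by
    rw [← smul_mem_pseudoInfinitesimal hl0, hXA]
    exact map_mem_pseudoInfinitesimal _ hY
  have hXa : div ℓ L X = extendDivisor ℓ K L a := by
    refine divisor_smul_cancel hl0 ?_
    rw [← map_smul, hXA, div_map, hA, map_smul]
  have hlog : ∀ y, logDiv ℓ K y ≠ Divisor.toLog ℓ K a := by
    intro y hy
    have h1 : logDiv ℓ K (A - (ℓ : ℤ_[ℓ]) • y) = 0 := by
      rw [map_sub, map_smul, hy, logDiv_of_mem_pseudoInfinitesimal hY, hA, map_smul, sub_self]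
    have h2 := hGK.sub_map_mem_torsion hℓ hc hcu h1
    obtain ⟨ζ, k, hζ, h4⟩ := AdicMul.exists_of_mem_torsion h2
    have h5 : (1 ⊗ₜ Additive.ofMul (α ^ 2 / ζ) : AdicMul ℓ K) = (ℓ : ℤ_[ℓ]) ^ 1 •
        ((2 : ℤ_[ℓ]) • Y + (y - AdicMul.map ℓ (c : K →+* K) y)) := by
      rw [ofMul_div, TensorProduct.tmul_sub, ← h4, map_sub, map_sub, map_smul, map_smul,
        AdicMul.map_one_tmul_eq_neg hcα, hcY, ofMul_pow, TensorProduct.tmul_smul, pow_one,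
        two_smul, two_smul]
      simp only [A, smul_add, smul_sub, smul_neg]
      abel
    obtain ⟨β, hβ⟩ := exists_pow_smul_eq h5
    -- `α ^ 2 = ζ * β ^ ℓ`; as `ℓ` is odd, `α` is itself a root of unity times an `ℓ`-th power
    have h6 : α ^ 2 = ζ * β.toMul ^ ℓ := by
      have h7 : α ^ 2 / ζ = β.toMul ^ ℓ ^ 1 := congrArg Additive.toMul hβ
      rw [pow_one] at h7
      rw [← h7, mul_div_cancel]
    obtain ⟨m, hm⟩ := hp.odd_of_ne_two hℓ
    let γ : Kˣ := β.toMul ^ (m + 1) / α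
    have h7 : α = ζ ^ (m + 1) * γ ^ ℓ := by
      have h8 : α ^ (ℓ + 1) = ζ ^ (m + 1) * (β.toMul ^ (m + 1)) ^ ℓ := by
        have h9 : ℓ + 1 = 2 * (m + 1) := by omega
        rw [h9, pow_mul, h6, mul_pow, ← pow_mul, ← pow_mul, mul_comm ℓ]
      rw [div_pow, mul_div_assoc', ← h8, pow_succ, mul_comm, mul_div_assoc, div_self', mul_one]
    refine hne ((x : L) / algebraMap K L γ) (k + 1) γ ?_ ?_
    · have h8 : ((x : L) / algebraMap K L γ) ^ ℓ = algebraMap K L (ζ ^ (m + 1) : Kˣ) := by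
        have h9 : (x : L) ^ ℓ = algebraMap K L α := congrArg Units.val hx
        rw [div_pow, h9, ← map_pow, ← map_div₀]
        congr 1
        rw [div_eq_iff (pow_ne_zero _ γ.ne_zero)]
        exact congrArg Units.val h7
      rw [pow_succ, mul_comm, pow_mul, h8, ← map_pow, ← Units.val_pow_eq_pow_val, ← pow_mul,
        mul_comm, pow_mul, hζ, one_pow, Units.val_one, map_one]
    · rw [div_mul_cancel₀]
      simp
  exact ⟨a, bpCapitulates_iff.mpr ⟨not_mem_bpPrincipal hlog, X, hXmem, hXa⟩,
    logCapitulates_of_mem hXmem hXa hl0 hY hA hlog⟩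

/-- Let `a` become the divisor of `x ∈ ℛ_L^{bp}`. Under the Leopoldt conjecture `σ x - x` is a root
of unity, so that a multiple of `a` is the divisor of an element of `ℛ_K^{bp}`, and `x + τ x` is
defined over `K`. If `a` were the logarithmic divisor of `y ∈ ℛ_K`, the conjecture of
Gross–Kuz'min would make the odd part of `y` pseudo-infinitesimal, while its even part has the
divisor of `x + τ x`. Thus `a` would be trivial in `Cl_K^{bp}`. -/
theorem logCapitulates_of_bpCapitulates (hℓ : ℓ ≠ 2) (hGK : GrossKuzmin ℓ K) (hLeo : Leopoldt ℓ L)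
    (hc : ∀ x, c (c x) = x)
    (hcu : ∀ u : Kˣ, IsIntegral ℤ (u : K) → IsIntegral ℤ ((u⁻¹ : Kˣ) : K) →
      ∃ n ≠ 0, (u / Units.map (c : K →* K) u) ^ n = 1)
    {τ : L ≃+* L} (hτc : ∀ y : K, τ (algebraMap K L y) = algebraMap K L (c y))
    (hτζ : ∀ (ξ : L) (k : ℕ), ξ ^ ℓ ^ k = 1 → τ ξ = ξ⁻¹)
    {σ : L ≃ₐ[K] L} (hσ : ∀ y, σ y = y → y ∈ Set.range (algebraMap K L))
    (hστ : ∀ y, σ (τ y) = τ (σ y)) {a : Divisor ℓ K} (ha : BPCapitulates ℓ L a) :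
    LogCapitulates ℓ L a := by
  have hp : ℓ.Prime := Fact.out
  have hl0 : (ℓ : ℤ_[ℓ]) ≠ 0 := by exact_mod_cast hp.ne_zero
  obtain ⟨hane, x, hx, hxa⟩ := bpCapitulates_iff.mp ha
  let S := AdicMul.map ℓ (σ : L →+* L)
  let T := AdicMul.map ℓ (τ : L →+* L)
  let C := AdicMul.map ℓ (c : K →+* K)
  let j := AdicMul.map ℓ (algebraMap K L)
  have hSj : ∀ y, S (j y) = j y := fun y => by
    rw [AdicMul.map_map, show (σ : L →+* L).comp (algebraMap K L) = algebraMap K L from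
      RingHom.ext σ.commutes]
  have hTj : ∀ y, T (j y) = j (C y) := fun y => by
    rw [AdicMul.map_map, AdicMul.map_map, show (τ : L →+* L).comp (algebraMap K L) =
      (algebraMap K L).comp (c : K →+* K) from RingHom.ext hτc]
  have hST : ∀ y, S (T y) = T (S y) := fun y => by
    rw [AdicMul.map_map, AdicMul.map_map, show (σ : L →+* L).comp (τ : L →+* L) =
      (τ : L →+* L).comp (σ : L →+* L) from RingHom.ext hστ]
  -- a multiple of `a` is principal, so that `σ x - x` is a unit, hence a root of unity
  have htors : S x - x ∈ Submodule.torsion ℤ_[ℓ] (AdicMul ℓ L) := by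
    obtain ⟨n, z, hn, hz⟩ := exists_div_eq_smul a
    have h1 : div ℓ L ((n : ℤ_[ℓ]) • x - j z) = 0 := by
      rw [map_sub, map_smul, hxa, div_map, hz, map_smul, sub_self]
    have h2 := div_map_eq_zero (σ : L →+* L) h1
    refine hLeo.mem_torsion (sub_mem (map_mem_pseudoInfinitesimal _ hx) hx) ?_
    refine divisor_smul_cancel (c := (n : ℤ_[ℓ])) (by exact_mod_cast hn) ?_
    rw [← map_smul, smul_zero]
    have h3 : (n : ℤ_[ℓ]) • (S x - x) = S ((n : ℤ_[ℓ]) • x - j z) - ((n : ℤ_[ℓ]) • x - j z) := by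
      rw [map_sub, map_smul, hSj, smul_sub]
      abel
    rw [h3, map_sub, h1, h2, sub_zero]
  obtain ⟨k, hk⟩ := mem_torsion_iff.mp htors
  have hk0 : (ℓ : ℤ_[ℓ]) ^ k ≠ 0 := pow_ne_zero k hl0
  obtain ⟨A, hA⟩ := AdicMul.exists_map_eq_of_fixed hσ (x := (ℓ : ℤ_[ℓ]) ^ k • x) (by
    rw [map_smul, ← sub_eq_zero, ← smul_sub]
    exact hk)
  have hAmem : A ∈ pseudoInfinitesimal ℓ K :=
    mem_pseudoInfinitesimal_of_map (L := L) (hA ▸ Submodule.smul_mem _ _ hx)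
  have hAa : div ℓ K A = (ℓ : ℤ_[ℓ]) ^ k • a := by
    refine extendDivisor_injective (L := L) ?_
    rw [← div_map, hA, map_smul, hxa, map_smul]
  -- as `τ` inverts roots of unity, the sum `x + τ x` is defined over `K`
  obtain ⟨u, hu⟩ : ∃ u, j u = x + T x := by
    refine AdicMul.exists_map_eq_of_fixed hσ ?_
    obtain ⟨ξ, n, hξ, h1⟩ := AdicMul.exists_of_mem_torsion htors
    have h2 : T (S x - x) = -(S x - x) := by
      rw [h1, AdicMul.map_tmul, ← TensorProduct.tmul_neg, ← ofMul_inv]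
      congr 2
      refine Units.ext ?_
      rw [Units.val_inv_eq_inv_val]
      exact hτζ ξ n (by simpa using congrArg Units.val hξ)
    change S (x + T x) = _
    rw [map_add, hST, ← sub_eq_zero]
    rw [map_sub, ← sub_eq_zero] at h2
    rw [← h2]
    abel
  have humem : u ∈ pseudoInfinitesimal ℓ K := by
    refine mem_pseudoInfinitesimal_of_map (L := L) (?_ : j u ∈ _)
    rw [hu]
    exact add_mem hx (map_mem_pseudoInfinitesimal _ hx)
  refine logCapitulates_of_mem hx hxa hk0 hAmem hAa fun y hy => hane ?_
  have hya : div ℓ K y = a := congrArg Prod.fst hy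
  -- the odd part of `y` is pseudo-infinitesimal
  have h1 : y - C y ∈ pseudoInfinitesimal ℓ K := by
    have h2 : logDiv ℓ K ((ℓ : ℤ_[ℓ]) ^ k • y - A) = 0 := by
      rw [map_sub, map_smul, hy, logDiv_of_mem_pseudoInfinitesimal hAmem, hAa, map_smul, sub_self]
    have h3 := torsion_le_pseudoInfinitesimal (hGK.sub_map_mem_torsion hℓ hc hcu h2)
    rw [← smul_mem_pseudoInfinitesimal hk0]
    convert add_mem h3 (sub_mem hAmem (map_mem_pseudoInfinitesimal (c : K →+* K) hAmem)) using 1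
    rw [map_sub, map_smul, smul_sub]
    abel
  -- the even part of `y` has the same divisor as `u`
  have h2 : div ℓ K (y + C y) = div ℓ K u := by
    refine extendDivisor_injective (L := L) ?_
    have h3 : div ℓ L (j y - x) = 0 := by rw [map_sub, div_map, hya, hxa, sub_self]
    have h4 := div_map_eq_zero (τ : L →+* L) h3
    rw [← div_map, ← div_map, ← sub_eq_zero, ← map_sub]
    change div ℓ L (j (y + C y) - j u) = 0
    have h5 : j (y + C y) - j u = (j y - x) + T (j y - x) := by
      rw [hu, map_sub, hTj, map_add]
      abel
    rw [h5, map_add, h3, h4, add_zero]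
  have h3 : (2 : ℤ_[ℓ]) • a ∈ bpPrincipal ℓ K := by
    refine ⟨(y - C y) + u, add_mem h1 humem, ?_⟩
    rw [map_add, ← h2, ← map_add, sub_add_add_cancel, ← two_smul ℤ_[ℓ], map_smul, hya]
  obtain ⟨w, hw⟩ := isUnit_two (ℓ := ℓ) hℓ
  have h4 := Submodule.smul_mem _ ((w⁻¹ : ℤ_[ℓ]ˣ) : ℤ_[ℓ]) h3
  rwa [← hw, ← mul_smul, w.inv_mul, one_smul] at h4

end Capitulation

end LogClasses

end

theorem mainTheorem11 (ℓ : ℕ) [Fact ℓ.Prime] (hℓ : ℓ ≠ 2)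
    (K₀ K L₀ L : Type*)
    [Field K₀] [NumberField K₀] [Field K] [NumberField K]
    [Field L₀] [NumberField L₀] [Field L] [NumberField L]
    [Algebra K₀ K] [Algebra K₀ L₀] [Algebra K₀ L] [Algebra K L] [Algebra L₀ L]
    [IsScalarTower K₀ K L] [IsScalarTower K₀ L₀ L]
    -- `K` is a CM field with maximal real subfield `K₀`, containing the `ℓ`-th roots of unity
    [NumberField.IsTotallyReal K₀] [NumberField.IsTotallyComplex K]
    [Algebra.IsQuadraticExtension K₀ K]
    (hμ : ∃ ζ : K, IsPrimitiveRoot ζ ℓ)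
    -- `L₀/K₀` is cyclic of degree `ℓ`, not cyclotomic, and `L = K L₀` is locally cyclotomic
    [IsGalois K₀ L₀] [IsCyclic (L₀ ≃ₐ[K₀] L₀)] (hdeg : Module.finrank K₀ L₀ = ℓ)
    (hcyc : ¬ LogClasses.IsGloballyCyclotomic ℓ K₀ L₀)
    (hL : IntermediateField.adjoin K (Set.range (algebraMap L₀ L)) = ⊤)
    (hloc : LogClasses.IsLocallyCyclotomic ℓ K L)
    (hGK : LogClasses.GrossKuzmin ℓ K) :
    LogClasses.IsOfClassType ℓ K L ∧
      (LogClasses.Leopoldt ℓ L → ∀ a : LogClasses.Divisor ℓ K,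
        LogClasses.BPCapitulates ℓ L a → LogClasses.LogCapitulates ℓ L a) := by
  obtain ⟨ζ, hζ⟩ := hμ
  have hp : ℓ.Prime := Fact.out
  have : FiniteDimensional K₀ L := Module.Finite.of_restrictScalars_finite ℚ K₀ L
  have : IsGalois K₀ L := LogClasses.isGalois_of_adjoin_eq_top hL
  have : IsGalois K L := IsGalois.tower_top_of_isGalois K₀ K L
  obtain ⟨c, hc, hcζ, hcu⟩ := LogClasses.exists_complexConj K₀ K
  obtain ⟨τ, hτ, hτc⟩ := LogClasses.exists_involution hℓ hL hdeg c hc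
  obtain ⟨x, α, hx, hτx, hxg⟩ := LogClasses.exists_kummer_generator hℓ hL hdeg hζ
    (hcζ ζ ℓ hp.ne_zero hζ.pow_eq_one) hτ hτc
  constructor
  · refine hloc.isOfClassType (c := (c : K ≃+* K)) hℓ hGK hc hcu hx (Units.ext ?_)
      fun η k z hη h => hcyc ?_
    · apply (algebraMap K L).injective
      have h1 : (x : L) ^ ℓ = algebraMap K L α := congrArg Units.val hx
      change algebraMap K L (c α) = _
      rw [← hτc, ← h1, map_pow, hτx, Units.val_inv_eq_inv_val, Units.val_inv_eq_inv_val, map_inv₀,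
        ← h1, inv_pow]
    · exact LogClasses.isGloballyCyclotomic_of_eq_mul hℓ hL hdeg hxg hη h
  · intro hLeo a ha
    have hζ' : IsPrimitiveRoot (algebraMap K L ζ) ℓ :=
      hζ.map_of_injective (algebraMap K L).injective
    have : IsCyclic (L ≃ₐ[K] L) :=
      isCyclic_of_injective _ (LogClasses.restrictHom_injective (K₀ := K₀) hL)
    obtain ⟨σ, hσ⟩ := IsCyclic.exists_generator (α := L ≃ₐ[K] L)
    refine LogClasses.logCapitulates_of_bpCapitulates (c := (c : K ≃+* K)) (τ := (τ : L ≃+* L))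
      (σ := σ) hℓ hGK hLeo hc hcu hτc (fun ξ k hξ => ?_) (fun y hy => ?_) (fun y => ?_) ha
    · exact LogClasses.apply_eq_inv_of_pow_eq_one (τ := (τ : L →+* L)) hℓ hτ hζ'
        (by
          change τ (algebraMap K L ζ) = _
          rw [hτc, hcζ ζ ℓ hp.ne_zero hζ.pow_eq_one, map_inv₀]) hξ
    · rw [IsGalois.mem_range_algebraMap_iff_fixed]
      intro g
      have h : Subgroup.zpowers σ ≤ MulAction.stabilizer (L ≃ₐ[K] L) y := by
        rw [Subgroup.zpowers_le]
        exact hy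
      exact h (hσ g)
    · exact DFunLike.congr_fun
        (LogClasses.commute_of_adjoin_eq_top (K₀ := K₀) hL (σ.restrictScalars K₀) τ) y
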